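/- Let $M$ be a smooth finite-dimensional Hausdorff manifold, $\psi\colon M\to\mathbb R$ a smooth function and $f_0,f_1$ smooth vector fields on $M$. For a vector field $f$ on $M$ let $F(\ell)=\langle \ell,f(\pi\ell)\rangle$, $\ell\in T^*M$, be its Hamiltonian lift ($\pi\colon T^*M\to M$ the projection), and set $f_{01}=[f_0,f_1]$, $f_{101}=[f_1,f_{01}]$, with lifts $F_0,F_1,F_{01},F_{101}$. Let $\boldsymbol\sigma=d\varsigma$, $\varsigma_\ell=\ell\circ\pi_*$, be the canonical symplectic form; the Hamiltonian vector field $\vec F$ of a function $F$ on $T^*M$ is defined by $\langle dF(\ell),\cdot\rangle=\boldsymbol\sigma_\ell(\cdot,\vec F(\ell))$. Put $$\Phi^-(\ell)=F_1(\ell)-|\psi(\pi\ell)|,\quad \Sigma^-=\{\Phi^-=0\},\quad S^-=\{\ell\in\Sigma^-: F_{01}(\ell)-L_{f_0}\psi(\pi\ell)=0\},$$ $$\mathbb L(\ell)=F_{101}(\ell)+L_{f_{01}}\psi(\pi\ell)-L_{f_1}L_{f_0}\psi(\pi\ell).$$ Let $0<\tau_1<\tau_2<\tau_3<T$ and let $\hat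 u\colon[0,T]\to[-1,1]$ be a measurable control with $\hat u=1$ on $(0,\tau_1)$, $\hat u\in(0,1)$ on $(\tau_1,\tau_2)$, $\hat u=0$ on $(\tau_2,\tau_3)$, $\hat u=-1$ on $(\tau_3,T)$. Let $\hat\lambda\colon[0,T]\to T^*M$ be a normal Pontryagin extremal with control $\hat u$ for the problem of minimising $\int_0^T|u\,\psi(\xi)|\,dt$ subject to $\dot\xi=f_0(\xi)+u f_1(\xi)$, $|u|\le 1$, $\xi(0)=q_0$, $\xi(T)=q_T$; that is, with $h(\ell,u)=F_0(\ell)+uF_1(\ell)-|u\,\psi(\pi\ell)|$: $\hat\lambda$ is absolutely continuous, $\psi\circ\pi\circ\hat\lambda$ has only finitely many zeros, all in $(0,T)$, for a.e. $t$ one has $\dot{\hat\lambda}(t)=\vec h(\hat\lambda(t),\hat u(t))$ and $h(\hat\lambda(t),\hat u(t))=\max_{|u|\le1}h(\hat\lambda(t),u)$, and $\pi\hat\lambda(0)=q_0$, $\pi\hat\lambda(T)=q_T$. Assume that for all $t\in[\tau_1,\tau_2]$ one has $\psi(\pi\hat\lambda(t))>0$ and $\mathbb L(\hat\lambda(t))>0$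 (strong generalised Legendre condition). Set $K=\hat\lambda([\tau_1,\tau_2])$. Then there are an open neighbourhood $\mathcal U$ of $K$ in $T^*M$ and a smooth $\vartheta\colon\mathcal U\to\mathbb R$ with $\vartheta=0$ on $K$ such that, for all $\ell\in\mathcal U$, $\exp(\vartheta(\ell)\vec\Phi^-)(\ell)$ is defined and $$\bigl(F_{01}-L_{f_0}\psi\circ\pi\bigr)\bigl(\exp(\vartheta(\ell)\vec\Phi^-)(\ell)\bigr)=0 .$$ Moreover, for every such pair $(\mathcal U,\vartheta)$, setting $H_0(\ell)=F_0\bigl(\exp(\vartheta(\ell)\vec\Phi^-)(\ell)\bigr)$, the following holds after possibly replacing $\mathcal U$ by a smaller open neighbourhood of $K$. The functions $\Phi^-$ and $H_0$ are smooth on $\mathcal U$, and: 1. For every $\ell\in\Sigma^-\cap\mathcal U$ the vector $\vec H_0(\ell)$ is tangent to $\Sigma^-$ and $$\vec H_0(\ell)=\exp(-s\vec\Phi^-)_*\,\vec F_0\circ\exp(s\vec\Phi^-)(\ell)\big|_{s=\vartheta(\ell)}$$ (where $\exp(-s\vec\Phi^-)$ is differentiable at $\exp(s\vec\Phi^-)(\ell)$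 and maps it to $\ell$). For every $\ell\in S^-\cap\mathcal U$ one has $\vec H_0(\ell)=\vec F_0(\ell)$. 2. For every $\ell\in\Sigma^-\cap\mathcal U$ one has $H_0(\ell)\ge F_0(\ell)$, with equality if and only if $\ell\in S^-$. 3. For every smooth $\upsilon\colon\mathbb R\times T^*M\to\mathbb R$, every $t\in\mathbb R$ and every $\ell\in\Sigma^-\cap\mathcal U$, the Hamiltonian vector field of $H_0+\upsilon(t,\cdot)\Phi^-$ at $\ell$ is tangent to $\Sigma^-$. -/

import Mathlib

open Set Filter MeasureTheory Bundle
open scoped Manifold ContDiff Topology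

noncomputable section

namespace SingularArc

/-! ### The cotangent bundle and its canonical symplectic structure

`M` is a smooth manifold without boundary modelled on the finite-dimensional real vector
space `E`. -/

/-- The cotangent bundle `T*M`. A point `ℓ` has base point `ℓ.1 = π ℓ`, and `ℓ.2` is a linear form
on the tangent space of `M` at `π ℓ`. The topology and the smooth structure are those which Mathlib
puts on the total space of a bundle of continuous linear maps. -/
abbrev Cotangent (E M : Type*) [NormedAddCommGroup E] [NormedSpace ℝ E] [TopologicalSpace M]
    [ChartedSpace E M] : Type _ :=
  TotalSpace (E →L[ℝ] ℝ) (fun q : M => TangentSpace 𝓘(ℝ, E) q →L[ℝ] ℝ)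

/-- The model with corners of `T*M`. -/
abbrev cotangentModel (E : Type*) [NormedAddCommGroup E] [NormedSpace ℝ E] :
    ModelWithCorners ℝ (E × (E →L[ℝ] ℝ)) (ModelProd E (E →L[ℝ] ℝ)) :=
  𝓘(ℝ, E).prod 𝓘(ℝ, E →L[ℝ] ℝ)

section

variable {E : Type*} [NormedAddCommGroup E] [NormedSpace ℝ E]
  {M : Type*} [TopologicalSpace M] [ChartedSpace E M] [IsManifold 𝓘(ℝ, E) ∞ M]

/-- The Poincaré-Cartan (Liouville) one-form `ς_ℓ = ℓ ∘ π_*` on `T*M`. -/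
def liouvilleForm (ℓ : Cotangent E M) : TangentSpace (cotangentModel E) ℓ →L[ℝ] ℝ :=
  ContinuousLinearMap.comp (ℓ.2 : TangentSpace 𝓘(ℝ, E) ℓ.1 →L[ℝ] ℝ)
    (mfderiv (cotangentModel E) 𝓘(ℝ, E) (fun ℓ' : Cotangent E M => ℓ'.1) ℓ)

/-- The Liouville form read in the chart of `T*M` centred at `ℓ₀`, as a one-form on the model
vector space. -/
def liouvilleFormInChart (ℓ₀ : Cotangent E M) (z : E × (E →L[ℝ] ℝ)) :
    (E × (E →L[ℝ] ℝ)) →L[ℝ] ℝ :=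
  ContinuousLinearMap.comp (liouvilleForm ((extChartAt (cotangentModel E) ℓ₀).symm z))
    (mfderiv 𝓘(ℝ, E × (E →L[ℝ] ℝ)) (cotangentModel E) (extChartAt (cotangentModel E) ℓ₀).symm z)

/-- The canonical symplectic form `σ = dς` at `ℓ`: the exterior derivative
`(v, w) ↦ D ς(v) w - D ς(w) v` computed in the chart centred at `ℓ`. -/
def symplecticForm (ℓ : Cotangent E M) (v w : TangentSpace (cotangentModel E) ℓ) : ℝ :=
  let φ := extChartAt (cotangentModel E) ℓ
  let D := fderiv ℝ (liouvilleFormInChart ℓ) (φ ℓ)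
  let v' : E × (E →L[ℝ] ℝ) := mfderiv (cotangentModel E) 𝓘(ℝ, E × (E →L[ℝ] ℝ)) φ ℓ v
  let w' : E × (E →L[ℝ] ℝ) := mfderiv (cotangentModel E) 𝓘(ℝ, E × (E →L[ℝ] ℝ)) φ ℓ w
  D v' w' - D w' v'

/-- The differential `⟨dF(ℓ), v⟩` of a function `F` on `T*M`. -/
def differential (F : Cotangent E M → ℝ) (ℓ : Cotangent E M)
    (v : TangentSpace (cotangentModel E) ℓ) : ℝ :=
  mfderiv (cotangentModel E) 𝓘(ℝ, ℝ) F ℓ v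

open Classical in
/-- The Hamiltonian vector field of `F`, determined by `⟨dF(ℓ), ·⟩ = σ_ℓ(·, F⃗(ℓ))`. -/
def hamVF (F : Cotangent E M → ℝ) (ℓ : Cotangent E M) : TangentSpace (cotangentModel E) ℓ :=
  if h : ∃ X : TangentSpace (cotangentModel E) ℓ,
      ∀ v : TangentSpace (cotangentModel E) ℓ, differential F ℓ v = symplecticForm ℓ v X
  then h.choose else 0

/-! ### Flows, tangency, absolute continuity -/

/-- `γ` is an integral curve of the vector field `X`, starting at `ℓ` at time `0` and defined on the
closed interval with end points `0` and `s` (`s` may be negative). -/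
def IsFlowLine (X : ∀ ℓ : Cotangent E M, TangentSpace (cotangentModel E) ℓ) (s : ℝ)
    (ℓ : Cotangent E M) (γ : ℝ → Cotangent E M) : Prop :=
  γ 0 = ℓ ∧ IsMIntegralCurveOn (I := cotangentModel E) γ X (uIcc 0 s)

/-- `exp (s X) (ℓ)` is defined. -/
def FlowDefined (X : ∀ ℓ : Cotangent E M, TangentSpace (cotangentModel E) ℓ) (s : ℝ)
    (ℓ : Cotangent E M) : Prop :=
  ∃ γ, IsFlowLine X s ℓ γ

open Classical in
/-- The flow `exp (s X) (ℓ)` of the vector field `X`: the value at time `s` of the integral curve of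
`X` starting at `ℓ` at time `0` (and `ℓ` itself if there is none). -/
def expFlow (X : ∀ ℓ : Cotangent E M, TangentSpace (cotangentModel E) ℓ) (s : ℝ)
    (ℓ : Cotangent E M) : Cotangent E M :=
  if h : FlowDefined X s ℓ then h.choose s else ℓ

/-- `v` is tangent to the set `A` at its point `ℓ`: it is the velocity at `ℓ` of a `C¹` curve
that lies in `A`. For an embedded submanifold `A` this says that `v` belongs to `T_ℓ A`. -/
def IsTangentTo (A : Set (Cotangent E M)) (ℓ : Cotangent E M)
    (v : TangentSpace (cotangentModel E) ℓ) : Prop :=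
  ∃ c : ℝ → Cotangent E M, c 0 = ℓ ∧
    ContMDiffAt 𝓘(ℝ, ℝ) (cotangentModel E) 1 c 0 ∧
    (∀ᶠ t in 𝓝 (0 : ℝ), c t ∈ A) ∧
    HasMFDerivAt 𝓘(ℝ, ℝ) (cotangentModel E) c 0 ((1 : ℝ →L[ℝ] ℝ).smulRight v)

/-- Absolute continuity on `[a, b]` of a curve in `T*M`: it is continuous, and absolutely continuous
in charts. -/
def IsAbsContCurve (a b : ℝ) (γ : ℝ → Cotangent E M) : Prop :=
  ContinuousOn γ (Icc a b) ∧
  ∀ t ∈ Icc a b, ∃ ε > 0, AbsolutelyContinuousOnInterval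
    (fun s => extChartAt (cotangentModel E) (γ t) (γ s)) (max a (t - ε)) (min b (t + ε))

/-! ### Hamiltonian lifts and the functions of the optimal control problem -/

/-- A smooth vector field on `M`. -/
def SmoothVF (f : ∀ q : M, TangentSpace 𝓘(ℝ, E) q) : Prop :=
  ContMDiff 𝓘(ℝ, E) (𝓘(ℝ, E).prod 𝓘(ℝ, E)) ∞ (fun q => (⟨q, f q⟩ : TangentBundle 𝓘(ℝ, E) M))

/-- The Lie bracket `[f, g]` of vector fields on `M`. -/
abbrev bracket (f g : ∀ q : M, TangentSpace 𝓘(ℝ, E) q) : ∀ q : M, TangentSpace 𝓘(ℝ, E) q :=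
  VectorField.mlieBracket 𝓘(ℝ, E) f g

/-- The Lie derivative `L_f φ` of a function. -/
def lieDeriv (f : ∀ q : M, TangentSpace 𝓘(ℝ, E) q) (φ : M → ℝ) (q : M) : ℝ :=
  mfderiv 𝓘(ℝ, E) 𝓘(ℝ, ℝ) φ q (f q)

/-- The Hamiltonian lift `F(ℓ) = ⟨ℓ, f(π ℓ)⟩` of a vector field `f` on `M`. -/
def hamLift (f : ∀ q : M, TangentSpace 𝓘(ℝ, E) q) (ℓ : Cotangent E M) : ℝ :=
  (ℓ.2 : TangentSpace 𝓘(ℝ, E) ℓ.1 →L[ℝ] ℝ) (f ℓ.1)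

/-- The switching function `Φ⁻(ℓ) = F₁(ℓ) - |ψ(π ℓ)|`. -/
def PhiMinus (f₁ : ∀ q : M, TangentSpace 𝓘(ℝ, E) q) (ψ : M → ℝ) (ℓ : Cotangent E M) : ℝ :=
  hamLift f₁ ℓ - |ψ ℓ.1|

/-- The set `Σ⁻ = {Φ⁻ = 0}`. -/
def SigmaMinus (f₁ : ∀ q : M, TangentSpace 𝓘(ℝ, E) q) (ψ : M → ℝ) : Set (Cotangent E M) :=
  {ℓ | PhiMinus f₁ ψ ℓ = 0}

/-- The function `F₀₁ - L_{f₀} ψ ∘ π`. -/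
def singFun (f₀ f₁ : ∀ q : M, TangentSpace 𝓘(ℝ, E) q) (ψ : M → ℝ) (ℓ : Cotangent E M) : ℝ :=
  hamLift (bracket f₀ f₁) ℓ - lieDeriv f₀ ψ ℓ.1

/-- The set `S⁻ = {ℓ ∈ Σ⁻ : F₀₁(ℓ) - L_{f₀} ψ(π ℓ) = 0}`. -/
def SMinus (f₀ f₁ : ∀ q : M, TangentSpace 𝓘(ℝ, E) q) (ψ : M → ℝ) : Set (Cotangent E M) :=
  {ℓ | ℓ ∈ SigmaMinus f₁ ψ ∧ singFun f₀ f₁ ψ ℓ = 0}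

/-- `𝕃 = F₁₀₁ + L_{f₀₁} ψ ∘ π - L_{f₁} L_{f₀} ψ ∘ π`, the function of the generalised Legendre
condition along an arc on which `ψ` is positive. -/
def legendreFun (f₀ f₁ : ∀ q : M, TangentSpace 𝓘(ℝ, E) q) (ψ : M → ℝ) (ℓ : Cotangent E M) : ℝ :=
  hamLift (bracket f₁ (bracket f₀ f₁)) ℓ
    + (lieDeriv (bracket f₀ f₁) ψ ℓ.1 - lieDeriv f₁ (lieDeriv f₀ ψ) ℓ.1)

/-- The normal pre-Hamiltonian `h(ℓ, u) = F₀(ℓ) + u F₁(ℓ) - |u ψ(π ℓ)|`. -/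
def preHam (f₀ f₁ : ∀ q : M, TangentSpace 𝓘(ℝ, E) q) (ψ : M → ℝ) (ℓ : Cotangent E M) (u : ℝ) : ℝ :=
  hamLift f₀ ℓ + u * hamLift f₁ ℓ - |u * ψ ℓ.1|

/-- `lam : [0, T] → T*M` is a normal Pontryagin extremal, with extremal control `u`, of the problem
of minimising `∫₀ᵀ |u(t) ψ(ξ(t))| dt` over the trajectories of `ξ' = f₀(ξ) + u f₁(ξ)`, `|u| ≤ 1`,
which join `q₀` to `q_T` in time `T`. -/
structure IsNormalExtremal (f₀ f₁ : ∀ q : M, TangentSpace 𝓘(ℝ, E) q) (ψ : M → ℝ) (T : ℝ)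
    (q₀ qT : M) (u : ℝ → ℝ) (lam : ℝ → Cotangent E M) : Prop where
  absCont : IsAbsContCurve 0 T lam
  control_measurable : AEStronglyMeasurable u (volume.restrict (Icc 0 T))
  control_mem : ∀ᵐ t ∂(volume.restrict (Icc 0 T)), u t ∈ Icc (-1 : ℝ) 1
  zeros_finite : {t ∈ Icc 0 T | ψ (lam t).1 = 0}.Finite
  zeros_interior : ∀ t ∈ Icc 0 T, ψ (lam t).1 = 0 → t ∈ Ioo 0 T
  hamiltonian_eq : ∀ᵐ t ∂(volume.restrict (Icc 0 T)),
    HasMFDerivAt 𝓘(ℝ, ℝ) (cotangentModel E) lam t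
      ((1 : ℝ →L[ℝ] ℝ).smulRight (hamVF (fun ℓ => preHam f₀ f₁ ψ ℓ (u t)) (lam t)))
  maximality : ∀ᵐ t ∂(volume.restrict (Icc 0 T)),
    IsMaxOn (fun v => preHam f₀ f₁ ψ (lam t) v) (Icc (-1 : ℝ) 1) (u t)
  initial : (lam 0).1 = q₀
  final : (lam T).1 = qT

/-- The bang-singular-zero-bang structure of the reference control. -/
structure IsBangSingularZeroBang (T τ₁ τ₂ τ₃ : ℝ) (u : ℝ → ℝ) : Prop where
  pos : 0 < τ₁
  lt₁₂ : τ₁ < τ₂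
  lt₂₃ : τ₂ < τ₃
  lt₃ : τ₃ < T
  bang_one : ∀ t ∈ Ioo 0 τ₁, u t = 1
  singular : ∀ t ∈ Ioo τ₁ τ₂, u t ∈ Ioo (0 : ℝ) 1
  zero : ∀ t ∈ Ioo τ₂ τ₃, u t = 0
  bang_minus_one : ∀ t ∈ Ioo τ₃ T, u t = -1

/-! ### The implicit function and the Hamiltonian `H₀` -/

/-- `θ : U → ℝ` is a smooth solution, on the open neighbourhood `U` of the compact set `K`, of the
implicit equation `(F₀₁ - L_{f₀} ψ ∘ π) (exp (θ(ℓ) Φ⃗⁻) (ℓ)) = 0`, the branch being fixed by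
`θ = 0` on `K`. -/
structure IsImplicitTime (f₀ f₁ : ∀ q : M, TangentSpace 𝓘(ℝ, E) q) (ψ : M → ℝ)
    (K U : Set (Cotangent E M)) (θ : Cotangent E M → ℝ) : Prop where
  isOpen : IsOpen U
  subset : K ⊆ U
  smooth : ContMDiffOn (cotangentModel E) 𝓘(ℝ, ℝ) ∞ θ U
  zero_on : ∀ ℓ ∈ K, θ ℓ = 0
  flowDefined : ∀ ℓ ∈ U, FlowDefined (hamVF (PhiMinus f₁ ψ)) (θ ℓ) ℓ
  equation : ∀ ℓ ∈ U, singFun f₀ f₁ ψ (expFlow (hamVF (PhiMinus f₁ ψ)) (θ ℓ) ℓ) = 0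

/-- `H₀(ℓ) = F₀(exp (θ(ℓ) Φ⃗⁻) (ℓ))`. -/
def H0 (f₀ f₁ : ∀ q : M, TangentSpace 𝓘(ℝ, E) q) (ψ : M → ℝ) (θ : Cotangent E M → ℝ)
    (ℓ : Cotangent E M) : ℝ :=
  hamLift f₀ (expFlow (hamVF (PhiMinus f₁ ψ)) (θ ℓ) ℓ)

/-- `exp (-s X)_* Y (exp (s X) (ℓ))`, for a fixed time `s`. This is a tangent vector at
`exp (-s X) (exp (s X) (ℓ))`; it is regarded as a tangent vector at `ℓ`, and is used together with
the fact that these two points are equal. -/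
def pullBackByFlow (X Y : ∀ ℓ : Cotangent E M, TangentSpace (cotangentModel E) ℓ) (s : ℝ)
    (ℓ : Cotangent E M) : TangentSpace (cotangentModel E) ℓ :=
  mfderiv (cotangentModel E) (cotangentModel E) (expFlow X (-s)) (expFlow X s ℓ)
    (Y (expFlow X s ℓ))

end

end SingularArc

end

/-! Near `K` one has `ψ > 0`, so `Φ⁻ = F₁ - ψ ∘ π` is smooth and affine in the momentum. The Poisson
bracket of functions of this kind (`differential_hamVF_hamLift_sub`) gives two derivatives along the
flow of `Φ⃗⁻`, with `G = F₀₁ - L_{f₀} ψ ∘ π`: that of `F₀` is `-G`, and that of `G` is `𝕃`. Where `𝕃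
> 0`, `G` is thus strictly increasing along each flow line, and `F₀` is strictly concave with its
maximum at the zero of `G`.

The arc `K` lies in `S⁻`: a control value in `(0, 1)` maximises `F₀ + u Φ⁻` only if `Φ⁻ = 0`, and
differentiating this identity along the extremal gives `G = 0` (`IsNormalExtremal.mem_SMinus`).
Hence `G` has a zero at time `0` on flow lines through `K`. The implicit function theorem keeps a
zero on nearby lines, and monotonicity makes it unique, so the local solutions agree and form one
smooth `ϑ` (`exists_isImplicitTime`).

At time `ϑ(ℓ)` the derivative of `F₀` along the line is `-G = 0`. Therefore `ϑ` does not contribute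
to `dH₀`, which is the differential of `F₀ ∘ exp(s Φ⃗⁻)` with `s` frozen at `ϑ(ℓ)`
(`differential_H0`). Three consequences follow. Since the flow is symplectic, `H⃗₀` is the pull-back
of `F⃗₀`. Since `dH₀` vanishes on `Φ⃗⁻`, antisymmetry of the bracket gives `dΦ⁻(H⃗₀) = 0`, which is
tangency; a term `υ Φ⁻` changes nothing where `Φ⁻ = 0`. Finally `H₀ ≥ F₀` by concavity, with
equality exactly when `ϑ = 0`, that is when `G(ℓ) = 0`.

The remaining work supports this: smooth local flows, constructed by inverting the integral equation
on a space of paths; the fact that bundle charts of `T*M` are canonical, because each reads the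
Liouville form as `p dq`; and flow boxes with a time bound uniform over the compact set `K`. -/

noncomputable section

namespace SingularArc

/-! ### Smooth dependence of solutions of differential equations on initial data -/

/-! ### Post-composition by a smooth map as an operator on spaces of continuous functions -/

section CompositionOperator

universe v u

variable {K : Type v} [TopologicalSpace K] [CompactSpace K]
  {Z Y W : Type u} [NormedAddCommGroup Z] [NormedSpace ℝ Z] [NormedAddCommGroup Y] [NormedSpace ℝ Y]
  [NormedAddCommGroup W] [NormedSpace ℝ W]

/-- Pointwise application of a bilinear map to a pair of continuous functions. -/
def pointwiseApply (K : Type v) [TopologicalSpace K] [CompactSpace K] (B : W →L[ℝ] Z →L[ℝ] Y) :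
    C(K, W) →L[ℝ] C(K, Z) →L[ℝ] C(K, Y) :=
  LinearMap.mkContinuous₂
    (LinearMap.mk₂ ℝ (fun (A : C(K, W)) (h : C(K, Z)) =>
        (⟨fun t => B (A t) (h t), (B.continuous.comp A.continuous).clm_apply h.continuous⟩ :
          C(K, Y)))
      (fun _ _ _ => by ext; simp) (fun _ _ _ => by ext; simp)
      (fun _ _ _ => by ext; simp) (fun _ _ _ => by ext; simp))
    ‖B‖ (fun A h => by
      rw [ContinuousMap.norm_le _ (by positivity)]
      intro t
      calc ‖B (A t) (h t)‖ ≤ ‖B‖ * ‖A t‖ * ‖h t‖ := B.le_opNorm₂ _ _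
        _ ≤ ‖B‖ * ‖A‖ * ‖h‖ := by
          gcongr
          · exact A.norm_coe_le_norm t
          · exact h.norm_coe_le_norm t)

@[simp] lemma pointwiseApply_apply (B : W →L[ℝ] Z →L[ℝ] Y) (A : C(K, W)) (h : C(K, Z)) (t : K) :
    pointwiseApply K B A h t = B (A t) (h t) := rfl

/-- The mean value inequality gives the estimate at each point of `K`. It is uniform in that point
because `γ ↦ X' ∘ γ` is continuous for the sup norm, `K` being compact. -/
lemma hasFDerivAt_postcomp (B : W →L[ℝ] Z →L[ℝ] Y) (hB : ‖B‖ ≤ 1) (X : C(Z, Y)) (X' : C(Z, W))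
    (hX : ∀ z, HasFDerivAt X (B (X' z)) z) (γ : C(K, Z)) :
    HasFDerivAt (fun γ : C(K, Z) => X.comp γ) (pointwiseApply K B (X'.comp γ)) γ := by
  rw [hasFDerivAt_iff_isLittleO_nhds_zero, Asymptotics.isLittleO_iff]
  intro c hc
  have hcont := ContinuousMap.continuous_postcomp (X := K) X'
  obtain ⟨δ, hδ, hδ'⟩ := Metric.continuous_iff.1 hcont γ c hc
  filter_upwards [Metric.ball_mem_nhds (0 : C(K, Z)) hδ] with h hh
  rw [ContinuousMap.norm_le _ (by positivity)]
  intro t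
  have key : ∀ z ∈ segment ℝ (γ t) (γ t + h t), ‖B (X' z) - B (X' (γ t))‖ ≤ c := by
    intro z hz
    rw [segment_eq_image'] at hz
    obtain ⟨s, hs, rfl⟩ := hz
    have h1 : dist (γ + s • h) γ < δ := by
      rw [dist_eq_norm, add_sub_cancel_left, norm_smul, Real.norm_of_nonneg hs.1]
      have : ‖h‖ < δ := by simpa using hh
      calc s * ‖h‖ ≤ 1 * ‖h‖ := by gcongr; exact hs.2
        _ < δ := by rwa [one_mul]
    have h2 := (hδ' _ h1).le
    rw [ContinuousMap.dist_le hc.le] at h2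
    have h3 : ‖X' (γ t + s • h t) - X' (γ t)‖ ≤ c := by simpa [dist_eq_norm] using h2 t
    rw [← map_sub, add_sub_cancel_left]
    calc _ ≤ ‖B‖ * ‖X' (γ t + s • h t) - X' (γ t)‖ := B.le_opNorm _
      _ ≤ 1 * c := by gcongr
      _ = c := one_mul c
  have := (convex_segment (γ t) (γ t + h t)).norm_image_sub_le_of_norm_hasFDerivWithin_le'
    (fun z _ => (hX z).hasFDerivWithinAt) key (left_mem_segment ℝ _ _) (right_mem_segment ℝ _ _)
  calc _ = ‖X (γ t + h t) - X (γ t) - (B (X' (γ t))) (γ t + h t - γ t)‖ := by simp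
    _ ≤ c * ‖γ t + h t - γ t‖ := this
    _ ≤ c * ‖h‖ := by
      rw [add_sub_cancel_left]
      gcongr
      exact h.norm_coe_le_norm t

/-- The derivative is post-composition by `X'` followed by a fixed continuous linear map, so
induction applies. The target must vary, since `X'` takes values in `Z →L[ℝ] Y`; keeping `Z` and `Y`
in one universe keeps this space in it too. -/
lemma contDiff_postcomp_nat (n : ℕ) : ∀ (Y : Type u) [NormedAddCommGroup Y] [NormedSpace ℝ Y]
    (X : C(Z, Y)), ContDiff ℝ n X → ContDiff ℝ n (fun γ : C(K, Z) => X.comp γ) := by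
  induction n with
  | zero =>
    intro Y _ _ X hX
    exact contDiff_zero.2 (ContinuousMap.continuous_postcomp X)
  | succ n ih =>
    intro Y _ _ X hX
    push_cast at hX ⊢
    obtain ⟨X', hX', hXX'⟩ := contDiff_succ_iff_hasFDerivAt.1 hX
    rw [contDiff_succ_iff_hasFDerivAt]
    have h := ih _ ⟨X', hX'.continuous⟩ hX'
    exact ⟨_, ContDiff.comp (ContinuousLinearMap.contDiff
        (pointwiseApply K (ContinuousLinearMap.id ℝ (Z →L[ℝ] Y)))) h,
      fun γ => hasFDerivAt_postcomp _ ContinuousLinearMap.norm_id_le X ⟨X', hX'.continuous⟩ hXX' γ⟩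

lemma contDiff_postcomp (X : C(Z, Y)) (hX : ContDiff ℝ ∞ X) :
    ContDiff ℝ ∞ (fun γ : C(K, Z) => X.comp γ) :=
  contDiff_infty.2 fun n => contDiff_postcomp_nat n Y X (contDiff_infty.1 hX n)

end CompositionOperator

/-! ### Local flows from the inverse function theorem on path space -/

section LocalFlow

universe u

variable {Z : Type u} [NormedAddCommGroup Z] [NormedSpace ℝ Z]

/-- Continuous paths parametrised by the unit interval. -/
abbrev PathSpace (Z : Type u) [NormedAddCommGroup Z] : Type u := C(Icc (0 : ℝ) 1, Z)

/-- The primitive vanishing at `0` of a continuous function on the unit interval. -/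
def primitiveCLM (Z : Type u) [NormedAddCommGroup Z] [NormedSpace ℝ Z] :
    C(Icc (0 : ℝ) 1, Z) →L[ℝ] C(Icc (0 : ℝ) 1, Z) :=
  LinearMap.mkContinuous
    { toFun := fun γ => ⟨fun τ => ∫ s in (0 : ℝ)..τ, γ (projIcc 0 1 zero_le_one s), by
        have h : Continuous fun s : ℝ => γ (projIcc 0 1 zero_le_one s) :=
          γ.continuous.comp continuous_projIcc
        exact (intervalIntegral.continuous_primitive (fun a b => h.intervalIntegrable a b) 0).comp
          continuous_subtype_val⟩
      map_add' := fun γ η => by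
        ext τ
        have h (γ : C(Icc (0 : ℝ) 1, Z)) : Continuous fun s : ℝ => γ (projIcc 0 1 zero_le_one s) :=
          γ.continuous.comp continuous_projIcc
        exact intervalIntegral.integral_add ((h γ).intervalIntegrable _ _)
          ((h η).intervalIntegrable _ _)
      map_smul' := fun c γ => by
        ext τ
        exact intervalIntegral.integral_smul _ _ }
    1 (fun γ => by
      rw [ContinuousMap.norm_le _ (by positivity)]
      intro τ
      refine (intervalIntegral.norm_integral_le_of_norm_le_const
        (fun s _ => γ.norm_coe_le_norm _)).trans ?_
      rw [sub_zero, abs_of_nonneg τ.2.1, one_mul]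
      exact mul_le_of_le_one_right (norm_nonneg _) τ.2.2)

lemma primitiveCLM_apply (γ : C(Icc (0 : ℝ) 1, Z)) (τ : Icc (0 : ℝ) 1) :
    primitiveCLM Z γ τ = ∫ s in (0 : ℝ)..τ, γ (projIcc 0 1 zero_le_one s) := rfl

/-- The map `(t, z, γ) ↦ (t, z, γ - z - t ∫ X ∘ γ)`, whose inverse parametrises the solutions of
`γ' = t X(γ)`, `γ(0) = z`. -/
def flowMap (X : C(Z, Z)) (a : (ℝ × Z) × C(Icc (0 : ℝ) 1, Z)) : (ℝ × Z) × C(Icc (0 : ℝ) 1, Z) :=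
  (a.1, a.2 - ContinuousLinearMap.const ℝ _ a.1.2 - a.1.1 • primitiveCLM Z (X.comp a.2))

lemma contDiff_flowMap (X : C(Z, Z)) (hX : ContDiff ℝ ∞ X) : ContDiff ℝ ∞ (flowMap X) := by
  have h1 : ContDiff ℝ ∞ (fun a : (ℝ × Z) × C(Icc (0 : ℝ) 1, Z) => X.comp a.2) :=
    (contDiff_postcomp X hX).comp contDiff_snd
  unfold flowMap
  fun_prop

/-- With time rescaled to the unit interval, solutions are the paths that `flowMap` sends to zero in
the last component. At the constant path with `t = 0` the derivative is invertible, so the solution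
path is a smooth function of `(t, z)`; its end point is the flow. -/
lemma exists_flow_of_contDiff [CompleteSpace Z] (X : Z → Z) (hX : ContDiff ℝ ∞ X) (z₀ : Z) :
    ∃ (φ : ℝ × Z → Z) (δ : ℝ), 0 < δ ∧
      (∀ t ∈ Ioo (-δ) δ, ∀ z ∈ Metric.ball z₀ δ, ContDiffAt ℝ ∞ φ (t, z)) ∧
      (∀ z ∈ Metric.ball z₀ δ, φ (0, z) = z) ∧
      ∀ t ∈ Ioo (-δ) δ, ∀ z ∈ Metric.ball z₀ δ,
        HasDerivAt (fun s => φ (s, z)) (X (φ (t, z))) t := by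
  set X' : C(Z, Z) := ⟨X, hX.continuous⟩
  set G := flowMap X'
  have hG : ContDiff ℝ ∞ G := contDiff_flowMap X' hX
  set c₀ : PathSpace Z := ContinuousLinearMap.const ℝ _ z₀
  set w : PathSpace Z := primitiveCLM Z (X'.comp c₀)
  set a₀ : (ℝ × Z) × PathSpace Z := ((0, z₀), c₀)
  -- the derivative at the constant solution
  let A : ((ℝ × Z) × PathSpace Z) →L[ℝ] (ℝ × Z) × PathSpace Z :=
    (ContinuousLinearMap.fst ℝ _ _).prod (ContinuousLinearMap.snd ℝ _ _ -
      ((ContinuousLinearMap.const ℝ _).comp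
        ((ContinuousLinearMap.snd ℝ ℝ Z).comp (ContinuousLinearMap.fst ℝ _ _))) -
      (((ContinuousLinearMap.fst ℝ ℝ Z).comp (ContinuousLinearMap.fst ℝ _ _)).smulRight w))
  -- `A` is triangular with identity diagonal, so its inverse only reverses the sign of the
  -- off-diagonal terms.
  let B : ((ℝ × Z) × PathSpace Z) →L[ℝ] (ℝ × Z) × PathSpace Z :=
    (ContinuousLinearMap.fst ℝ _ _).prod (ContinuousLinearMap.snd ℝ _ _ +
      ((ContinuousLinearMap.const ℝ _).comp
        ((ContinuousLinearMap.snd ℝ ℝ Z).comp (ContinuousLinearMap.fst ℝ _ _))) +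
      (((ContinuousLinearMap.fst ℝ ℝ Z).comp (ContinuousLinearMap.fst ℝ _ _)).smulRight w))
  have hBA : Function.LeftInverse B A := fun a => by
    refine Prod.ext rfl ?_
    simp only [A, B, ContinuousLinearMap.prod_apply, ContinuousLinearMap.coe_fst', ContinuousLinearMap.coe_snd',
      sub_apply, add_apply, ContinuousLinearMap.comp_apply,
      ContinuousLinearMap.smulRight_apply]
    abel
  have hAB : Function.RightInverse B A := fun a => by
    refine Prod.ext rfl ?_
    simp only [A, B, ContinuousLinearMap.prod_apply, ContinuousLinearMap.coe_fst', ContinuousLinearMap.coe_snd',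
      sub_apply, add_apply, ContinuousLinearMap.comp_apply,
      ContinuousLinearMap.smulRight_apply]
    abel
  let e := ContinuousLinearEquiv.equivOfInverse A B hBA hAB
  -- The factor `t` in front of the primitive vanishes at `a₀`, so the product rule leaves only `dt
  -- • w` and the derivative of `X` drops out.
  have hGd : HasFDerivAt G (e : ((ℝ × Z) × PathSpace Z) →L[ℝ] (ℝ × Z) × PathSpace Z) a₀ := by
    have h1 : DifferentiableAt ℝ (fun a : (ℝ × Z) × PathSpace Z => primitiveCLM Z (X'.comp a.2)) a₀ :=
      (((primitiveCLM Z).contDiff.comp ((contDiff_postcomp X' hX).comp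
        contDiff_snd)).differentiable (by simp)) a₀
    have h2 : HasFDerivAt (fun a : (ℝ × Z) × PathSpace Z => a.1.1)
        ((ContinuousLinearMap.fst ℝ ℝ Z).comp (ContinuousLinearMap.fst ℝ _ _)) a₀ :=
      ContinuousLinearMap.hasFDerivAt ((ContinuousLinearMap.fst ℝ ℝ Z).comp (ContinuousLinearMap.fst ℝ (ℝ × Z) (PathSpace Z)))
    have h3 := h2.smul h1.hasFDerivAt
    have h4 := ((ContinuousLinearMap.snd ℝ (ℝ × Z) (PathSpace Z) -
      ((ContinuousLinearMap.const ℝ (Icc (0 : ℝ) 1)).comp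
        ((ContinuousLinearMap.snd ℝ ℝ Z).comp (ContinuousLinearMap.fst ℝ _ _)))).hasFDerivAt
          (x := a₀)).sub h3
    have h5 := (ContinuousLinearMap.fst ℝ (ℝ × Z) (PathSpace Z)).hasFDerivAt (x := a₀) |>.prodMk h4
    refine h5.congr_fderiv ?_
    ext a <;> simp [e, A, a₀, w]
  let f := hG.contDiffAt.toOpenPartialHomeomorph G hGd (by simp)
  have hf : ⇑f = G := rfl
  have ha₀ : a₀ ∈ f.source := hG.contDiffAt.mem_toOpenPartialHomeomorph_source hGd (by simp)
  have hGa₀ : G a₀ = ((0, z₀), 0) := by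
    simp [G, flowMap, a₀, c₀]
  have hta₀ : ((0, z₀), 0) ∈ f.target := by
    rw [← hGa₀, ← hf]; exact f.map_source ha₀
  have hsa₀ : f.symm ((0, z₀), 0) = a₀ := by
    rw [← hGa₀, ← hf]; exact f.left_inv ha₀
  obtain ⟨ε, hε, hεs⟩ := Metric.mem_nhds_iff.1 (f.open_source.mem_nhds ha₀)
  -- points at which the inverse is smooth
  have hinv : ∀ᶠ a in 𝓝 a₀, fderiv ℝ G a ∈ range
      (ContinuousLinearEquiv.toContinuousLinearMap :
        (((ℝ × Z) × PathSpace Z) ≃L[ℝ] (ℝ × Z) × PathSpace Z) → _) := by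
    -- Invertible operators form an open set. This is what gives smoothness of the inverse at all
    -- nearby points and not only at the image of `a₀`.
    have hc : ContinuousAt (fderiv ℝ G) a₀ := (hG.continuous_fderiv (by simp)).continuousAt
    refine hc.eventually_mem ?_
    rw [hGd.fderiv]
    exact ContinuousLinearEquiv.nhds e
  have hcs : ContinuousAt f.symm ((0, z₀), 0) := f.continuousAt_symm hta₀
  have hinj : ContinuousAt (fun p : ℝ × Z => (p, (0 : PathSpace Z))) (0, z₀) := by fun_prop
  have hev : ∀ᶠ p : ℝ × Z in 𝓝 (0, z₀), (p, (0 : PathSpace Z)) ∈ f.target ∧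
      f.symm (p, 0) ∈ Metric.ball a₀ ε ∧ fderiv ℝ G (f.symm (p, 0)) ∈ range
      (ContinuousLinearEquiv.toContinuousLinearMap :
        (((ℝ × Z) × PathSpace Z) ≃L[ℝ] (ℝ × Z) × PathSpace Z) → _) := by
    have h1 : ∀ᶠ b in 𝓝 ((0, z₀), (0 : PathSpace Z)), b ∈ f.target ∧ f.symm b ∈ Metric.ball a₀ ε ∧
        fderiv ℝ G (f.symm b) ∈ range (ContinuousLinearEquiv.toContinuousLinearMap :
        (((ℝ × Z) × PathSpace Z) ≃L[ℝ] (ℝ × Z) × PathSpace Z) → _) := by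
      refine (f.open_target.eventually_mem hta₀).and ?_
      rw [← hsa₀] at hinv
      have h2 : Metric.ball a₀ ε ∈ 𝓝 (f.symm ((0, z₀), 0)) := by
        rw [hsa₀]; exact Metric.ball_mem_nhds _ hε
      exact (hcs.eventually_mem h2).and (hcs.eventually hinv)
    exact hinj.eventually h1
  obtain ⟨δ', hδ', hδ's⟩ := Metric.eventually_nhds_iff.1 hev
  set δ := min δ' ε
  have hδ : 0 < δ := lt_min hδ' hε
  set S : ℝ × Z → PathSpace Z := fun p => (f.symm (p, 0)).2
  have hp : ∀ t ∈ Ioo (-δ) δ, ∀ z ∈ Metric.ball z₀ δ, dist ((t, z) : ℝ × Z) (0, z₀) < δ := by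
    intro t ht z hz
    rw [Prod.dist_eq, max_lt_iff]
    exact ⟨by rw [Real.dist_eq, sub_zero, abs_lt]; exact ht, hz⟩
  -- the equation for `S`
  have hS1 : ∀ p, dist p ((0 : ℝ), z₀) < δ → f.symm (p, 0) = (p, S p) ∧
      S p = ContinuousLinearMap.const ℝ _ p.2 + p.1 • primitiveCLM Z (X'.comp (S p)) ∧
      dist (S p) c₀ < ε := by
    intro p hp
    obtain ⟨h1, h2, -⟩ := hδ's (hp.trans_le (min_le_left _ _))
    have h3 : G (f.symm (p, 0)) = (p, 0) := f.right_inv h1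
    have h4 : (f.symm (p, 0)).1 = p := congrArg Prod.fst h3
    have h5 := congrArg Prod.snd h3
    simp only [G, flowMap, h4] at h5
    refine ⟨Prod.ext h4 rfl, ?_, ?_⟩
    · rw [sub_sub, sub_eq_zero] at h5
      exact h5
    · rw [Metric.mem_ball, Prod.dist_eq, max_lt_iff] at h2
      exact h2.2
  -- Local uniqueness: a solution path close to `c₀` lies in the source of `f`, where `f` is
  -- injective.
  have hS2 : ∀ p, dist p ((0 : ℝ), z₀) < δ → ∀ γ : PathSpace Z, dist γ c₀ < ε →
      γ = ContinuousLinearMap.const ℝ _ p.2 + p.1 • primitiveCLM Z (X'.comp γ) → γ = S p := by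
    intro p hp γ hγ h
    have h1 : (p, γ) ∈ f.source := hεs (by
      rw [Metric.mem_ball, Prod.dist_eq, max_lt_iff]
      exact ⟨hp.trans_le (min_le_right _ _), hγ⟩)
    have h2 : f (p, γ) = (p, 0) := by
      rw [hf]
      refine Prod.ext rfl ?_
      simp only [G, flowMap]
      rw [sub_sub, sub_eq_zero]
      exact h
    have h3 := f.left_inv h1
    rw [h2] at h3
    simp [S, h3]
  -- rescaling of time
  have hS3 : ∀ t ∈ Ioo (-δ) δ, ∀ z ∈ Metric.ball z₀ δ, ∀ τ : Icc (0 : ℝ) 1,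
      S (t * τ, z) ⟨1, by simp⟩ = S (t, z) τ := by
    intro t ht z hz τ
    obtain ⟨-, h2, h3⟩ := hS1 _ (hp t ht z hz)
    have hτ (σ : Icc (0 : ℝ) 1) : (τ : ℝ) * σ ∈ Icc (0 : ℝ) 1 :=
      ⟨mul_nonneg τ.2.1 σ.2.1, mul_le_one₀ τ.2.2 σ.2.1 σ.2.2⟩
    have hτt : t * τ ∈ Ioo (-δ) δ := by
      refine abs_lt.1 ?_
      rw [abs_mul, abs_of_nonneg τ.2.1]
      replace ht := abs_lt.2 ht
      exact (mul_le_of_le_one_right (abs_nonneg _) τ.2.2).trans_lt ht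
    -- The initial piece of the path for `t`, stretched back to the unit interval, solves the
    -- equation for the time `t * τ`; local uniqueness identifies it.
    let γ : PathSpace Z := ⟨fun σ => S (t, z) ⟨τ * σ, hτ σ⟩, by fun_prop⟩
    have hγ : γ = S (t * τ, z) := by
      refine hS2 _ (hp _ hτt z hz) γ (lt_of_le_of_lt ?_ h3) ?_
      · rw [ContinuousMap.dist_le dist_nonneg]
        intro σ
        exact ContinuousMap.dist_apply_le_dist (f := S (t, z)) (g := c₀) ⟨τ * σ, hτ σ⟩
      · ext σ
        have h4 := congrArg (fun η : PathSpace Z => η ⟨τ * σ, hτ σ⟩) h2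
        simp only [ContinuousMap.add_apply, ContinuousMap.smul_apply, primitiveCLM_apply] at h4 ⊢
        refine h4.trans ?_
        congr 1
        rw [mul_smul]
        congr 1
        have h5 := intervalIntegral.smul_integral_comp_mul_left (a := 0) (b := σ)
          (fun s => X (S (t, z) (projIcc 0 1 zero_le_one s))) (τ : ℝ)
        rw [mul_zero] at h5
        refine h5.symm.trans ?_
        congr 1
        refine intervalIntegral.integral_congr fun s hs => ?_
        rw [uIcc_of_le σ.2.1] at hs
        have hs' : s ∈ Icc (0 : ℝ) 1 := ⟨hs.1, hs.2.trans σ.2.2⟩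
        have h6 := hτ ⟨s, hs'⟩
        change X (S (t, z) (projIcc 0 1 zero_le_one (τ * s))) =
          X (S (t, z) ⟨τ * projIcc 0 1 zero_le_one s, _⟩)
        congr 2
        rw [projIcc_of_mem _ h6]
        ext
        simp [projIcc_of_mem _ hs']
    rw [← hγ]
    change S (t, z) ⟨τ * 1, _⟩ = _
    congr 1
    ext
    simp
  have hsmooth : ∀ t ∈ Ioo (-δ) δ, ∀ z ∈ Metric.ball z₀ δ,
      ContDiffAt ℝ ∞ (fun p => S p ⟨1, by simp⟩) (t, z) := by
    intro t ht z hz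
    obtain ⟨h1, -, e', he'⟩ := hδ's ((hp t ht z hz).trans_le (min_le_left _ _))
    have h2 : HasFDerivAt f (e' : ((ℝ × Z) × PathSpace Z) →L[ℝ] (ℝ × Z) × PathSpace Z) (f.symm ((t, z), 0)) := by
      rw [he', hf]
      exact (hG.differentiable (by simp) _).hasFDerivAt
    have h3 : ContDiffAt ℝ ∞ f.symm ((t, z), 0) := f.contDiffAt_symm h1 h2 hG.contDiffAt
    have h4 : ContDiffAt ℝ ∞ S (t, z) := by
      refine contDiff_snd.contDiffAt.comp _ (h3.comp (t, z) ?_)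
      fun_prop
    exact (ContinuousMap.evalCLM ℝ (⟨1, by simp⟩ : Icc (0 : ℝ) 1)).contDiff.contDiffAt.comp _ h4
  refine ⟨fun p => S p ⟨1, by simp⟩, δ, hδ, hsmooth, ?_, ?_⟩
  · intro z hz
    obtain ⟨-, h2, -⟩ := hS1 _ (hp 0 (by simpa using hδ) z hz)
    simp only [zero_smul, add_zero] at h2
    simp only
    rw [h2]
    rfl
  · intro t ht z hz
    set g : ℝ → Z := fun s => X (S (s, z) ⟨1, by simp⟩) with hg
    have hgc : ContinuousOn g (Ioo (-δ) δ) := by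
      intro s hs
      have h1 : ContinuousAt (fun s : ℝ => (s, z)) s := by fun_prop
      exact (hX.continuous.continuousAt.comp
        (ContinuousAt.comp (x := s) (hsmooth s hs z hz).continuousAt h1)).continuousWithinAt
    -- By the rescaling identity, the integral equation along one path becomes an integral equation
    -- for the end points as `s` varies. The fundamental theorem of calculus then gives the
    -- differential equation.
    have h1 : ∀ s ∈ Ioo (-δ) δ, S (s, z) ⟨1, by simp⟩ = z + ∫ r in (0 : ℝ)..s, g r := by
      intro s hs
      obtain ⟨-, h2, -⟩ := hS1 _ (hp s hs z hz)
      have h4 := congrArg (fun η : PathSpace Z => η ⟨1, by simp⟩) h2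
      simp only [ContinuousMap.add_apply, ContinuousMap.smul_apply, primitiveCLM_apply] at h4
      refine h4.trans ?_
      congr 1
      have h5 := intervalIntegral.smul_integral_comp_mul_left (a := 0) (b := 1) g s
      rw [mul_zero, mul_one] at h5
      refine Eq.trans ?_ h5
      congr 1
      refine intervalIntegral.integral_congr fun r hr => ?_
      rw [uIcc_of_le zero_le_one] at hr
      have := hS3 s hs z hz ⟨r, hr⟩
      simp only [hg, projIcc_of_mem _ hr]
      exact congrArg X this.symm
    have h0 : (0 : ℝ) ∈ Ioo (-δ) δ := by simpa using hδ
    have h2 : HasDerivAt (fun s => z + ∫ r in (0 : ℝ)..s, g r) (g t) t := by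
      refine HasDerivAt.const_add _ (intervalIntegral.integral_hasDerivAt_right ?_ ?_ ?_)
      · refine (hgc.mono ?_).intervalIntegrable
        exact ordConnected_Ioo.uIcc_subset h0 ht
      · exact hgc.stronglyMeasurableAtFilter isOpen_Ioo t ht
      · exact hgc.continuousAt (isOpen_Ioo.mem_nhds ht)
    refine h2.congr_of_eventuallyEq ?_
    filter_upwards [isOpen_Ioo.mem_nhds ht] with s hs using h1 s hs

/-- Local flow of a smooth vector field on an open subset of a finite-dimensional space. -/
theorem exists_flow_of_contDiffOn [FiniteDimensional ℝ Z] {X : Z → Z} {O : Set Z} (hO : IsOpen O)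
    (hX : ContDiffOn ℝ ∞ X O) {z₀ : Z} (hz₀ : z₀ ∈ O) :
    ∃ (φ : ℝ × Z → Z) (δ : ℝ), 0 < δ ∧
      (∀ t ∈ Ioo (-δ) δ, ∀ z ∈ Metric.ball z₀ δ, ContDiffAt ℝ ∞ φ (t, z)) ∧
      (∀ t ∈ Ioo (-δ) δ, ∀ z ∈ Metric.ball z₀ δ, φ (t, z) ∈ O) ∧
      (∀ z ∈ Metric.ball z₀ δ, φ (0, z) = z) ∧
      ∀ t ∈ Ioo (-δ) δ, ∀ z ∈ Metric.ball z₀ δ,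
        HasDerivAt (fun s => φ (s, z)) (X (φ (t, z))) t := by
  have : CompleteSpace Z := FiniteDimensional.complete ℝ Z
  obtain ⟨r, hr, hrO⟩ := Metric.nhds_basis_closedBall.mem_iff.1 (hO.mem_nhds hz₀)
  -- The cut-off field is smooth on the whole space and equals `X` on the ball of radius `r / 2`.
  -- For short times the flow stays in that ball.
  let b : ContDiffBump z₀ := ⟨r / 2, r, by positivity, by linarith⟩
  have hbX : ContDiff ℝ ∞ (fun z => b z • X z) := by
    rw [contDiff_iff_contDiffAt]
    intro z
    by_cases hz : z ∈ O
    · exact b.contDiffAt.smul (hX.contDiffAt (hO.mem_nhds hz))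
    · have h1 : ∀ᶠ y in 𝓝 z, b y • X y = 0 := by
        have h2 : (Metric.closedBall z₀ r)ᶜ ∈ 𝓝 z :=
          Metric.isClosed_closedBall.isOpen_compl.mem_nhds fun h => hz (hrO h)
        filter_upwards [h2] with y hy
        rw [b.zero_of_le_dist (by simpa using (lt_of_not_ge fun h => hy (Metric.mem_closedBall.2 h)).le), zero_smul]
      exact contDiffAt_const.congr_of_eventuallyEq h1
  obtain ⟨φ, δ, hδ, h1, h2, h3⟩ := exists_flow_of_contDiff _ hbX z₀
  have hc : ContinuousAt φ (0, z₀) :=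
    (h1 0 (by simpa using hδ) z₀ (Metric.mem_ball_self hδ)).continuousAt
  have h4 : ∀ᶠ p in 𝓝 ((0 : ℝ), z₀), φ p ∈ Metric.ball z₀ (r / 2) := by
    refine hc.eventually_mem ?_
    rw [h2 z₀ (Metric.mem_ball_self hδ)]
    exact Metric.ball_mem_nhds _ (by positivity)
  obtain ⟨δ', hδ', h5⟩ := Metric.eventually_nhds_iff.1 h4
  have hsub : ∀ t ∈ Ioo (-min δ δ') (min δ δ'), ∀ z ∈ Metric.ball z₀ (min δ δ'),
      t ∈ Ioo (-δ) δ ∧ z ∈ Metric.ball z₀ δ ∧ φ (t, z) ∈ Metric.ball z₀ (r / 2) := by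
    intro t ht z hz
    replace ht := abs_lt.2 ht
    refine ⟨abs_lt.1 (ht.trans_le (min_le_left _ _)),
      Metric.ball_subset_ball (min_le_left _ _) hz, h5 ?_⟩
    rw [Prod.dist_eq, max_lt_iff]
    exact ⟨by rw [Real.dist_eq, sub_zero]; exact ht.trans_le (min_le_right _ _),
      Metric.ball_subset_ball (min_le_right _ _) hz⟩
  refine ⟨φ, min δ δ', lt_min hδ hδ', fun t ht z hz => h1 t (hsub t ht z hz).1 z (hsub t ht z hz).2.1,
    fun t ht z hz => hrO (Metric.ball_subset_closedBall (Metric.ball_subset_ball (by linarith)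
      (hsub t ht z hz).2.2)),
    fun z hz => h2 z (Metric.ball_subset_ball (min_le_left _ _) hz), fun t ht z hz => ?_⟩
  have h6 := h3 t (hsub t ht z hz).1 z (hsub t ht z hz).2.1
  rwa [b.one_of_mem_closedBall (Metric.ball_subset_closedBall (hsub t ht z hz).2.2), one_smul] at h6

end LocalFlow

/-! ### Integral curves and charts -/

section IntegralCurves

variable {Z : Type*} [NormedAddCommGroup Z] [NormedSpace ℝ Z] {H : Type*} [TopologicalSpace H]
  {I : ModelWithCorners ℝ Z H} {N : Type*} [TopologicalSpace N] [ChartedSpace H N]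

/-- A vector field read in the chart centred at `k`. -/
def chartField (X : ∀ x : N, TangentSpace I x) (k : N) (z : Z) : Z :=
  mfderiv I 𝓘(ℝ, Z) (extChartAt I k) ((extChartAt I k).symm z) (X ((extChartAt I k).symm z))

variable [IsManifold I 1 N] {X : ∀ x : N, TangentSpace I x} {k : N}

lemma hasMFDerivAt_extChartAt' {x : N} (hx : x ∈ (extChartAt I k).source) :
    HasMFDerivAt I 𝓘(ℝ, Z) (extChartAt I k) x (mfderiv I 𝓘(ℝ, Z) (extChartAt I k) x) :=
  (mdifferentiableAt_extChartAt (by simpa using hx)).hasMFDerivAt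

lemma hasDerivWithinAt_extChartAt_comp {γ : ℝ → N} {s : Set ℝ} {t : ℝ}
    (hγ : HasMFDerivWithinAt 𝓘(ℝ, ℝ) I γ s t ((1 : ℝ →L[ℝ] ℝ).smulRight (X (γ t))))
    (hk : γ t ∈ (extChartAt I k).source) :
    HasDerivWithinAt (fun r => extChartAt I k (γ r)) (chartField X k (extChartAt I k (γ t))) s t := by
  have h1 := (hasMFDerivAt_extChartAt' hk).comp_hasMFDerivWithinAt t hγ
  rw [hasMFDerivWithinAt_iff_hasFDerivWithinAt] at h1
  rw [hasDerivWithinAt_iff_hasFDerivWithinAt]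
  refine h1.congr_fderiv ?_
  rw [chartField, (extChartAt I k).left_inv hk]
  refine ContinuousLinearMap.ext fun r => ?_
  exact (mfderiv I 𝓘(ℝ, Z) (extChartAt I k) (γ t)).map_smul r (X (γ t))

section

variable [I.Boundaryless]

lemma hasMFDerivAt_extChartAt_symm' {z : Z} (hz : z ∈ (extChartAt I k).target) :
    HasMFDerivAt 𝓘(ℝ, Z) I (extChartAt I k).symm z
      (mfderiv 𝓘(ℝ, Z) I (extChartAt I k).symm z) := by
  have h := mdifferentiableWithinAt_extChartAt_symm (I := I) hz
  rw [I.range_eq_univ, mdifferentiableWithinAt_univ] at h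
  exact h.hasMFDerivAt

lemma mfderiv_extChartAt_comp_symm {z : Z} (hz : z ∈ (extChartAt I k).target) :
    (mfderiv I 𝓘(ℝ, Z) (extChartAt I k) ((extChartAt I k).symm z)).comp
      (mfderiv 𝓘(ℝ, Z) I (extChartAt I k).symm z) = ContinuousLinearMap.id ℝ Z := by
  have h := mfderiv_extChartAt_comp_mfderivWithin_extChartAt_symm (I := I) hz
  rwa [I.range_eq_univ, mfderivWithin_univ] at h

lemma mfderiv_extChartAt_symm_comp {z : Z} (hz : z ∈ (extChartAt I k).target) :
    (mfderiv 𝓘(ℝ, Z) I (extChartAt I k).symm z).comp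
      (mfderiv I 𝓘(ℝ, Z) (extChartAt I k) ((extChartAt I k).symm z)) =
      ContinuousLinearMap.id ℝ (TangentSpace I ((extChartAt I k).symm z)) := by
  have h := mfderivWithin_extChartAt_symm_comp_mfderiv_extChartAt (I := I) hz
  rwa [I.range_eq_univ, mfderivWithin_univ] at h

lemma mfderiv_extChartAt_symm_chartField {z : Z} (hz : z ∈ (extChartAt I k).target) :
    mfderiv 𝓘(ℝ, Z) I (extChartAt I k).symm z (chartField (Z := Z) X k z) = X ((extChartAt I k).symm z) :=
  DFunLike.congr_fun (mfderiv_extChartAt_symm_comp hz) (X ((extChartAt I k).symm z))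

lemma hasMFDerivAt_extChartAt_symm_comp {g : ℝ → Z} {t : ℝ}
    (hg : HasDerivAt g (chartField X k (g t)) t) (hk : g t ∈ (extChartAt I k).target) :
    HasMFDerivAt 𝓘(ℝ, ℝ) I (fun r => (extChartAt I k).symm (g r)) t
      ((1 : ℝ →L[ℝ] ℝ).smulRight (X ((extChartAt I k).symm (g t)))) := by
  have h1 := (hasMFDerivAt_extChartAt_symm' hk).comp t
    (hasMFDerivAt_iff_hasFDerivAt.2 hg.hasFDerivAt)
  refine h1.congr_mfderiv ?_
  refine ContinuousLinearMap.ext fun r => ?_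
  exact ((mfderiv 𝓘(ℝ, Z) I (extChartAt I k).symm (g t)).map_smul r
    (chartField (Z := Z) X k (g t))).trans
    (congrArg ((show ℝ from r) • ·) (mfderiv_extChartAt_symm_chartField (X := X) hk))

end

variable [T2Space N]

/-- The coincidence set is closed since `N` is Hausdorff. It extends to the right of each of its
points by uniqueness for Lipschitz fields in a chart centred there. Regularity of the field is
needed along one of the two curves only. -/
lemma eqOn_Icc_of_isMIntegralCurveOn {γ γ' : ℝ → N} {s : ℝ}
    (hγ : IsMIntegralCurveOn γ X (Icc 0 s)) (hγ' : IsMIntegralCurveOn γ' X (Icc 0 s))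
    (h0 : γ 0 = γ' 0)
    (hX : ∀ t ∈ Icc 0 s, ContDiffAt ℝ 1 (chartField X (γ' t)) (extChartAt I (γ' t) (γ' t))) :
    EqOn γ γ' (Icc 0 s) := by
  have hcl : IsClosed ({t | γ t = γ' t} ∩ Icc 0 s) := by
    have h1 : IsClosed {t : Icc 0 s | γ t = γ' t} :=
      isClosed_eq (continuousOn_iff_continuous_domRestrict.1 hγ.continuousOn)
        (continuousOn_iff_continuous_domRestrict.1 hγ'.continuousOn)
    convert! isClosed_Icc.isClosedEmbedding_subtypeVal.isClosedMap _ h1 using 1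
    ext t
    simp [and_comm]
  refine hcl.Icc_subset_of_forall_mem_nhdsWithin h0 ?_
  rintro t ⟨htγ : γ t = γ' t, ht⟩
  have htI : t ∈ Icc 0 s := ⟨ht.1, ht.2.le⟩
  set k := γ' t
  obtain ⟨K, u, hu, hLip⟩ := (hX t htI).exists_lipschitzOnWith
  have hnhds : 𝓝[≥] t ≤ 𝓝[Icc 0 s] t :=
    nhdsWithin_le_iff.2 (mem_of_superset (Icc_mem_nhdsGE ht.2) (Icc_subset_Icc_left ht.1))
  have hev (η : ℝ → N) (hη : IsMIntegralCurveOn η X (Icc 0 s)) (hηt : η t = k) :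
      ∀ᶠ r in 𝓝[≥] t, η r ∈ (extChartAt I k).source ∧ extChartAt I k (η r) ∈ u := by
    have h1 : Tendsto η (𝓝[≥] t) (𝓝 k) := by
      rw [← hηt]; exact (hη t htI).continuousWithinAt.tendsto.mono_left hnhds
    exact h1.eventually ((eventually_mem_set.2 (extChartAt_source_mem_nhds (I := I) k)).and
      ((continuousAt_extChartAt k).eventually_mem hu))
  obtain ⟨b, hb, hbs⟩ := (mem_nhdsGE_iff_exists_Icc_subset).1
    ((hev γ hγ htγ).and (hev γ' hγ' rfl))
  set c := min b s
  have htc : t < c := lt_min hb ht.2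
  have hcb : ∀ r ∈ Icc t c, r ∈ Icc t b := fun r hr => ⟨hr.1, hr.2.trans (min_le_left _ _)⟩
  have hcs : Icc t c ⊆ Icc 0 s := fun r hr => ⟨ht.1.trans hr.1, hr.2.trans (min_le_right _ _)⟩
  have hder (η : ℝ → N) (hη : IsMIntegralCurveOn η X (Icc 0 s)) (r : ℝ) (hr : r ∈ Icc t c)
      (hηr : η r ∈ (extChartAt I k).source) :
      HasDerivWithinAt (fun r => extChartAt I k (η r)) (chartField X k (extChartAt I k (η r)))
        (Icc t c) r :=
    (hasDerivWithinAt_extChartAt_comp (hη r (hcs hr)) hηr).mono hcs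
  have hder' (η : ℝ → N) (hη : IsMIntegralCurveOn η X (Icc 0 s)) (r : ℝ) (hr : r ∈ Ico t c)
      (hηr : η r ∈ (extChartAt I k).source) :
      HasDerivWithinAt (fun r => extChartAt I k (η r)) (chartField X k (extChartAt I k (η r)))
        (Ici r) r :=
    (hder η hη r ⟨hr.1, hr.2.le⟩ hηr).mono_of_mem_nhdsWithin
      (mem_of_superset (Icc_mem_nhdsGE hr.2) (Icc_subset_Icc_left hr.1))
  have heq := ODE_solution_unique_of_mem_Icc_right (v := fun _ => chartField X k)
    (s := fun _ => u) (fun _ _ => hLip)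
    (fun r hr => (hder γ hγ r hr (hbs (hcb r hr)).1.1).continuousWithinAt)
    (fun r hr => hder' γ hγ r hr (hbs (hcb r ⟨hr.1, hr.2.le⟩)).1.1)
    (fun r hr => (hbs (hcb r ⟨hr.1, hr.2.le⟩)).1.2)
    (fun r hr => (hder γ' hγ' r hr (hbs (hcb r hr)).2.1).continuousWithinAt)
    (fun r hr => hder' γ' hγ' r hr (hbs (hcb r ⟨hr.1, hr.2.le⟩)).2.1)
    (fun r hr => (hbs (hcb r ⟨hr.1, hr.2.le⟩)).2.2)
    (by simp only [htγ]; rfl)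
  refine mem_of_superset (Icc_mem_nhdsGT htc) fun r hr => ?_
  exact (extChartAt I k).injOn (hbs (hcb r hr)).1.1 (hbs (hcb r hr)).2.1 (heq hr)

lemma eqOn_uIcc_of_isMIntegralCurveOn {γ γ' : ℝ → N} {s : ℝ}
    (hγ : IsMIntegralCurveOn γ X (uIcc 0 s)) (hγ' : IsMIntegralCurveOn γ' X (uIcc 0 s))
    (h0 : γ 0 = γ' 0)
    (hX : ∀ t ∈ uIcc 0 s, ContDiffAt ℝ 1 (chartField X (γ' t)) (extChartAt I (γ' t) (γ' t))) :
    EqOn γ γ' (uIcc 0 s) := by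
  rcases le_total 0 s with hs | hs
  · rw [uIcc_of_le hs] at *
    exact eqOn_Icc_of_isMIntegralCurveOn hγ hγ' h0 hX
  · rw [uIcc_of_ge hs] at *
    -- For negative `s`, reverse time: both curves become integral curves of `-X`.
    have hset : {t : ℝ | t * (-1) ∈ Icc s 0} = Icc 0 (-s) := by
      ext t; simp only [mem_ofPred_eq, mem_Icc]; constructor <;> rintro ⟨h1, h2⟩ <;> constructor <;>
        linarith
    have h1 := hγ.comp_mul (-1)
    have h2 := hγ'.comp_mul (-1)
    rw [hset] at h1 h2
    have h3 := eqOn_Icc_of_isMIntegralCurveOn h1 h2 (by simpa using h0) (by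
      intro t ht
      have h4 := hX (t * (-1)) ⟨by linarith [ht.2], by linarith [ht.1]⟩
      have h5 : chartField ((-1 : ℝ) • X) = fun k => - chartField X k := by
        funext k z
        exact (mfderiv I 𝓘(ℝ, Z) (extChartAt I k) ((extChartAt I k).symm z)).map_smul (-1 : ℝ)
          (X ((extChartAt I k).symm z)) |>.trans (neg_one_smul ℝ _)
      simp only [h5, Function.comp]
      exact h4.neg)
    intro t ht
    have := h3 (x := -t) ⟨by linarith [ht.2], by linarith [ht.1]⟩
    simpa using this

end IntegralCurves

/-! ### Canonical coordinates on the cotangent bundle -/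

lemma fderiv_eq_of_hasMFDerivAt {V W : Type*} [NormedAddCommGroup V] [NormedSpace ℝ V]
    [NormedAddCommGroup W] [NormedSpace ℝ W] {f : V → W} {z : V}
    {f' : TangentSpace 𝓘(ℝ, V) z →L[ℝ] TangentSpace 𝓘(ℝ, W) (f z)}
    (h : HasMFDerivAt 𝓘(ℝ, V) 𝓘(ℝ, W) f z f') (v : V) : fderiv ℝ f z v = f' v := by
  rw [← h.mfderiv, mfderiv_eq_fderiv]
  rfl

/-! ### Linear symplectic algebra on `E × P` -/

section PairingForm

variable {E P : Type*} [NormedAddCommGroup E] [NormedSpace ℝ E]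
  [NormedAddCommGroup P] [NormedSpace ℝ P] (B : P →L[ℝ] E →L[ℝ] ℝ)

/-- The symplectic form of `E × P` associated with a pairing of `P` and `E`. -/
def pairingForm (v w : E × P) : ℝ := B v.2 w.1 - B w.2 v.1

lemma pairingForm_swap (v w : E × P) : pairingForm B v w = - pairingForm B w v := by
  simp [pairingForm]

/-- The symplectic form as a map from vectors to covectors, `X ↦ ω(·, X)`. -/
def pairingFlat : (E × P) →ₗ[ℝ] (E × P) →L[ℝ] ℝ where
  toFun X := (B.flip X.1).comp (ContinuousLinearMap.snd ℝ _ _) -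
    (B X.2).comp (ContinuousLinearMap.fst ℝ _ _)
  map_add' X Y := by
    ext v
    · simp; ring
    · simp
  map_smul' c X := by
    ext v
    · simp
    · simp

lemma pairingFlat_apply (X v : E × P) : pairingFlat B X v = pairingForm B v X := by
  simp [pairingFlat, pairingForm]

variable {B}

lemma pairingFlat_injective (hP : ∀ p, B p = 0 → p = 0) (hE : ∀ x, (∀ p, B p x = 0) → x = 0) :
    Function.Injective (pairingFlat B) := by
  rw [← LinearMap.ker_eq_bot, LinearMap.ker_eq_bot']
  intro X hX
  have h (v : E × P) : pairingForm B v X = 0 := by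
    rw [← pairingFlat_apply, hX]; rfl
  have h1 : X.1 = 0 := hE _ fun p => by simpa [pairingForm] using h (0, p)
  have h2 : X.2 = 0 := hP _ (by
    ext v
    simpa [pairingForm] using h (v, 0))
  exact Prod.ext h1 h2

lemma exists_pairingSharp [FiniteDimensional ℝ E] [FiniteDimensional ℝ P]
    (hP : ∀ p, B p = 0 → p = 0) (hE : ∀ x, (∀ p, B p x = 0) → x = 0) :
    ∃ J : ((E × P) →L[ℝ] ℝ) →L[ℝ] E × P, ∀ a v, pairingForm B v (J a) = a v := by
  -- An injective map between a space and its dual, which have equal finite dimension, is an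
  -- isomorphism.
  let e := LinearEquiv.ofInjectiveOfFinrankEq (pairingFlat B) (pairingFlat_injective hP hE) (by
    rw [← (LinearMap.toContinuousLinearMap (𝕜 := ℝ) (E := E × P) (F' := ℝ)).finrank_eq]
    exact Subspace.dual_finrank_eq.symm)
  refine ⟨LinearMap.toContinuousLinearMap (e.symm : ((E × P) →L[ℝ] ℝ) →ₗ[ℝ] E × P), fun a v => ?_⟩
  rw [← pairingFlat_apply]
  exact DFunLike.congr_fun (e.apply_symm_apply a) v

/-- A map preserving the Liouville form is symplectic. -/
lemma pairingForm_fderiv_of_liouville {c : E × P → E × P} {z₀ : E × P} (hc : ContDiffAt ℝ 2 c z₀)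
    (h : ∀ᶠ z in 𝓝 z₀, ∀ v, B (c z).2 (fderiv ℝ c z v).1 = B z.2 v.1) (v w : E × P) :
    pairingForm B (fderiv ℝ c z₀ v) (fderiv ℝ c z₀ w) = pairingForm B v w := by
  have hsymm : IsSymmSndFDerivAt ℝ c z₀ := hc.isSymmSndFDerivAt (by simp)
  have hc1 : HasFDerivAt c (fderiv ℝ c z₀) z₀ := (hc.differentiableAt (by simp)).hasFDerivAt
  have hc2 : HasFDerivAt (fderiv ℝ c) (fderiv ℝ (fderiv ℝ c) z₀) z₀ :=
    ((hc.fderiv_right (m := 1) (by norm_num)).differentiableAt (by simp)).hasFDerivAt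
  -- The identity `h` applied to `w` is differentiated in the direction `v`. The term with the
  -- second derivative of `c` is symmetric in `v` and `w`, so it disappears on antisymmetrising.
  have key (v w : E × P) : B v.2 w.1 = B (fderiv ℝ c z₀ v).2 (fderiv ℝ c z₀ w).1 +
      B (c z₀).2 (fderiv ℝ (fderiv ℝ c) z₀ v w).1 := by
    have h1 : HasFDerivAt (fun z => (c z).2) ((ContinuousLinearMap.snd ℝ E P).comp
      (fderiv ℝ c z₀)) z₀ := hc1.snd
    have h2 : HasFDerivAt (fun z => fderiv ℝ c z w)
        ((ContinuousLinearMap.apply ℝ _ w).comp (fderiv ℝ (fderiv ℝ c) z₀)) z₀ :=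
      HasFDerivAt.comp z₀ (g := ContinuousLinearMap.apply ℝ (E × P) w)
        (ContinuousLinearMap.hasFDerivAt _) hc2
    have h3 := (B.hasFDerivAt.comp z₀ h1).clm_apply h2.fst
    have h4 : HasFDerivAt (fun z : E × P => B z.2 w.1)
        ((B.flip w.1).comp (ContinuousLinearMap.snd ℝ E P)) z₀ :=
      ContinuousLinearMap.hasFDerivAt ((B.flip w.1).comp (ContinuousLinearMap.snd ℝ E P))
    have h5 := h4.unique (h3.congr_of_eventuallyEq (h.mono fun z hz => (hz w).symm))
    have h6 := DFunLike.congr_fun h5 v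
    simp at h6
    rw [h6, add_comm]
  have e1 := key v w
  have e2 := key w v
  rw [hsymm v w] at e1
  simp only [pairingForm]
  linarith

/-- The exterior derivative of the Liouville form. -/
lemma fderiv_liouville_apply {L : E × P → (E × P) →L[ℝ] ℝ} {z₀ : E × P}
    (h : ∀ᶠ z in 𝓝 z₀, ∀ v, L z v = B z.2 v.1) (v w : E × P) :
    fderiv ℝ L z₀ v w = B v.2 w.1 := by
  let A : (E × P) →L[ℝ] (E × P) →L[ℝ] ℝ :=
    ((ContinuousLinearMap.compL ℝ (E × P) E ℝ).flip (ContinuousLinearMap.fst ℝ E P)).comp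
      (B.comp (ContinuousLinearMap.snd ℝ E P))
  have h1 : L =ᶠ[𝓝 z₀] A := h.mono fun z hz => ContinuousLinearMap.ext fun v => hz v
  rw [h1.fderiv_eq, A.fderiv]
  rfl

end PairingForm

/-! ### The Liouville and symplectic forms in bundle charts -/

section CotangentCharts

variable {E : Type*} [NormedAddCommGroup E] [NormedSpace ℝ E]
  {M : Type*} [TopologicalSpace M] [ChartedSpace E M] [IsManifold 𝓘(ℝ, E) ∞ M]

instance : IsManifold (cotangentModel E) 1 (Cotangent E M) := IsManifold.of_le (n := ∞) (by simp)

/-- Points of one fibre are separated inside a common trivialisation; points of different fibres are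
separated by their projections. -/
instance [T2Space M] : T2Space (Cotangent E M) := by
  refine ⟨fun x y hxy => ?_⟩
  by_cases h : x.1 = y.1
  · let e := trivializationAt (E →L[ℝ] ℝ) (fun q : M => TangentSpace 𝓘(ℝ, E) q →L[ℝ] ℝ) x.1
    have hx : x ∈ e.source := by
      rw [e.mem_source]; exact mem_baseSet_trivializationAt _ _ x.1
    have hy : y ∈ e.source := by
      rw [e.mem_source, ← h]; exact mem_baseSet_trivializationAt _ _ x.1
    have hne : e x ≠ e y := fun h' => hxy (e.injOn hx hy h')
    obtain ⟨u, v, hu, hv, hxu, hyv, huv⟩ := t2_separation hne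
    refine ⟨_, _, e.continuousOn.isOpen_inter_preimage e.open_source hu,
      e.continuousOn.isOpen_inter_preimage e.open_source hv, ⟨hx, hxu⟩, ⟨hy, hyv⟩, ?_⟩
    rw [Set.disjoint_left] at huv ⊢
    exact fun a ha hb => huv ha.2 hb.2
  · obtain ⟨u, v, hu, hv, hxu, hyv, huv⟩ := t2_separation h
    have hc : Continuous (fun ℓ : Cotangent E M => ℓ.1) := FiberBundle.continuous_proj _ _
    exact ⟨_, _, hu.preimage hc, hv.preimage hc, hxu, hyv, huv.preimage _⟩

lemma mem_extChartAt_source_iff {k ℓ : Cotangent E M} :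
    ℓ ∈ (extChartAt (cotangentModel E) k).source ↔ ℓ.1 ∈ (extChartAt 𝓘(ℝ, E) k.1).source := by
  rw [FiberBundle.extChartAt]
  simp [hom_trivializationAt_apply]

lemma extChartAt_apply_fst (k ℓ : Cotangent E M) :
    (extChartAt (cotangentModel E) k ℓ).1 = extChartAt 𝓘(ℝ, E) k.1 ℓ.1 := by
  rw [FiberBundle.extChartAt]
  simp [hom_trivializationAt_apply]

/-- The momentum coordinate is `ℓ` composed with the inverse of the tangent trivialisation, and that
trivialisation is the differential of the base chart. This links the Hom-bundle charts to `p dq`. -/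
lemma apply_eq_extChartAt_apply_snd {k ℓ : Cotangent E M}
    (h : ℓ ∈ (extChartAt (cotangentModel E) k).source) (v : TangentSpace 𝓘(ℝ, E) ℓ.1) :
    (ℓ.2 : TangentSpace 𝓘(ℝ, E) ℓ.1 →L[ℝ] ℝ) v = (extChartAt (cotangentModel E) k ℓ).2
      (mfderiv 𝓘(ℝ, E) 𝓘(ℝ, E) (extChartAt 𝓘(ℝ, E) k.1) ℓ.1 v) := by
  rw [mem_extChartAt_source_iff, extChartAt_source] at h
  have h1 : (extChartAt (cotangentModel E) k ℓ).2 =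
      ContinuousLinearMap.inCoordinates E (TangentSpace 𝓘(ℝ, E)) ℝ (fun _ : M => ℝ)
        k.1 ℓ.1 k.1 ℓ.1 ℓ.2 := by
    simp only [extChartAt]
    simp [hom_chart]
  have : IsManifold 𝓘(ℝ, E) 1 M := IsManifold.of_le (n := ∞) (by simp)
  have h2 : ℓ.1 ∈ (trivializationAt E (TangentSpace 𝓘(ℝ, E)) k.1).baseSet := by
    simpa using h
  have h3 := (trivializationAt E (TangentSpace 𝓘(ℝ, E)) k.1).symmL_continuousLinearMapAt (R := ℝ) h2 v
  have h4 : Trivialization.continuousLinearMapAt ℝ (trivializationAt ℝ (fun _ : M => ℝ) k.1) ℓ.1 =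
      ContinuousLinearMap.id ℝ ℝ := Bundle.Trivial.continuousLinearMapAt_trivialization ℝ M ℝ ℓ.1
  rw [h1, ContinuousLinearMap.inCoordinates, h4]
  conv_lhs => rw [← h3, TangentBundle.continuousLinearMapAt_trivializationAt h]
  rfl

lemma extChartAt_target_iff {k : Cotangent E M} {z : E × (E →L[ℝ] ℝ)} :
    z ∈ (extChartAt (cotangentModel E) k).target ↔ z.1 ∈ (extChartAt 𝓘(ℝ, E) k.1).target := by
  rw [FiberBundle.extChartAt_target]
  simp
  exact fun h => (chartAt E k.1).map_target h

lemma mdifferentiableAt_proj (ℓ : Cotangent E M) :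
    MDifferentiableAt (cotangentModel E) 𝓘(ℝ, E) (fun ℓ' : Cotangent E M => ℓ'.1) ℓ :=
  ((Bundle.contMDiff_proj (n := ∞) (IB := 𝓘(ℝ, E)) (F := E →L[ℝ] ℝ)
    (fun q : M => TangentSpace 𝓘(ℝ, E) q →L[ℝ] ℝ)) ℓ).mdifferentiableAt (by simp)

/-- The bundle chart covers the base chart, so `dπ` followed by the base chart is the position part
of the bundle chart's differential. Hence `ς` is `p dq` in every such chart, not only in the one
centred at the point. -/
lemma liouvilleForm_apply {k ℓ : Cotangent E M}
    (h : ℓ ∈ (extChartAt (cotangentModel E) k).source) (v : TangentSpace (cotangentModel E) ℓ) :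
    liouvilleForm ℓ v = (extChartAt (cotangentModel E) k ℓ).2
      (mfderiv (cotangentModel E) 𝓘(ℝ, E × (E →L[ℝ] ℝ)) (extChartAt (cotangentModel E) k) ℓ v).1 := by
  have : IsManifold 𝓘(ℝ, E) 1 M := IsManifold.of_le (n := ∞) (by simp)
  have h1 : liouvilleForm ℓ v = (ℓ.2 : TangentSpace 𝓘(ℝ, E) ℓ.1 →L[ℝ] ℝ)
      (mfderiv (cotangentModel E) 𝓘(ℝ, E) (fun ℓ' : Cotangent E M => ℓ'.1) ℓ v) := rfl
  rw [h1, apply_eq_extChartAt_apply_snd h]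
  have h2 := (hasMFDerivAt_extChartAt' (mem_extChartAt_source_iff.1 h)).comp ℓ
    (mdifferentiableAt_proj ℓ).hasMFDerivAt
  have h3 := (hasMFDerivAt_iff_hasFDerivAt.2 (hasFDerivAt_fst (𝕜 := ℝ)
    (p := extChartAt (cotangentModel E) k ℓ))).comp ℓ (hasMFDerivAt_extChartAt' h)
  have h4 : ∀ ℓ' : Cotangent E M, extChartAt 𝓘(ℝ, E) k.1 ℓ'.1 =
    (extChartAt (cotangentModel E) k ℓ').1 := fun ℓ' => (extChartAt_apply_fst k ℓ').symm
  have h5 := DFunLike.congr_fun (hasMFDerivAt_unique h2 (h3.congr_of_eventuallyEq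
    (Eventually.of_forall h4))) v
  exact congrArg (extChartAt (cotangentModel E) k ℓ).2 h5

lemma liouvilleFormInChart_apply {k : Cotangent E M} {z : E × (E →L[ℝ] ℝ)}
    (hz : z ∈ (extChartAt (cotangentModel E) k).target) (v : E × (E →L[ℝ] ℝ)) :
    liouvilleFormInChart k z v = z.2 v.1 := by
  have h1 := liouvilleForm_apply ((extChartAt (cotangentModel E) k).map_target hz)
    (mfderiv 𝓘(ℝ, E × (E →L[ℝ] ℝ)) (cotangentModel E) (extChartAt (cotangentModel E) k).symm z v)
  have h2 := DFunLike.congr_fun (mfderiv_extChartAt_comp_symm hz) v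
  rw [(extChartAt (cotangentModel E) k).right_inv hz] at h1
  exact h1.trans (congrArg (fun w : E × (E →L[ℝ] ℝ) => z.2 w.1) h2)

/-- The canonical symplectic form of `E × E*`. -/
abbrev canonicalForm : E × (E →L[ℝ] ℝ) → E × (E →L[ℝ] ℝ) → ℝ :=
  pairingForm (ContinuousLinearMap.id ℝ (E →L[ℝ] ℝ))

lemma symplecticForm_self (ℓ : Cotangent E M) (v w : TangentSpace (cotangentModel E) ℓ) :
    symplecticForm ℓ v w = canonicalForm
      (mfderiv (cotangentModel E) 𝓘(ℝ, E × (E →L[ℝ] ℝ)) (extChartAt (cotangentModel E) ℓ) ℓ v)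
      (mfderiv (cotangentModel E) 𝓘(ℝ, E × (E →L[ℝ] ℝ)) (extChartAt (cotangentModel E) ℓ) ℓ w) := by
  have h : ∀ᶠ z in 𝓝 (extChartAt (cotangentModel E) ℓ ℓ), ∀ v,
      liouvilleFormInChart ℓ z v = ContinuousLinearMap.id ℝ (E →L[ℝ] ℝ) z.2 v.1 := by
    filter_upwards [(isOpen_extChartAt_target ℓ).mem_nhds (mem_extChartAt_target ℓ)] with z hz v
    exact liouvilleFormInChart_apply hz v
  exact congrArg₂ (· - ·) (fderiv_liouville_apply h _ _) (fderiv_liouville_apply h _ _)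

/-- The change of canonical coordinates is symplectic. -/
lemma symplecticForm_eq {k ℓ : Cotangent E M} (h : ℓ ∈ (extChartAt (cotangentModel E) k).source)
    (v w : TangentSpace (cotangentModel E) ℓ) :
    symplecticForm ℓ v w = canonicalForm
      (mfderiv (cotangentModel E) 𝓘(ℝ, E × (E →L[ℝ] ℝ)) (extChartAt (cotangentModel E) k) ℓ v)
      (mfderiv (cotangentModel E) 𝓘(ℝ, E × (E →L[ℝ] ℝ)) (extChartAt (cotangentModel E) k) ℓ w) := by
  set φ := extChartAt (cotangentModel E) ℓ
  set χ := extChartAt (cotangentModel E) k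
  have hφ : φ.symm (φ ℓ) = ℓ := φ.left_inv (mem_extChartAt_source ℓ)
  have hz₀ : φ ℓ ∈ φ.target := mem_extChartAt_target ℓ
  have hder : ∀ z ∈ φ.target, φ.symm z ∈ χ.source →
      HasMFDerivAt 𝓘(ℝ, E × (E →L[ℝ] ℝ)) 𝓘(ℝ, E × (E →L[ℝ] ℝ)) (fun z => χ (φ.symm z)) z
      ((mfderiv (cotangentModel E) 𝓘(ℝ, E × (E →L[ℝ] ℝ)) χ (φ.symm z)).comp
        (mfderiv 𝓘(ℝ, E × (E →L[ℝ] ℝ)) (cotangentModel E) φ.symm z)) := fun z hz hz' =>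
    (hasMFDerivAt_extChartAt' hz').comp z (hasMFDerivAt_extChartAt_symm' hz)
  have hev : ∀ᶠ z in 𝓝 (φ ℓ), z ∈ φ.target ∧ φ.symm z ∈ χ.source := by
    refine ((isOpen_extChartAt_target ℓ).eventually_mem hz₀).and ?_
    refine (continuousAt_extChartAt_symm ℓ).eventually_mem ?_
    rw [hφ]
    exact (isOpen_extChartAt_source k).mem_nhds h
  have hc : ContDiffAt ℝ 2 (fun z => χ (φ.symm z)) (φ ℓ) := by
    have h1 : ContMDiffAt 𝓘(ℝ, E × (E →L[ℝ] ℝ)) (cotangentModel E) ∞ φ.symm (φ ℓ) :=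
      (contMDiffOn_extChartAt_symm ℓ).contMDiffAt ((isOpen_extChartAt_target ℓ).mem_nhds hz₀)
    have h2 : ContMDiffAt (cotangentModel E) 𝓘(ℝ, E × (E →L[ℝ] ℝ)) ∞ χ (φ.symm (φ ℓ)) := by
      rw [hφ]
      exact contMDiffAt_extChartAt' (by simpa [χ] using h)
    exact (contMDiffAt_iff_contDiffAt.1 (h2.comp _ h1)).of_le (by norm_cast)
  -- Both charts read the Liouville form as `p dq`, so the transition map preserves it.
  have hL : ∀ᶠ z in 𝓝 (φ ℓ), ∀ v, ContinuousLinearMap.id ℝ (E →L[ℝ] ℝ) (χ (φ.symm z)).2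
      (fderiv ℝ (fun z => χ (φ.symm z)) z v).1 =
      ContinuousLinearMap.id ℝ (E →L[ℝ] ℝ) z.2 v.1 := by
    filter_upwards [hev] with z hz v
    rw [fderiv_eq_of_hasMFDerivAt (hder z hz.1 hz.2)]
    have h1 := liouvilleForm_apply hz.2
      (mfderiv 𝓘(ℝ, E × (E →L[ℝ] ℝ)) (cotangentModel E) φ.symm z v)
    exact h1.symm.trans (liouvilleFormInChart_apply hz.1 v)
  rw [symplecticForm_self]
  have key := pairingForm_fderiv_of_liouville hc hL
    (mfderiv (cotangentModel E) 𝓘(ℝ, E × (E →L[ℝ] ℝ)) φ ℓ v)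
    (mfderiv (cotangentModel E) 𝓘(ℝ, E × (E →L[ℝ] ℝ)) φ ℓ w)
  refine key.symm.trans ?_
  have hfd : ∀ v : TangentSpace (cotangentModel E) ℓ, fderiv ℝ (fun z => χ (φ.symm z)) (φ ℓ)
      (mfderiv (cotangentModel E) 𝓘(ℝ, E × (E →L[ℝ] ℝ)) φ ℓ v) =
      mfderiv (cotangentModel E) 𝓘(ℝ, E × (E →L[ℝ] ℝ)) χ ℓ v := by
    intro v
    have h1 : HasMFDerivAt (cotangentModel E) 𝓘(ℝ, E × (E →L[ℝ] ℝ)) (fun x => χ (φ.symm (φ x))) ℓ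
        ((fderiv ℝ (fun z => χ (φ.symm z)) (φ ℓ)).comp
          (mfderiv (cotangentModel E) 𝓘(ℝ, E × (E →L[ℝ] ℝ)) φ ℓ)) :=
      (hasMFDerivAt_iff_hasFDerivAt.2 (hc.differentiableAt (by simp)).hasFDerivAt).comp ℓ
        (hasMFDerivAt_extChartAt' (mem_extChartAt_source ℓ))
    have h2 := (hasMFDerivAt_extChartAt' h).congr_of_eventuallyEq
      (f₁ := fun x => χ (φ.symm (φ x))) (by
        filter_upwards [(isOpen_extChartAt_source (I := cotangentModel E) ℓ).mem_nhds
          (mem_extChartAt_source ℓ)] with x hx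
        exact congrArg χ (φ.left_inv hx))
    exact DFunLike.congr_fun (hasMFDerivAt_unique h1 h2) v
  rw [hfd, hfd]

end CotangentCharts

/-! ### Hamiltonian vector fields in canonical coordinates -/

section HamiltonianFields

variable {E : Type*} [NormedAddCommGroup E] [NormedSpace ℝ E] [FiniteDimensional ℝ E]

lemma exists_canonicalSharp : ∃ J : ((E × (E →L[ℝ] ℝ)) →L[ℝ] ℝ) →L[ℝ] E × (E →L[ℝ] ℝ),
    ∀ a v, canonicalForm v (J a) = a v :=
  exists_pairingSharp (fun _ h => h) fun x hx =>
    (SeparatingDual.eq_zero_iff_forall_dual_eq_zero (R := ℝ) x).2 hx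

/-- The isomorphism from covectors to vectors given by the canonical symplectic form. -/
def canonicalSharp : ((E × (E →L[ℝ] ℝ)) →L[ℝ] ℝ) →L[ℝ] E × (E →L[ℝ] ℝ) :=
  exists_canonicalSharp.choose

lemma canonicalForm_canonicalSharp (a : (E × (E →L[ℝ] ℝ)) →L[ℝ] ℝ) (v : E × (E →L[ℝ] ℝ)) :
    canonicalForm v (canonicalSharp a) = a v :=
  exists_canonicalSharp.choose_spec a v

omit [FiniteDimensional ℝ E] in
lemma eq_of_forall_canonicalForm_eq {X Y : E × (E →L[ℝ] ℝ)}
    (h : ∀ v, canonicalForm v X = canonicalForm v Y) : X = Y :=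
  pairingFlat_injective (B := ContinuousLinearMap.id ℝ (E →L[ℝ] ℝ)) (fun _ h => h)
    (fun x hx => (SeparatingDual.eq_zero_iff_forall_dual_eq_zero (R := ℝ) x).2 hx)
    (ContinuousLinearMap.ext fun v => by rw [pairingFlat_apply, pairingFlat_apply]; exact h v)

variable {M : Type*} [TopologicalSpace M] [ChartedSpace E M] [IsManifold 𝓘(ℝ, E) ∞ M]
  {F : Cotangent E M → ℝ} {k ℓ : Cotangent E M}

omit [FiniteDimensional ℝ E] in
/-- The differential in a chart. -/
lemma fderiv_comp_extChartAt_symm {z : E × (E →L[ℝ] ℝ)}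
    (hz : z ∈ (extChartAt (cotangentModel E) k).target)
    (hF : MDifferentiableAt (cotangentModel E) 𝓘(ℝ, ℝ) F
      ((extChartAt (cotangentModel E) k).symm z)) (v : E × (E →L[ℝ] ℝ)) :
    fderiv ℝ (fun y => F ((extChartAt (cotangentModel E) k).symm y)) z v =
      differential F ((extChartAt (cotangentModel E) k).symm z)
        (mfderiv 𝓘(ℝ, E × (E →L[ℝ] ℝ)) (cotangentModel E)
          (extChartAt (cotangentModel E) k).symm z v) :=
  fderiv_eq_of_hasMFDerivAt (hF.hasMFDerivAt.comp z (hasMFDerivAt_extChartAt_symm' hz)) v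

omit [FiniteDimensional ℝ E] in
lemma symplecticForm_mfderiv_extChartAt_symm {z : E × (E →L[ℝ] ℝ)}
    (hz : z ∈ (extChartAt (cotangentModel E) k).target) (v w : E × (E →L[ℝ] ℝ)) :
    symplecticForm ((extChartAt (cotangentModel E) k).symm z)
      (mfderiv 𝓘(ℝ, E × (E →L[ℝ] ℝ)) (cotangentModel E)
          (extChartAt (cotangentModel E) k).symm z v)
      (mfderiv 𝓘(ℝ, E × (E →L[ℝ] ℝ)) (cotangentModel E)
          (extChartAt (cotangentModel E) k).symm z w) = canonicalForm v w := by
  rw [symplecticForm_eq ((extChartAt (cotangentModel E) k).map_target hz)]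
  exact congrArg₂ canonicalForm (DFunLike.congr_fun (mfderiv_extChartAt_comp_symm hz) v)
    (DFunLike.congr_fun (mfderiv_extChartAt_comp_symm hz) w)

omit [FiniteDimensional ℝ E] in
lemma mfderiv_extChartAt_symm_surjective {z : E × (E →L[ℝ] ℝ)}
    (hz : z ∈ (extChartAt (cotangentModel E) k).target)
    (v : TangentSpace (cotangentModel E) ((extChartAt (cotangentModel E) k).symm z)) :
    ∃ w : E × (E →L[ℝ] ℝ), mfderiv 𝓘(ℝ, E × (E →L[ℝ] ℝ)) (cotangentModel E)
          (extChartAt (cotangentModel E) k).symm z w = v :=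
  ⟨_, DFunLike.congr_fun (mfderiv_extChartAt_symm_comp hz) v⟩

omit [FiniteDimensional ℝ E] in
lemma exists_extChartAt_symm_eq (ℓ : Cotangent E M) : ∃ (k : Cotangent E M),
    ∃ z ∈ (extChartAt (cotangentModel E) k).target,
      (extChartAt (cotangentModel E) k).symm z = ℓ :=
  ⟨ℓ, _, mem_extChartAt_target ℓ, (extChartAt (cotangentModel E) ℓ).left_inv
      (mem_extChartAt_source ℓ)⟩

omit [FiniteDimensional ℝ E] in
/-- The symplectic form is nondegenerate. -/
lemma eq_of_forall_symplecticForm_eq {X Y : TangentSpace (cotangentModel E) ℓ}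
    (h : ∀ v, symplecticForm ℓ v X = symplecticForm ℓ v Y) : X = Y := by
  obtain ⟨k, z, hz, rfl⟩ := exists_extChartAt_symm_eq ℓ
  obtain ⟨X', rfl⟩ := mfderiv_extChartAt_symm_surjective hz X
  obtain ⟨Y', rfl⟩ := mfderiv_extChartAt_symm_surjective hz Y
  congr 1
  refine eq_of_forall_canonicalForm_eq fun v => ?_
  rw [← symplecticForm_mfderiv_extChartAt_symm hz, ← symplecticForm_mfderiv_extChartAt_symm hz]
  exact h _

/-- The coordinate vector `canonicalSharp dF` satisfies the defining relation, so the choice in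
`hamVF` is not the default value; nondegeneracy then forces the chosen vector to be this one. -/
lemma hamVF_extChartAt_symm {z : E × (E →L[ℝ] ℝ)}
    (hz : z ∈ (extChartAt (cotangentModel E) k).target)
    (hF : MDifferentiableAt (cotangentModel E) 𝓘(ℝ, ℝ) F
      ((extChartAt (cotangentModel E) k).symm z)) :
    (∀ v, differential F ((extChartAt (cotangentModel E) k).symm z) v = symplecticForm _ v
      (hamVF F ((extChartAt (cotangentModel E) k).symm z))) ∧
    hamVF F ((extChartAt (cotangentModel E) k).symm z) =
      mfderiv 𝓘(ℝ, E × (E →L[ℝ] ℝ)) (cotangentModel E) (extChartAt (cotangentModel E) k).symm z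
        (canonicalSharp
          (fderiv ℝ (fun y => F ((extChartAt (cotangentModel E) k).symm y)) z)) := by
  have hX : ∀ v, differential F ((extChartAt (cotangentModel E) k).symm z) v = symplecticForm _ v
      (mfderiv 𝓘(ℝ, E × (E →L[ℝ] ℝ)) (cotangentModel E) (extChartAt (cotangentModel E) k).symm z
        (canonicalSharp
          (fderiv ℝ (fun y => F ((extChartAt (cotangentModel E) k).symm y)) z))) := by
    intro v
    obtain ⟨v', rfl⟩ := mfderiv_extChartAt_symm_surjective hz v
    rw [symplecticForm_mfderiv_extChartAt_symm hz, canonicalForm_canonicalSharp,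
      fderiv_comp_extChartAt_symm hz hF]
  have hex : ∃ X : TangentSpace (cotangentModel E) ((extChartAt (cotangentModel E) k).symm z),
      ∀ v, differential F ((extChartAt (cotangentModel E) k).symm z) v = symplecticForm _ v X :=
    ⟨_, hX⟩
  have h1 : ∀ v, differential F ((extChartAt (cotangentModel E) k).symm z) v = symplecticForm _ v
      (hamVF F ((extChartAt (cotangentModel E) k).symm z)) := by
    rw [hamVF, dif_pos hex]
    exact hex.choose_spec
  exact ⟨h1, eq_of_forall_symplecticForm_eq fun v => (h1 v).symm.trans (hX v)⟩

lemma differential_eq_symplecticForm (hF : MDifferentiableAt (cotangentModel E) 𝓘(ℝ, ℝ) F ℓ)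
    (v : TangentSpace (cotangentModel E) ℓ) :
    differential F ℓ v = symplecticForm ℓ v (hamVF F ℓ) := by
  obtain ⟨k, z, hz, rfl⟩ := exists_extChartAt_symm_eq ℓ
  exact (hamVF_extChartAt_symm hz hF).1 v

lemma hamVF_eq_of_forall (hF : MDifferentiableAt (cotangentModel E) 𝓘(ℝ, ℝ) F ℓ)
    {X : TangentSpace (cotangentModel E) ℓ}
    (h : ∀ v, differential F ℓ v = symplecticForm ℓ v X) : hamVF F ℓ = X :=
  eq_of_forall_symplecticForm_eq fun v => (differential_eq_symplecticForm hF v).symm.trans (h v)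

omit [FiniteDimensional ℝ E] in
lemma symplecticForm_swap (v w : TangentSpace (cotangentModel E) ℓ) :
    symplecticForm ℓ v w = - symplecticForm ℓ w v := by
  rw [symplecticForm_self, symplecticForm_self]
  exact pairingForm_swap _ _ _

lemma differential_hamVF_swap {G : Cotangent E M → ℝ}
    (hF : MDifferentiableAt (cotangentModel E) 𝓘(ℝ, ℝ) F ℓ)
    (hG : MDifferentiableAt (cotangentModel E) 𝓘(ℝ, ℝ) G ℓ) :
    differential F ℓ (hamVF G ℓ) = - differential G ℓ (hamVF F ℓ) := by
  rw [differential_eq_symplecticForm hF, differential_eq_symplecticForm hG, symplecticForm_swap]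

lemma chartField_hamVF {z : E × (E →L[ℝ] ℝ)}
    (hz : z ∈ (extChartAt (cotangentModel E) k).target)
    (hF : MDifferentiableAt (cotangentModel E) 𝓘(ℝ, ℝ) F
      ((extChartAt (cotangentModel E) k).symm z)) :
    chartField (hamVF F) k z = canonicalSharp
      (fderiv ℝ (fun y => F ((extChartAt (cotangentModel E) k).symm y)) z) := by
  rw [chartField, (hamVF_extChartAt_symm hz hF).2]
  exact DFunLike.congr_fun (mfderiv_extChartAt_comp_symm hz) _

omit [FiniteDimensional ℝ E] in
lemma isOpen_extChartAt_symm_preimage {O : Set (Cotangent E M)} (hO : IsOpen O) :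
    IsOpen ((extChartAt (cotangentModel E) k).target ∩
      (extChartAt (cotangentModel E) k).symm ⁻¹' O) :=
  (continuousOn_extChartAt_symm k).isOpen_inter_preimage (isOpen_extChartAt_target k) hO

omit [FiniteDimensional ℝ E] in
lemma contDiffOn_comp_extChartAt_symm {O : Set (Cotangent E M)}
    (hF : ContMDiffOn (cotangentModel E) 𝓘(ℝ, ℝ) ∞ F O) :
    ContDiffOn ℝ ∞ (fun y => F ((extChartAt (cotangentModel E) k).symm y))
      ((extChartAt (cotangentModel E) k).target ∩
        (extChartAt (cotangentModel E) k).symm ⁻¹' O) :=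
  contMDiffOn_iff_contDiffOn.1 (hF.comp
    ((contMDiffOn_extChartAt_symm k).mono inter_subset_left) fun _ hz => hz.2)

lemma contDiffOn_chartField_hamVF {O : Set (Cotangent E M)} (hO : IsOpen O)
    (hF : ContMDiffOn (cotangentModel E) 𝓘(ℝ, ℝ) ∞ F O) :
    ContDiffOn ℝ ∞ (chartField (hamVF F) k) ((extChartAt (cotangentModel E) k).target ∩
      (extChartAt (cotangentModel E) k).symm ⁻¹' O) := by
  have h1 := (contDiffOn_comp_extChartAt_symm (k := k) hF).fderiv_of_isOpen (m := ∞)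
    (isOpen_extChartAt_symm_preimage hO) (by simp)
  refine (canonicalSharp.contDiff.comp_contDiffOn h1).congr fun z hz => ?_
  exact chartField_hamVF hz.1 ((hF.contMDiffAt (hO.mem_nhds hz.2)).mdifferentiableAt (by simp))

end HamiltonianFields

/-! ### Hamiltonian lifts and their Poisson brackets -/

section Lifts

variable {E : Type*} [NormedAddCommGroup E] [NormedSpace ℝ E]
  {M : Type*} [TopologicalSpace M] [ChartedSpace E M] [IsManifold 𝓘(ℝ, E) ∞ M]
  {F : Cotangent E M → ℝ} {k ℓ : Cotangent E M}

lemma contDiffOn_chartField_of_smoothVF {f : ∀ q : M, TangentSpace 𝓘(ℝ, E) q} (hf : SmoothVF f) (q : M) :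
    ContDiffOn ℝ ∞ (chartField f q) (extChartAt 𝓘(ℝ, E) q).target := by
  have hU := (isOpen_extChartAt_source (I := 𝓘(ℝ, E)) q)
  have h1 : ContMDiffOn 𝓘(ℝ, E) 𝓘(ℝ, E) ∞ (extChartAt 𝓘(ℝ, E) q) (extChartAt 𝓘(ℝ, E) q).source := by
    simpa using contMDiffOn_extChartAt (I := 𝓘(ℝ, E)) (n := ∞) (x := q)
  have h2 := h1.contMDiffOn_tangentMapWithin (m := ∞) (by simp) hU.uniqueMDiffOn
  have h3 := hf.comp_contMDiffOn (contMDiffOn_extChartAt_symm (I := 𝓘(ℝ, E)) (n := ∞) q)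
  have h4 := (h2.comp h3 fun y hy => (extChartAt 𝓘(ℝ, E) q).map_target hy)
  have h5 := (contMDiff_snd_tangentBundle_modelSpace (n := ∞) E 𝓘(ℝ, E)).comp_contMDiffOn h4
  refine (contMDiffOn_iff_contDiffOn.1 h5).congr fun y hy => ?_
  exact congrArg (fun A : TangentSpace 𝓘(ℝ, E) ((extChartAt 𝓘(ℝ, E) q).symm y) →L[ℝ] E =>
    A (f ((extChartAt 𝓘(ℝ, E) q).symm y)))
    (mfderivWithin_of_isOpen hU ((extChartAt 𝓘(ℝ, E) q).map_target hy)).symm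


lemma contMDiffAt_of_eventuallyEq_comp_extChartAt {G : E × (E →L[ℝ] ℝ) → ℝ}
    (hG : ContDiffAt ℝ ∞ G (extChartAt (cotangentModel E) ℓ ℓ))
    (hF : ∀ ℓ' ∈ (extChartAt (cotangentModel E) ℓ).source, F ℓ' = G (extChartAt (cotangentModel E) ℓ ℓ')) :
    ContMDiffAt (cotangentModel E) 𝓘(ℝ, ℝ) ∞ F ℓ := by
  refine (hG.contMDiffAt.comp ℓ contMDiffAt_extChartAt).congr_of_eventuallyEq ?_
  filter_upwards [(isOpen_extChartAt_source (I := cotangentModel E) ℓ).mem_nhds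
          (mem_extChartAt_source ℓ)] with x hx using hF x hx

/-- `a` and `b` are the derivatives of `F` with respect to momentum and position, in the canonical
coordinates centred at `ℓ`. -/
def HasCanonicalPartials (F : Cotangent E M → ℝ) (ℓ : Cotangent E M) (a : E) (b : E →L[ℝ] ℝ) :
    Prop :=
  MDifferentiableAt (cotangentModel E) 𝓘(ℝ, ℝ) F ℓ ∧ ∀ v : TangentSpace (cotangentModel E) ℓ,
    differential F ℓ v =
      (mfderiv (cotangentModel E) 𝓘(ℝ, E × (E →L[ℝ] ℝ)) (extChartAt (cotangentModel E) ℓ) ℓ v).2 a +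
      b (mfderiv (cotangentModel E) 𝓘(ℝ, E × (E →L[ℝ] ℝ)) (extChartAt (cotangentModel E) ℓ) ℓ v).1

lemma hasCanonicalPartials_of_eventuallyEq {G : E × (E →L[ℝ] ℝ) → ℝ}
    {G' : (E × (E →L[ℝ] ℝ)) →L[ℝ] ℝ} {a : E} {b : E →L[ℝ] ℝ}
    (hG : HasFDerivAt G G' (extChartAt (cotangentModel E) ℓ ℓ))
    (hF : ∀ ℓ' ∈ (extChartAt (cotangentModel E) ℓ).source, F ℓ' = G (extChartAt (cotangentModel E) ℓ ℓ'))
    (hG' : ∀ v, G' v = v.2 a + b v.1) :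
    HasCanonicalPartials F ℓ a b := by
  have h1 := ((hasMFDerivAt_iff_hasFDerivAt.2 hG).comp ℓ
    (hasMFDerivAt_extChartAt' (mem_extChartAt_source (I := cotangentModel E) ℓ))).congr_of_eventuallyEq
    (f₁ := F) (by
      filter_upwards [(isOpen_extChartAt_source (I := cotangentModel E) ℓ).mem_nhds
          (mem_extChartAt_source ℓ)] with x hx using hF x hx)
  refine ⟨h1.mdifferentiableAt, fun v => ?_⟩
  refine Eq.trans ?_ (hG' _)
  exact DFunLike.congr_fun h1.mfderiv v

lemma hamLift_eq_extChartAt {k ℓ : Cotangent E M} (f : ∀ q : M, TangentSpace 𝓘(ℝ, E) q)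
    (h : ℓ ∈ (extChartAt (cotangentModel E) k).source) :
    hamLift f ℓ = (extChartAt (cotangentModel E) k ℓ).2
      (chartField f k.1 (extChartAt (cotangentModel E) k ℓ).1) := by
  rw [hamLift, apply_eq_extChartAt_apply_snd h, extChartAt_apply_fst, chartField,
    (extChartAt 𝓘(ℝ, E) k.1).left_inv (mem_extChartAt_source_iff.1 h)]

lemma extChartAt_fst_mem_target (ℓ : Cotangent E M) :
    (extChartAt (cotangentModel E) ℓ ℓ).1 ∈ (extChartAt 𝓘(ℝ, E) ℓ.1).target :=
  extChartAt_target_iff.1 (mem_extChartAt_target ℓ)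

lemma contDiffAt_hamLift_coord {P : Type*} [NormedAddCommGroup P] [NormedSpace ℝ P]
    (B : P →L[ℝ] E →L[ℝ] ℝ) {f : E → E} {z : E × P} (hf : ContDiffAt ℝ ∞ f z.1) :
    ContDiffAt ℝ ∞ (fun z : E × P => B z.2 (f z.1)) z :=
  (B.contDiff.contDiffAt.comp z contDiffAt_snd).clm_apply (hf.comp z contDiffAt_fst)

lemma hasFDerivAt_hamLift_coord {P : Type*} [NormedAddCommGroup P] [NormedSpace ℝ P]
    (B : P →L[ℝ] E →L[ℝ] ℝ) {f : E → E} {z : E × P} (hf : DifferentiableAt ℝ f z.1) :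
    HasFDerivAt (fun z : E × P => B z.2 (f z.1))
      ((B.flip (f z.1)).comp (ContinuousLinearMap.snd ℝ E P) +
        ((B z.2).comp (fderiv ℝ f z.1)).comp (ContinuousLinearMap.fst ℝ E P)) z := by
  have h1 : HasFDerivAt (fun z : E × P => B z.2) (B.comp (ContinuousLinearMap.snd ℝ E P)) z :=
    (B.comp (ContinuousLinearMap.snd ℝ E P)).hasFDerivAt
  have h2 := h1.clm_apply (hf.hasFDerivAt.comp z hasFDerivAt_fst)
  refine h2.congr_fderiv ?_
  ext v <;> simp

lemma SmoothVF.contDiffAt_chartField {f : ∀ q : M, TangentSpace 𝓘(ℝ, E) q} (hf : SmoothVF f)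
    (ℓ : Cotangent E M) :
    ContDiffAt ℝ ∞ (chartField f ℓ.1) (extChartAt (cotangentModel E) ℓ ℓ).1 :=
  (contDiffOn_chartField_of_smoothVF hf ℓ.1).contDiffAt
    ((isOpen_extChartAt_target ℓ.1).mem_nhds (extChartAt_fst_mem_target ℓ))

lemma contMDiff_hamLift {f : ∀ q : M, TangentSpace 𝓘(ℝ, E) q} (hf : SmoothVF f) :
    ContMDiff (cotangentModel E) 𝓘(ℝ, ℝ) ∞ (hamLift f) := by
  intro ℓ
  have h1 : ContDiffAt ℝ ∞ (fun z : E × (E →L[ℝ] ℝ) => z.2 (chartField f ℓ.1 z.1))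
     (extChartAt (cotangentModel E) ℓ ℓ) :=
    contDiffAt_hamLift_coord (ContinuousLinearMap.id ℝ (E →L[ℝ] ℝ)) (hf.contDiffAt_chartField ℓ)
  exact contMDiffAt_of_eventuallyEq_comp_extChartAt h1 fun ℓ' h => hamLift_eq_extChartAt f h

lemma hasCanonicalPartials_hamLift {f : ∀ q : M, TangentSpace 𝓘(ℝ, E) q} (hf : SmoothVF f)
    (ℓ : Cotangent E M) : HasCanonicalPartials (hamLift f) ℓ
      (chartField f ℓ.1 (extChartAt (cotangentModel E) ℓ ℓ).1)
      ((extChartAt (cotangentModel E) ℓ ℓ).2.comp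
        (fderiv ℝ (chartField f ℓ.1) (extChartAt (cotangentModel E) ℓ ℓ).1)) :=
  hasCanonicalPartials_of_eventuallyEq
    (hasFDerivAt_hamLift_coord (ContinuousLinearMap.id ℝ (E →L[ℝ] ℝ))
      ((hf.contDiffAt_chartField ℓ).differentiableAt (by simp)))
    (fun _ h => hamLift_eq_extChartAt f h) fun _ => rfl

lemma contMDiff_comp_proj {φ : M → ℝ} (hφ : ContMDiff 𝓘(ℝ, E) 𝓘(ℝ, ℝ) ∞ φ) :
    ContMDiff (cotangentModel E) 𝓘(ℝ, ℝ) ∞ (fun ℓ : Cotangent E M => φ ℓ.1) :=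
  hφ.comp (Bundle.contMDiff_proj (n := ∞) (IB := 𝓘(ℝ, E)) (F := E →L[ℝ] ℝ)
    (fun q : M => TangentSpace 𝓘(ℝ, E) q →L[ℝ] ℝ))

lemma contDiffOn_comp_extChartAt_symm_of_contMDiff {φ : M → ℝ} (hφ : ContMDiff 𝓘(ℝ, E) 𝓘(ℝ, ℝ) ∞ φ) (q : M) :
    ContDiffOn ℝ ∞ (fun y => φ ((extChartAt 𝓘(ℝ, E) q).symm y)) (extChartAt 𝓘(ℝ, E) q).target :=
  contMDiffOn_iff_contDiffOn.1 (hφ.comp_contMDiffOn (contMDiffOn_extChartAt_symm q))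

lemma hasCanonicalPartials_comp_proj {φ : M → ℝ} (hφ : ContMDiff 𝓘(ℝ, E) 𝓘(ℝ, ℝ) ∞ φ)
    (ℓ : Cotangent E M) : HasCanonicalPartials (fun ℓ' => φ ℓ'.1) ℓ 0
      (fderiv ℝ (fun y => φ ((extChartAt 𝓘(ℝ, E) ℓ.1).symm y))
        (extChartAt (cotangentModel E) ℓ ℓ).1) := by
  have h1 := ((contDiffOn_comp_extChartAt_symm_of_contMDiff hφ ℓ.1).contDiffAt
    ((isOpen_extChartAt_target ℓ.1).mem_nhds (extChartAt_fst_mem_target ℓ))).differentiableAt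
      (by simp)
  refine hasCanonicalPartials_of_eventuallyEq
    (h1.hasFDerivAt.comp (extChartAt (cotangentModel E) ℓ ℓ) hasFDerivAt_fst) (fun ℓ' h => ?_)
    fun v => ?_
  · rw [Function.comp_apply, extChartAt_apply_fst, (extChartAt 𝓘(ℝ, E) ℓ.1).left_inv (mem_extChartAt_source_iff.1 h)]
  · rw [map_zero, zero_add]; rfl

lemma lieDeriv_extChartAt_symm (f : ∀ q : M, TangentSpace 𝓘(ℝ, E) q) {φ : M → ℝ}
    (hφ : ContMDiff 𝓘(ℝ, E) 𝓘(ℝ, ℝ) ∞ φ) {q : M} {y : E} (hy : y ∈ (extChartAt 𝓘(ℝ, E) q).target) :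
    lieDeriv f φ ((extChartAt 𝓘(ℝ, E) q).symm y) =
      fderiv ℝ (fun y => φ ((extChartAt 𝓘(ℝ, E) q).symm y)) y (chartField f q y) := by
  have : IsManifold 𝓘(ℝ, E) 1 M := IsManifold.of_le (n := ∞) (by simp)
  have h1 := (hφ.mdifferentiableAt (by simp)).hasMFDerivAt.comp y (hasMFDerivAt_extChartAt_symm' hy)
  refine Eq.trans ?_ (fderiv_eq_of_hasMFDerivAt h1 _).symm
  exact congrArg _ (mfderiv_extChartAt_symm_chartField (X := f) hy).symm

lemma contMDiff_lieDeriv {f : ∀ q : M, TangentSpace 𝓘(ℝ, E) q} (hf : SmoothVF f) {φ : M → ℝ}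
    (hφ : ContMDiff 𝓘(ℝ, E) 𝓘(ℝ, ℝ) ∞ φ) : ContMDiff 𝓘(ℝ, E) 𝓘(ℝ, ℝ) ∞ (lieDeriv f φ) := by
  intro q
  have h1 : ContDiffOn ℝ ∞ (fun y => fderiv ℝ (fun y => φ ((extChartAt 𝓘(ℝ, E) q).symm y)) y
      (chartField f q y)) (extChartAt 𝓘(ℝ, E) q).target :=
    ((contDiffOn_comp_extChartAt_symm_of_contMDiff hφ q).fderiv_of_isOpen
      (isOpen_extChartAt_target q) (by simp)).clm_apply (contDiffOn_chartField_of_smoothVF hf q)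
  have h2 := (h1.contDiffAt ((isOpen_extChartAt_target q).mem_nhds (mem_extChartAt_target q))).contMDiffAt
  refine (h2.comp q contMDiffAt_extChartAt).congr_of_eventuallyEq ?_
  filter_upwards [(isOpen_extChartAt_source (I := 𝓘(ℝ, E)) q).mem_nhds
          (mem_extChartAt_source q)] with x hx
  have h3 := lieDeriv_extChartAt_symm f hφ ((extChartAt 𝓘(ℝ, E) q).map_source hx)
  rwa [(extChartAt 𝓘(ℝ, E) q).left_inv hx] at h3

lemma canonicalForm_neg_right (v : E × (E →L[ℝ] ℝ)) (a : E) (b : E →L[ℝ] ℝ) :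
    canonicalForm v (a, -b) = v.2 a + b v.1 := by
  simp [pairingForm]

section Partials

variable {G : Cotangent E M → ℝ} {a c : E} {b d : E →L[ℝ] ℝ}

lemma HasCanonicalPartials.sub (hF : HasCanonicalPartials F ℓ a b) (hG : HasCanonicalPartials G ℓ c d) :
    HasCanonicalPartials (fun ℓ => F ℓ - G ℓ) ℓ (a - c) (b - d) := by
  refine ⟨hF.1.sub hG.1, fun v => ?_⟩
  have h1 : differential (fun ℓ => F ℓ - G ℓ) ℓ v = differential F ℓ v - differential G ℓ v :=
    DFunLike.congr_fun (hF.1.hasMFDerivAt.sub hG.1.hasMFDerivAt).mfderiv v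
  rw [h1, hF.2, hG.2, map_sub, sub_apply]
  ring

/-- In canonical coordinates `F⃗ = (∂F/∂p, -∂F/∂q)`; this is the coordinate form of the Poisson
bracket. -/
lemma HasCanonicalPartials.differential_hamVF [FiniteDimensional ℝ E]
    (hF : HasCanonicalPartials F ℓ a b) (hG : HasCanonicalPartials G ℓ c d) :
    differential G ℓ (hamVF F ℓ) = d a - b c := by
  obtain ⟨X, hX⟩ : ∃ X : TangentSpace (cotangentModel E) ℓ, mfderiv (cotangentModel E)
    𝓘(ℝ, E × (E →L[ℝ] ℝ)) (extChartAt (cotangentModel E) ℓ) ℓ X = ((a, -b) : E × (E →L[ℝ] ℝ)) := by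
    have h1 := mfderiv_extChartAt_comp_symm (I := cotangentModel E) (mem_extChartAt_target ℓ)
    rw [(extChartAt (cotangentModel E) ℓ).left_inv (mem_extChartAt_source ℓ)] at h1
    exact ⟨_, DFunLike.congr_fun h1 ((a, -b) : E × (E →L[ℝ] ℝ))⟩
  have h2 : hamVF F ℓ = X := by
    refine hamVF_eq_of_forall hF.1 fun v => ?_
    rw [hF.2, symplecticForm_self, hX]
    exact (canonicalForm_neg_right _ _ _).symm
  rw [hG.2, h2, hX, neg_apply, sub_eq_add_neg, add_comm]

end Partials

section

variable [CompleteSpace E]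

lemma SmoothVF.bracket {f g : ∀ q : M, TangentSpace 𝓘(ℝ, E) q} (hf : SmoothVF f) (hg : SmoothVF g) :
    SmoothVF (bracket f g) := by
  have : IsManifold 𝓘(ℝ, E) (minSmoothness ℝ 2) M := by
    rw [minSmoothness_of_isRCLikeNormedField]
    exact IsManifold.of_le (n := ∞) (by norm_cast)
  have : IsManifold 𝓘(ℝ, E) ((⊤ : ℕ∞) + 1) M := by simpa
  exact ContDiff.mlieBracket_vectorField (m := ⊤) (n := ⊤) hf hg (by simp)

end

/-- The manifold bracket is defined by pulling both fields back through the inverse chart. Near the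
centre these pull-backs are the `chartField`s, and brackets of locally equal fields agree. -/
lemma extChartAt_bracket (f g : ∀ q : M, TangentSpace 𝓘(ℝ, E) q) (q : M) :
    (mfderiv 𝓘(ℝ, E) 𝓘(ℝ, E) (extChartAt 𝓘(ℝ, E) q) q (SingularArc.bracket f g q) : E) =
      VectorField.lieBracket ℝ (chartField f q) (chartField g q) (extChartAt 𝓘(ℝ, E) q q) := by
  have : IsManifold 𝓘(ℝ, E) 1 M := IsManifold.of_le (n := ∞) (by simp)
  have h0 := isInvertible_mfderiv_extChartAt (I := 𝓘(ℝ, E)) (mem_extChartAt_source (I := 𝓘(ℝ, E)) q)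
  refine (h0.inverse_apply_eq.1 rfl).symm.trans ?_
  have h1 (f : ∀ q : M, TangentSpace 𝓘(ℝ, E) q) :
    VectorField.mpullbackWithin 𝓘(ℝ, E) 𝓘(ℝ, E) (extChartAt 𝓘(ℝ, E) q).symm f (range 𝓘(ℝ, E))
      =ᶠ[𝓝 (extChartAt 𝓘(ℝ, E) q q)] chartField f q := by
    filter_upwards [(isOpen_extChartAt_target q).mem_nhds (mem_extChartAt_target q)] with y hy
    have h2 := isInvertible_mfderivWithin_extChartAt_symm (I := 𝓘(ℝ, E)) hy
    refine h2.inverse_apply_eq.2 ?_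
    have h3 := mfderiv_extChartAt_symm_chartField (X := f) hy
    refine h3.symm.trans ?_
    have h4 : mfderivWithin 𝓘(ℝ, E) 𝓘(ℝ, E) (extChartAt 𝓘(ℝ, E) q).symm (range 𝓘(ℝ, E)) y =
        mfderiv 𝓘(ℝ, E) 𝓘(ℝ, E) (extChartAt 𝓘(ℝ, E) q).symm y := by
      rw [ModelWithCorners.range_eq_univ, mfderivWithin_univ]
    exact (DFunLike.congr_fun h4 _).symm
  have h2 : (extChartAt 𝓘(ℝ, E) q).symm ⁻¹' univ ∩ range 𝓘(ℝ, E) = univ := by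
    rw [ModelWithCorners.range_eq_univ, preimage_univ, univ_inter]
  have h3 := (h1 f).lieBracket_vectorField_eq (𝕜 := ℝ) (h1 g)
  have h4 (V W : E → E) (x : E) {s : Set E} (hs : s = univ) :
      VectorField.lieBracketWithin ℝ V W s x = VectorField.lieBracket ℝ V W x := by
    rw [hs, VectorField.lieBracketWithin_univ]
  exact (h4 _ _ _ h2).trans h3


lemma hamLift_bracket (f g : ∀ q : M, TangentSpace 𝓘(ℝ, E) q) (ℓ : Cotangent E M) :
    hamLift (SingularArc.bracket f g) ℓ = (extChartAt (cotangentModel E) ℓ ℓ).2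
      (VectorField.lieBracket ℝ (chartField f ℓ.1) (chartField g ℓ.1)
        (extChartAt (cotangentModel E) ℓ ℓ).1) := by
  rw [hamLift, apply_eq_extChartAt_apply_snd (mem_extChartAt_source (I := cotangentModel E) ℓ),
    extChartAt_apply_fst]
  exact congrArg _ (extChartAt_bracket f g ℓ.1)

lemma lieDeriv_eq_extChartAt (f : ∀ q : M, TangentSpace 𝓘(ℝ, E) q) {φ : M → ℝ}
    (hφ : ContMDiff 𝓘(ℝ, E) 𝓘(ℝ, ℝ) ∞ φ) (ℓ : Cotangent E M) :
    lieDeriv f φ ℓ.1 = fderiv ℝ (fun y => φ ((extChartAt 𝓘(ℝ, E) ℓ.1).symm y))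
      (extChartAt (cotangentModel E) ℓ ℓ).1
      (chartField f ℓ.1 (extChartAt (cotangentModel E) ℓ ℓ).1) := by
  rw [← lieDeriv_extChartAt_symm f hφ (extChartAt_fst_mem_target ℓ), extChartAt_apply_fst,
    (extChartAt 𝓘(ℝ, E) ℓ.1).left_inv (mem_extChartAt_source ℓ.1)]

/-- The Poisson bracket of functions that are affine in the momentum. -/
lemma differential_hamVF_hamLift_sub [FiniteDimensional ℝ E] {f g : ∀ q : M, TangentSpace 𝓘(ℝ, E) q} {φ χ : M → ℝ}
    (hf : SmoothVF f) (hg : SmoothVF g) (hφ : ContMDiff 𝓘(ℝ, E) 𝓘(ℝ, ℝ) ∞ φ)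
    (hχ : ContMDiff 𝓘(ℝ, E) 𝓘(ℝ, ℝ) ∞ χ) (ℓ : Cotangent E M) :
    differential (fun ℓ => hamLift g ℓ - χ ℓ.1) ℓ (hamVF (fun ℓ => hamLift f ℓ - φ ℓ.1) ℓ) =
      hamLift (SingularArc.bracket f g) ℓ + (lieDeriv g φ ℓ.1 - lieDeriv f χ ℓ.1) := by
  -- The functions `φ` and `χ` have no momentum derivative, so they do not bracket with each other;
  -- each meets only the vector field of the other function.
  have hF := (hasCanonicalPartials_hamLift hf ℓ).sub (hasCanonicalPartials_comp_proj hφ ℓ)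
  have hG := (hasCanonicalPartials_hamLift hg ℓ).sub (hasCanonicalPartials_comp_proj hχ ℓ)
  rw [sub_zero] at hF hG
  rw [hF.differential_hamVF hG, hamLift_bracket, lieDeriv_eq_extChartAt g hφ,
    lieDeriv_eq_extChartAt f hχ, VectorField.lieBracket_eq, map_sub, sub_apply,
    sub_apply, ContinuousLinearMap.comp_apply, ContinuousLinearMap.comp_apply]
  ring

lemma differential_congr {F G : Cotangent E M → ℝ} (h : F =ᶠ[𝓝 ℓ] G)
    (v : TangentSpace (cotangentModel E) ℓ) : differential F ℓ v = differential G ℓ v :=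
  congrArg (fun A : TangentSpace (cotangentModel E) ℓ →L[ℝ] ℝ => A v)
    (h.mfderiv_eq (I := cotangentModel E) (I' := 𝓘(ℝ, ℝ)))

lemma hamVF_congr {F G : Cotangent E M → ℝ} (h : F =ᶠ[𝓝 ℓ] G) : hamVF F ℓ = hamVF G ℓ := by
  have h1 : differential F ℓ = differential G ℓ := funext fun v => differential_congr h v
  unfold hamVF
  rw [h1]

lemma isOpen_setOf_pos {ψ : M → ℝ} (hψ : ContMDiff 𝓘(ℝ, E) 𝓘(ℝ, ℝ) ∞ ψ) :
    IsOpen {ℓ : Cotangent E M | 0 < ψ ℓ.1} :=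
  isOpen_lt continuous_const (contMDiff_comp_proj hψ).continuous

lemma PhiMinus_eventuallyEq (f₁ : ∀ q : M, TangentSpace 𝓘(ℝ, E) q) {ψ : M → ℝ}
    (hψ : ContMDiff 𝓘(ℝ, E) 𝓘(ℝ, ℝ) ∞ ψ) (hℓ : 0 < ψ ℓ.1) :
    PhiMinus f₁ ψ =ᶠ[𝓝 ℓ] fun ℓ => hamLift f₁ ℓ - ψ ℓ.1 := by
  filter_upwards [(isOpen_setOf_pos hψ).mem_nhds hℓ] with x hx
  rw [PhiMinus, abs_of_pos hx]

lemma contMDiffOn_PhiMinus {f₁ : ∀ q : M, TangentSpace 𝓘(ℝ, E) q} {ψ : M → ℝ} (hf₁ : SmoothVF f₁)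
    (hψ : ContMDiff 𝓘(ℝ, E) 𝓘(ℝ, ℝ) ∞ ψ) :
    ContMDiffOn (cotangentModel E) 𝓘(ℝ, ℝ) ∞ (PhiMinus f₁ ψ)
      {ℓ : Cotangent E M | 0 < ψ ℓ.1} := by
  intro ℓ hℓ
  refine ContMDiffAt.contMDiffWithinAt ?_
  exact (((contMDiff_hamLift hf₁).sub (contMDiff_comp_proj hψ)) ℓ).congr_of_eventuallyEq
    (PhiMinus_eventuallyEq f₁ hψ hℓ)

lemma contMDiff_singFun [CompleteSpace E] {f₀ f₁ : ∀ q : M, TangentSpace 𝓘(ℝ, E) q} {ψ : M → ℝ}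
    (hf₀ : SmoothVF f₀) (hf₁ : SmoothVF f₁) (hψ : ContMDiff 𝓘(ℝ, E) 𝓘(ℝ, ℝ) ∞ ψ) :
    ContMDiff (cotangentModel E) 𝓘(ℝ, ℝ) ∞ (singFun f₀ f₁ ψ : Cotangent E M → ℝ) :=
  (contMDiff_hamLift (hf₀.bracket hf₁)).sub (contMDiff_comp_proj (contMDiff_lieDeriv hf₀ hψ))

omit [IsManifold 𝓘(ℝ, E) ∞ M] in
lemma lieDeriv_zero (f : ∀ q : M, TangentSpace 𝓘(ℝ, E) q) (q : M) :
    lieDeriv f (fun _ : M => (0 : ℝ)) q = 0 :=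
  congrArg (fun A : TangentSpace 𝓘(ℝ, E) q →L[ℝ] ℝ => A (f q))
    (mfderiv_const (I := 𝓘(ℝ, E)) (I' := 𝓘(ℝ, ℝ)) (c := (0 : ℝ)) (x := q))

variable [FiniteDimensional ℝ E] {f₀ f₁ : ∀ q : M, TangentSpace 𝓘(ℝ, E) q} {ψ : M → ℝ}

/-- The bracket formula with `φ = 0` and `χ = ψ`, the absolute value being inactive where `ψ > 0`.
-/
lemma differential_PhiMinus_hamVF_hamLift (hf₀ : SmoothVF f₀) (hf₁ : SmoothVF f₁)
    (hψ : ContMDiff 𝓘(ℝ, E) 𝓘(ℝ, ℝ) ∞ ψ) (hℓ : 0 < ψ ℓ.1) :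
    differential (PhiMinus f₁ ψ) ℓ (hamVF (hamLift f₀) ℓ) = singFun f₀ f₁ ψ ℓ := by
  have h1 := differential_hamVF_hamLift_sub hf₀ hf₁ (φ := fun _ => 0) contMDiff_const hψ ℓ
  simp only [sub_zero, lieDeriv_zero, zero_sub] at h1
  rw [differential_congr (PhiMinus_eventuallyEq f₁ hψ hℓ), singFun, sub_eq_add_neg, ← h1]

lemma differential_hamLift_hamVF_PhiMinus (hf₀ : SmoothVF f₀) (hf₁ : SmoothVF f₁)
    (hψ : ContMDiff 𝓘(ℝ, E) 𝓘(ℝ, ℝ) ∞ ψ) (hℓ : 0 < ψ ℓ.1) :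
    differential (hamLift f₀) ℓ (hamVF (PhiMinus f₁ ψ) ℓ) = - singFun f₀ f₁ ψ ℓ := by
  rw [← differential_PhiMinus_hamVF_hamLift hf₀ hf₁ hψ hℓ]
  exact differential_hamVF_swap (((contMDiff_hamLift hf₀) ℓ).mdifferentiableAt (by simp))
    (((contMDiffOn_PhiMinus hf₁ hψ).contMDiffAt
      ((isOpen_setOf_pos hψ).mem_nhds hℓ)).mdifferentiableAt (by simp))

/-- The bracket formula for the pairs `(f₁, ψ)` and `([f₀, f₁], L_{f₀} ψ)`. Positivity of `𝕃` thus
means growth of `F₀₁ - L_{f₀} ψ ∘ π` along the flow of `Φ⃗⁻`. -/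
lemma differential_singFun_hamVF_PhiMinus (hf₀ : SmoothVF f₀) (hf₁ : SmoothVF f₁)
    (hψ : ContMDiff 𝓘(ℝ, E) 𝓘(ℝ, ℝ) ∞ ψ) (hℓ : 0 < ψ ℓ.1) :
    differential (singFun f₀ f₁ ψ) ℓ (hamVF (PhiMinus f₁ ψ) ℓ) = legendreFun f₀ f₁ ψ ℓ := by
  have : CompleteSpace E := FiniteDimensional.complete ℝ E
  rw [hamVF_congr (PhiMinus_eventuallyEq f₁ hψ hℓ)]
  exact differential_hamVF_hamLift_sub hf₁ (hf₀.bracket hf₁) hψ (contMDiff_lieDeriv hf₀ hψ) ℓ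

lemma contMDiff_legendreFun (hf₀ : SmoothVF f₀) (hf₁ : SmoothVF f₁)
    (hψ : ContMDiff 𝓘(ℝ, E) 𝓘(ℝ, ℝ) ∞ ψ) :
    ContMDiff (cotangentModel E) 𝓘(ℝ, ℝ) ∞ (legendreFun f₀ f₁ ψ : Cotangent E M → ℝ) := by
  have : CompleteSpace E := FiniteDimensional.complete ℝ E
  exact (contMDiff_hamLift (hf₁.bracket (hf₀.bracket hf₁))).add
    ((contMDiff_comp_proj (contMDiff_lieDeriv (hf₀.bracket hf₁) hψ)).sub
      (contMDiff_comp_proj (contMDiff_lieDeriv hf₁ (contMDiff_lieDeriv hf₀ hψ))))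

end Lifts

/-! ### Hamiltonian flows on a vector space are symplectic -/

section LinearSymplectic

variable {Z : Type*} [NormedAddCommGroup Z] [NormedSpace ℝ Z]

/-- The variational equation: symmetry of the second derivative of `φ` in `(t, z)` allows `∂ₜ∂ₐφ =
∂ₐ∂ₜφ = ∂ₐ(X ∘ φ)`. -/
lemma hasDerivAt_fderiv_flow {φ : ℝ × Z → Z} {X : Z → Z} {t : ℝ} {z : Z}
    (hφ : ContDiffAt ℝ ∞ φ (t, z)) (hX : DifferentiableAt ℝ X (φ (t, z)))
    (hd : ∀ᶠ p in 𝓝 (t, z), HasDerivAt (fun s => φ (s, p.2)) (X (φ p)) p.1) (a : Z) :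
    HasDerivAt (fun s => fderiv ℝ φ (s, z) (0, a)) (fderiv ℝ X (φ (t, z)) (fderiv ℝ φ (t, z) (0, a))) t := by
  have hsymm : IsSymmSndFDerivAt ℝ φ (t, z) := hφ.isSymmSndFDerivAt (by simp; norm_cast)
  have hφ1 : HasFDerivAt φ (fderiv ℝ φ (t, z)) (t, z) := (hφ.differentiableAt (by simp)).hasFDerivAt
  have hφ2 : HasFDerivAt (fderiv ℝ φ) (fderiv ℝ (fderiv ℝ φ) (t, z)) (t, z) :=
    ((hφ.fderiv_right (m := 1) (by norm_cast)).differentiableAt (by simp)).hasFDerivAt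
  have h1 : HasDerivAt (fun s : ℝ => (s, z)) ((1 : ℝ), (0 : Z)) t :=
    (hasDerivAt_id t).prodMk (hasDerivAt_const t z)
  have h2 : HasDerivAt (fun s => fderiv ℝ φ (s, z)) (fderiv ℝ (fderiv ℝ φ) (t, z) (1, 0)) t :=
    hφ2.comp_hasDerivAt t h1
  have h3 := h2.clm_apply (hasDerivAt_const t ((0 : ℝ), a))
  have hev : ∀ᶠ p in 𝓝 (t, z), fderiv ℝ φ p (1, 0) = X (φ p) := by
    have h4 : ∀ᶠ p in 𝓝 (t, z), ContDiffAt ℝ 1 φ p :=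
      (hφ.of_le (by norm_cast)).eventually (by simp)
    filter_upwards [h4, hd] with p hp hp'
    have h5 : HasDerivAt (fun s : ℝ => (s, p.2)) ((1 : ℝ), (0 : Z)) p.1 :=
      (hasDerivAt_id p.1).prodMk (hasDerivAt_const p.1 p.2)
    exact ((hp.differentiableAt (by simp)).hasFDerivAt.comp_hasDerivAt p.1 h5).unique hp'
  have h6 : HasFDerivAt (fun p => fderiv ℝ φ p (1, 0)) ((fderiv ℝ X (φ (t, z))).comp
      (fderiv ℝ φ (t, z))) (t, z) :=
    (hX.hasFDerivAt.comp (t, z) hφ1).congr_of_eventuallyEq hev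
  have h7 := hφ2.clm_apply (hasFDerivAt_const ((1 : ℝ), (0 : Z)) (t, z))
  have h8 := DFunLike.congr_fun (h6.unique h7) (0, a)
  refine h3.congr_deriv ?_
  rw [map_zero, add_zero, hsymm]
  simpa using h8.symm

/-- By the variational equation and `hs`, the left side has zero derivative in `t`; at `t = 0` the
flow is the identity. -/
lemma symplectic_fderiv_flow (σ : Z →L[ℝ] Z →L[ℝ] ℝ) {X : Z → Z} {O : Set Z} (hO : IsOpen O)
    (hX : ContDiffOn ℝ ∞ X O)
    (hs : ∀ z ∈ O, ∀ a b, σ (fderiv ℝ X z a) b + σ a (fderiv ℝ X z b) = 0)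
    {φ : ℝ × Z → Z} {δ : ℝ} {z₀ : Z}
    (h1 : ∀ t ∈ Ioo (-δ) δ, ∀ z ∈ Metric.ball z₀ δ, ContDiffAt ℝ ∞ φ (t, z))
    (h2 : ∀ t ∈ Ioo (-δ) δ, ∀ z ∈ Metric.ball z₀ δ, φ (t, z) ∈ O)
    (h3 : ∀ z ∈ Metric.ball z₀ δ, φ (0, z) = z)
    (h4 : ∀ t ∈ Ioo (-δ) δ, ∀ z ∈ Metric.ball z₀ δ, HasDerivAt (fun s => φ (s, z)) (X (φ (t, z))) t)
    {t : ℝ} (ht : t ∈ Ioo (-δ) δ) {z : Z} (hz : z ∈ Metric.ball z₀ δ) (a b : Z) :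
    σ (fderiv ℝ (fun y => φ (t, y)) z a) (fderiv ℝ (fun y => φ (t, y)) z b) = σ a b := by
  have h0 : (0 : ℝ) ∈ Ioo (-δ) δ := by
    have := ht.1.trans ht.2
    constructor <;> linarith
  have hslice (t : ℝ) (ht : t ∈ Ioo (-δ) δ) (a : Z) :
      fderiv ℝ (fun y => φ (t, y)) z a = fderiv ℝ φ (t, z) (0, a) := by
    have h5 : HasFDerivAt (fun y : Z => (t, y)) (ContinuousLinearMap.inr ℝ ℝ Z) z :=
      (hasFDerivAt_const t z).prodMk (hasFDerivAt_id z)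
    have h6 := (((h1 t ht z hz).differentiableAt (by simp)).hasFDerivAt).comp z h5
    exact DFunLike.congr_fun h6.fderiv a
  have hder (t : ℝ) (ht : t ∈ Ioo (-δ) δ) (a : Z) := hasDerivAt_fderiv_flow (h1 t ht z hz)
    (((hX.contDiffAt (hO.mem_nhds (h2 t ht z hz))).differentiableAt (by simp)))
    (by
      filter_upwards [(isOpen_Ioo.prod Metric.isOpen_ball).mem_nhds (mk_mem_prod ht hz)] with p hp
      exact h4 p.1 hp.1 p.2 hp.2) a
  have hder2 (t : ℝ) (ht : t ∈ Ioo (-δ) δ) :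
      HasDerivAt (fun s => σ (fderiv ℝ φ (s, z) (0, a)) (fderiv ℝ φ (s, z) (0, b))) 0 t := by
    have h5 := (σ.hasFDerivAt.comp_hasDerivAt t (hder t ht a)).clm_apply (hder t ht b)
    refine h5.congr_deriv ?_
    exact hs _ (h2 t ht z hz) _ _
  have h7 := isOpen_Ioo.is_const_of_deriv_eq_zero (isPreconnected_Ioo)
    (fun s hs => (hder2 s hs).differentiableAt.differentiableWithinAt)
    (fun s hs => (hder2 s hs).deriv) ht h0
  have h8 : fderiv ℝ (fun y => φ (0, y)) z = ContinuousLinearMap.id ℝ Z := by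
    have h9 : (fun y => φ (0, y)) =ᶠ[𝓝 z] id := by
      filter_upwards [Metric.isOpen_ball.mem_nhds hz] with y hy using h3 y hy
    rw [h9.fderiv_eq, fderiv_id]
  rw [hslice t ht, hslice t ht, h7, ← hslice 0 h0, ← hslice 0 h0, h8]
  rfl

/-- Differentiating `hXF` gives `σ(a, DX b) = D²F(b, a)`, which is symmetric in `a` and `b`, while
`σ` is antisymmetric. -/
lemma symplectic_fderiv_of_hamiltonian (σ : Z →L[ℝ] Z →L[ℝ] ℝ) (hs : ∀ a b, σ a b = - σ b a)
    {X : Z → Z} {F : Z → ℝ} {O : Set Z} (hO : IsOpen O)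
    (hX : ContDiffOn ℝ ∞ X O) (hF : ContDiffOn ℝ ∞ F O)
    (hXF : ∀ z ∈ O, ∀ a, σ a (X z) = fderiv ℝ F z a) {z : Z} (hz : z ∈ O) (a b : Z) :
    σ (fderiv ℝ X z a) b + σ a (fderiv ℝ X z b) = 0 := by
  have hF' := hF.contDiffAt (hO.mem_nhds hz)
  have hsymm : IsSymmSndFDerivAt ℝ F z := hF'.isSymmSndFDerivAt (by simp; norm_cast)
  have hF2 : HasFDerivAt (fderiv ℝ F) (fderiv ℝ (fderiv ℝ F) z) z :=
    ((hF'.fderiv_right (m := 1) (by norm_cast)).differentiableAt (by simp)).hasFDerivAt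
  have hX1 := ((hX.contDiffAt (hO.mem_nhds hz)).differentiableAt (by simp)).hasFDerivAt
  have key (a b : Z) : σ a (fderiv ℝ X z b) = fderiv ℝ (fderiv ℝ F) z b a := by
    have h1 := (σ a).hasFDerivAt.comp z hX1
    have h2 := hF2.clm_apply (hasFDerivAt_const a z)
    have h3 : (fun z => σ a (X z)) =ᶠ[𝓝 z] fun z => fderiv ℝ F z a := by
      filter_upwards [hO.mem_nhds hz] with y hy using hXF y hy a
    simpa using DFunLike.congr_fun (h1.unique (h2.congr_of_eventuallyEq h3)) b
  rw [hs (fderiv ℝ X z a) b, key, key, hsymm]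
  ring

end LinearSymplectic

/-- The symplectic form of `E × P` as a continuous bilinear map. -/
def pairingFormCLM {E P : Type*} [NormedAddCommGroup E] [NormedSpace ℝ E]
    [NormedAddCommGroup P] [NormedSpace ℝ P] (B : P →L[ℝ] E →L[ℝ] ℝ) :
    (E × P) →L[ℝ] (E × P) →L[ℝ] ℝ :=
  B.bilinearComp (ContinuousLinearMap.snd ℝ E P) (ContinuousLinearMap.fst ℝ E P) -
    B.flip.bilinearComp (ContinuousLinearMap.fst ℝ E P) (ContinuousLinearMap.snd ℝ E P)

lemma pairingFormCLM_apply {E P : Type*} [NormedAddCommGroup E] [NormedSpace ℝ E]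
    [NormedAddCommGroup P] [NormedSpace ℝ P] (B : P →L[ℝ] E →L[ℝ] ℝ) (v w : E × P) :
    pairingFormCLM B v w = pairingForm B v w := by
  simp [pairingFormCLM, pairingForm]

/-! ### Flow boxes of Hamiltonian vector fields -/

section FlowBox

variable {E : Type*} [NormedAddCommGroup E] [NormedSpace ℝ E]
  {M : Type*} [TopologicalSpace M] [ChartedSpace E M] [IsManifold 𝓘(ℝ, E) ∞ M]
  {F : Cotangent E M → ℝ} {k ℓ : Cotangent E M}

/-- For `ℓ ∈ W` and `|s| < δ` the Hamiltonian flow of `F` stays in `O`, is smooth and symplectic. -/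
structure IsFlowBox (F : Cotangent E M → ℝ) (O W : Set (Cotangent E M)) (δ : ℝ) : Prop where
  isOpen : IsOpen W
  pos : 0 < δ
  flowDefined : ∀ ℓ ∈ W, ∀ s ∈ Ioo (-δ) δ, FlowDefined (hamVF F) s ℓ
  mem : ∀ ℓ ∈ W, ∀ s ∈ Ioo (-δ) δ, expFlow (hamVF F) s ℓ ∈ O
  zero : ∀ ℓ ∈ W, expFlow (hamVF F) 0 ℓ = ℓ
  smooth : ∀ ℓ ∈ W, ∀ s ∈ Ioo (-δ) δ, ContMDiffAt (𝓘(ℝ, ℝ).prod (cotangentModel E))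
    (cotangentModel E) ∞ (fun p : ℝ × Cotangent E M => expFlow (hamVF F) p.1 p.2) (s, ℓ)
  velocity : ∀ ℓ ∈ W, ∀ s ∈ Ioo (-δ) δ, HasMFDerivAt 𝓘(ℝ, ℝ) (cotangentModel E)
    (fun s => expFlow (hamVF F) s ℓ) s
    ((1 : ℝ →L[ℝ] ℝ).smulRight (hamVF F (expFlow (hamVF F) s ℓ)))
  symplectic : ∀ ℓ ∈ W, ∀ s ∈ Ioo (-δ) δ, ∀ v w : TangentSpace (cotangentModel E) ℓ,
    symplecticForm (expFlow (hamVF F) s ℓ)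
      (mfderiv (cotangentModel E) (cotangentModel E) (expFlow (hamVF F) s) ℓ v)
      (mfderiv (cotangentModel E) (cotangentModel E) (expFlow (hamVF F) s) ℓ w) =
    symplecticForm ℓ v w

lemma IsFlowBox.mono {O W W' : Set (Cotangent E M)} {δ δ' : ℝ} (h : IsFlowBox F O W δ)
    (hW : IsOpen W') (hWW : W' ⊆ W) (hδ : 0 < δ') (hδδ : δ' ≤ δ) : IsFlowBox F O W' δ' := by
  have hI : Ioo (-δ') δ' ⊆ Ioo (-δ) δ := Ioo_subset_Ioo (by linarith) hδδ
  exact ⟨hW, hδ, fun ℓ hℓ s hs => h.flowDefined ℓ (hWW hℓ) s (hI hs),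
    fun ℓ hℓ s hs => h.mem ℓ (hWW hℓ) s (hI hs), fun ℓ hℓ => h.zero ℓ (hWW hℓ),
    fun ℓ hℓ s hs => h.smooth ℓ (hWW hℓ) s (hI hs),
    fun ℓ hℓ s hs => h.velocity ℓ (hWW hℓ) s (hI hs),
    fun ℓ hℓ s hs => h.symplectic ℓ (hWW hℓ) s (hI hs)⟩

lemma IsFlowBox.union {O W W' : Set (Cotangent E M)} {δ : ℝ} (h : IsFlowBox F O W δ)
    (h' : IsFlowBox F O W' δ) : IsFlowBox F O (W ∪ W') δ :=
  ⟨h.isOpen.union h'.isOpen, h.pos,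
    fun ℓ hℓ => hℓ.elim (h.flowDefined ℓ) (h'.flowDefined ℓ),
    fun ℓ hℓ => hℓ.elim (h.mem ℓ) (h'.mem ℓ), fun ℓ hℓ => hℓ.elim (h.zero ℓ) (h'.zero ℓ),
    fun ℓ hℓ => hℓ.elim (h.smooth ℓ) (h'.smooth ℓ),
    fun ℓ hℓ => hℓ.elim (h.velocity ℓ) (h'.velocity ℓ),
    fun ℓ hℓ => hℓ.elim (h.symplectic ℓ) (h'.symplectic ℓ)⟩

variable [FiniteDimensional ℝ E] [T2Space M]

/-- `expFlow` takes its value from an arbitrarily chosen integral curve. Uniqueness makes the choice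
immaterial as soon as one integral curve stays where `F` is smooth; nothing is asked of the chosen
one. -/
lemma expFlow_eq_of_isFlowLine {O : Set (Cotangent E M)} (hO : IsOpen O)
    (hF : ContMDiffOn (cotangentModel E) 𝓘(ℝ, ℝ) ∞ F O) {s : ℝ} {γ : ℝ → Cotangent E M}
    (hγ : IsFlowLine (hamVF F) s ℓ γ) (hγO : ∀ t ∈ uIcc 0 s, γ t ∈ O) :
    expFlow (hamVF F) s ℓ = γ s := by
  have hex : FlowDefined (hamVF F) s ℓ := ⟨γ, hγ⟩
  rw [expFlow, dif_pos hex]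
  refine eqOn_uIcc_of_isMIntegralCurveOn hex.choose_spec.2 hγ.2
    (hex.choose_spec.1.trans hγ.1.symm) (fun t ht => ?_) right_mem_uIcc
  refine ((contDiffOn_chartField_hamVF (k := γ t) hO hF).contDiffAt
    ((isOpen_extChartAt_symm_preimage hO).mem_nhds ⟨mem_extChartAt_target (γ t), ?_⟩)).of_le
    (by norm_cast)
  rw [mem_preimage, (extChartAt (cotangentModel E) (γ t)).left_inv (mem_extChartAt_source (γ t))]
  exact hγO t ht

omit [T2Space M] in
lemma canonicalForm_fderiv_flow {F : Cotangent E M → ℝ} {O : Set (Cotangent E M)} (hO : IsOpen O)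
    (hF : ContMDiffOn (cotangentModel E) 𝓘(ℝ, ℝ) ∞ F O)
    {φ : ℝ × (E × (E →L[ℝ] ℝ)) → E × (E →L[ℝ] ℝ)} {δ : ℝ} {z₀ : E × (E →L[ℝ] ℝ)}
    (h1 : ∀ t ∈ Ioo (-δ) δ, ∀ z ∈ Metric.ball z₀ δ, ContDiffAt ℝ ∞ φ (t, z))
    (h2 : ∀ t ∈ Ioo (-δ) δ, ∀ z ∈ Metric.ball z₀ δ, φ (t, z) ∈
      (extChartAt (cotangentModel E) k).target ∩ (extChartAt (cotangentModel E) k).symm ⁻¹' O)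
    (h3 : ∀ z ∈ Metric.ball z₀ δ, φ (0, z) = z)
    (h4 : ∀ t ∈ Ioo (-δ) δ, ∀ z ∈ Metric.ball z₀ δ,
      HasDerivAt (fun s => φ (s, z)) (chartField (hamVF F) k (φ (t, z))) t)
    {t : ℝ} (ht : t ∈ Ioo (-δ) δ) {z : E × (E →L[ℝ] ℝ)} (hz : z ∈ Metric.ball z₀ δ)
    (a b : E × (E →L[ℝ] ℝ)) :
    canonicalForm (fderiv ℝ (fun y => φ (t, y)) z a) (fderiv ℝ (fun y => φ (t, y)) z b) =
      canonicalForm a b := by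
  have hX := contDiffOn_chartField_hamVF (k := k) hO hF
  have hF' := contDiffOn_comp_extChartAt_symm (k := k) hF
  have hO' := isOpen_extChartAt_symm_preimage (k := k) hO
  have key := symplectic_fderiv_flow
    (pairingFormCLM (ContinuousLinearMap.id ℝ (E →L[ℝ] ℝ))) hO' hX
    (fun z hz => symplectic_fderiv_of_hamiltonian _ (fun a b => by
      rw [pairingFormCLM_apply, pairingFormCLM_apply, pairingForm_swap]) hO' hX hF' (fun z hz a => by
      rw [pairingFormCLM_apply, chartField_hamVF hz.1
        ((hF.contMDiffAt (hO.mem_nhds hz.2)).mdifferentiableAt (by simp))]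
      exact canonicalForm_canonicalSharp _ _) hz) h1 h2 h3 h4 ht hz a b
  rwa [pairingFormCLM_apply, pairingFormCLM_apply] at key

/-- The coordinate flow in the chart at `k` is transported to `T*M`. Uniqueness identifies it with
`expFlow`, and each property is inherited from the chart. -/
lemma exists_isFlowBox {O : Set (Cotangent E M)} (hO : IsOpen O)
    (hF : ContMDiffOn (cotangentModel E) 𝓘(ℝ, ℝ) ∞ F O) (hk : k ∈ O) :
    ∃ W δ, k ∈ W ∧ IsFlowBox F O W δ := by
  have hX := contDiffOn_chartField_hamVF (k := k) hO hF
  have hO' := isOpen_extChartAt_symm_preimage (k := k) hO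
  set χ := extChartAt (cotangentModel E) k
  have hχk : χ.symm (χ k) = k := χ.left_inv (mem_extChartAt_source k)
  obtain ⟨φ, δ, hδ, h1, h2, h3, h4⟩ := exists_flow_of_contDiffOn hO' hX (z₀ := χ k)
    ⟨mem_extChartAt_target k, by rw [mem_preimage, hχk]; exact hk⟩
  have hW : IsOpen (χ.source ∩ χ ⁻¹' Metric.ball (χ k) δ) :=
    (continuousOn_extChartAt k).isOpen_inter_preimage (isOpen_extChartAt_source k) Metric.isOpen_ball
  have h0 : (0 : ℝ) ∈ Ioo (-δ) δ := ⟨by linarith, hδ⟩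
  have hvel : ∀ ℓ ∈ χ.source ∩ χ ⁻¹' Metric.ball (χ k) δ, ∀ s ∈ Ioo (-δ) δ,
      HasMFDerivAt 𝓘(ℝ, ℝ) (cotangentModel E) (fun s => χ.symm (φ (s, χ ℓ))) s
      ((1 : ℝ →L[ℝ] ℝ).smulRight (hamVF F (χ.symm (φ (s, χ ℓ))))) := fun ℓ hℓ s hs =>
    hasMFDerivAt_extChartAt_symm_comp (h4 s hs _ hℓ.2) (h2 s hs _ hℓ.2).1
  have hline : ∀ ℓ ∈ χ.source ∩ χ ⁻¹' Metric.ball (χ k) δ, ∀ s ∈ Ioo (-δ) δ,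
      IsFlowLine (hamVF F) s ℓ (fun t => χ.symm (φ (t, χ ℓ))) := fun ℓ hℓ s hs =>
    ⟨(congrArg χ.symm (h3 _ hℓ.2)).trans (χ.left_inv hℓ.1), fun t ht =>
      (hvel ℓ hℓ t (ordConnected_Ioo.uIcc_subset h0 hs ht)).hasMFDerivWithinAt⟩
  have hflow : ∀ ℓ ∈ χ.source ∩ χ ⁻¹' Metric.ball (χ k) δ, ∀ s ∈ Ioo (-δ) δ,
      expFlow (hamVF F) s ℓ = χ.symm (φ (s, χ ℓ)) := fun ℓ hℓ s hs =>
    expFlow_eq_of_isFlowLine hO hF (hline ℓ hℓ s hs) fun t ht =>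
      (h2 t (ordConnected_Ioo.uIcc_subset h0 hs ht) _ hℓ.2).2
  refine ⟨χ.source ∩ χ ⁻¹' Metric.ball (χ k) δ, δ, ⟨mem_extChartAt_source k, Metric.mem_ball_self hδ⟩, hW, hδ,
    fun ℓ hℓ s hs => ⟨_, hline ℓ hℓ s hs⟩, fun ℓ hℓ s hs => ?_, fun ℓ hℓ => ?_, fun ℓ hℓ s hs => ?_,
    fun ℓ hℓ s hs => ?_, fun ℓ hℓ s hs v w => ?_⟩
  · rw [hflow ℓ hℓ s hs]
    exact (h2 s hs _ hℓ.2).2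
  · rw [hflow ℓ hℓ 0 h0, h3 _ hℓ.2, χ.left_inv hℓ.1]
  · have e1 : ContMDiffAt 𝓘(ℝ, E × (E →L[ℝ] ℝ)) (cotangentModel E) ∞ χ.symm (φ (s, χ ℓ)) :=
      (contMDiffOn_extChartAt_symm k).contMDiffAt
        ((isOpen_extChartAt_target k).mem_nhds (h2 s hs _ hℓ.2).1)
    have e2 : ContMDiffAt (cotangentModel E) 𝓘(ℝ, E × (E →L[ℝ] ℝ)) ∞ χ ℓ :=
      contMDiffAt_extChartAt' (by simpa [χ] using hℓ.1)
    have e3 : ContMDiffAt (𝓘(ℝ, ℝ).prod (cotangentModel E)) 𝓘(ℝ, ℝ × (E × (E →L[ℝ] ℝ))) ∞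
        (fun p : ℝ × Cotangent E M => (p.1, χ p.2)) (s, ℓ) :=
      contMDiffAt_fst.prodMk_space (e2.comp (s, ℓ) contMDiffAt_snd)
    have e4 := e1.comp (s, ℓ) ((h1 s hs _ hℓ.2).contMDiffAt.comp (s, ℓ) e3)
    refine e4.congr_of_eventuallyEq ?_
    filter_upwards [(isOpen_Ioo.prod hW).mem_nhds (mk_mem_prod hs hℓ)] with p hp
    exact hflow p.2 hp.2 p.1 hp.1
  · have e1 := hvel ℓ hℓ s hs
    rw [← hflow ℓ hℓ s hs] at e1
    refine e1.congr_of_eventuallyEq ?_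
    filter_upwards [isOpen_Ioo.mem_nhds hs] with t ht using hflow ℓ hℓ t ht
  · have e1 := hasMFDerivAt_extChartAt' hℓ.1
    have e2 : HasFDerivAt (fun y => φ (s, y)) (fderiv ℝ (fun y => φ (s, y)) (χ ℓ)) (χ ℓ) :=
      (((h1 s hs _ hℓ.2).differentiableAt (by simp)).comp (χ ℓ)
        ((differentiableAt_const s).prodMk differentiableAt_id)).hasFDerivAt
    have e3 := (hasMFDerivAt_extChartAt_symm' (h2 s hs _ hℓ.2).1).comp ℓ
      ((hasMFDerivAt_iff_hasFDerivAt.2 e2).comp ℓ e1)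
    have e4 := e3.congr_of_eventuallyEq (f₁ := expFlow (hamVF F) s) (by
      filter_upwards [hW.mem_nhds hℓ] with y hy using hflow y hy s hs)
    rw [symplecticForm_eq hℓ.1, e4.mfderiv]
    have e5 := canonicalForm_fderiv_flow hO hF h1 h2 h3 h4 hs hℓ.2
      (mfderiv (cotangentModel E) 𝓘(ℝ, E × (E →L[ℝ] ℝ)) χ ℓ v)
      (mfderiv (cotangentModel E) 𝓘(ℝ, E × (E →L[ℝ] ℝ)) χ ℓ w)
    refine Eq.trans ?_ e5
    rw [← symplecticForm_mfderiv_extChartAt_symm (h2 s hs _ hℓ.2).1]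
    -- All tangent spaces unfold to the model space, so equal base points can be exchanged with the
    -- vectors kept fixed.
    have e6 : ∀ (ℓ' ℓ'' : Cotangent E M) (_ : ℓ' = ℓ'') (a b : E × (E →L[ℝ] ℝ)),
      symplecticForm ℓ' a b = symplecticForm ℓ'' a b := by rintro _ _ rfl _ _; rfl
    exact e6 _ _ (hflow ℓ hℓ s hs) _ _

/-- Flow boxes can be united after taking the smaller time bound, so compactness yields one positive
`δ` for all of `K`. -/
lemma exists_isFlowBox_of_isCompact {O K : Set (Cotangent E M)} (hO : IsOpen O)
    (hF : ContMDiffOn (cotangentModel E) 𝓘(ℝ, ℝ) ∞ F O) (hK : IsCompact K) (hKO : K ⊆ O) :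
    ∃ W δ, K ⊆ W ∧ IsFlowBox F O W δ := by
  refine hK.induction_on (p := fun S => ∃ W δ, S ⊆ W ∧ IsFlowBox F O W δ) ?_ ?_ ?_ ?_
  · exact ⟨∅, 1, Subset.rfl, isOpen_empty, one_pos, by simp, by simp, by simp, by simp, by simp,
      by simp⟩
  · rintro s t hst ⟨W, δ, h, h'⟩
    exact ⟨W, δ, hst.trans h, h'⟩
  · rintro s t ⟨W, δ, h, h'⟩ ⟨W₁, δ₁, h₁, h₁'⟩
    have hpos := lt_min h'.pos h₁'.pos
    exact ⟨W ∪ W₁, min δ δ₁, union_subset_union h h₁,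
      (h'.mono h'.isOpen Subset.rfl hpos (min_le_left _ _)).union
      (h₁'.mono h₁'.isOpen Subset.rfl hpos (min_le_right _ _))⟩
  · intro x hx
    obtain ⟨W, δ, h, h'⟩ := exists_isFlowBox hO hF (hKO hx)
    exact ⟨W, mem_nhdsWithin_of_mem_nhds (h'.isOpen.mem_nhds h), W, δ, Subset.rfl, h'⟩

/-- The shifted curve `t ↦ exp((r + t) F⃗)(ℓ)` is an integral curve staying in `O`. The intermediate
point need not belong to `W`. -/
lemma IsFlowBox.expFlow_add {O W : Set (Cotangent E M)} {δ : ℝ} (h : IsFlowBox F O W δ)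
    (hO : IsOpen O) (hF : ContMDiffOn (cotangentModel E) 𝓘(ℝ, ℝ) ∞ F O) (hℓ : ℓ ∈ W) {r s : ℝ}
    (hr : r ∈ Ioo (-δ) δ) (hs : r + s ∈ Ioo (-δ) δ) :
    expFlow (hamVF F) s (expFlow (hamVF F) r ℓ) = expFlow (hamVF F) (r + s) ℓ := by
  have hmem : ∀ t ∈ uIcc 0 s, r + t ∈ Ioo (-δ) δ := fun t ht => by
    refine ordConnected_Ioo.uIcc_subset hr hs ?_
    rw [mem_uIcc] at ht ⊢
    rcases ht with ht | ht
    · exact Or.inl ⟨by linarith, by linarith⟩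
    · exact Or.inr ⟨by linarith, by linarith⟩
  have hline : IsFlowLine (hamVF F) s (expFlow (hamVF F) r ℓ)
      (fun t => expFlow (hamVF F) (r + t) ℓ) := by
    refine ⟨by simp, fun t ht => HasMFDerivAt.hasMFDerivWithinAt ?_⟩
    have h1 : HasDerivAt (fun t => r + t) 1 t := (hasDerivAt_id t).const_add r
    refine ((h.velocity ℓ hℓ _ (hmem t ht)).comp t
      (hasMFDerivAt_iff_hasFDerivAt.2 h1.hasFDerivAt)).congr_mfderiv ?_
    refine ContinuousLinearMap.ext fun a => ?_
    exact congrArg (fun c : ℝ => c • hamVF F (expFlow (hamVF F) (r + t) ℓ)) (mul_one (show ℝ from a))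
  exact expFlow_eq_of_isFlowLine hO hF hline fun t ht => h.mem ℓ hℓ _ (hmem t ht)

lemma IsFlowBox.expFlow_neg {O W : Set (Cotangent E M)} {δ : ℝ} (h : IsFlowBox F O W δ)
    (hO : IsOpen O) (hF : ContMDiffOn (cotangentModel E) 𝓘(ℝ, ℝ) ∞ F O) (hℓ : ℓ ∈ W) {s : ℝ}
    (hs : s ∈ Ioo (-δ) δ) : expFlow (hamVF F) (-s) (expFlow (hamVF F) s ℓ) = ℓ := by
  have h0 : s + -s ∈ Ioo (-δ) δ := by
    rw [add_neg_cancel]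
    exact ⟨by linarith [h.pos], h.pos⟩
  rw [h.expFlow_add hO hF hℓ hs h0, add_neg_cancel, h.zero ℓ hℓ]

end FlowBox

/-! ### Tangency to `Σ⁻` -/

section Tangency

/-- A curve in the hypersurface `⟨p, f x⟩ = g x` with a prescribed tangent velocity. -/
lemma exists_curve_of_tangent {E P : Type*} [NormedAddCommGroup E] [NormedSpace ℝ E]
    [NormedAddCommGroup P] [NormedSpace ℝ P] (B : P →L[ℝ] E →L[ℝ] ℝ) {f : E → E} {g : E → ℝ}
    {z w : E × P} (hf : ContDiffAt ℝ 1 f z.1) (hg : ContDiffAt ℝ 1 g z.1) (hg0 : g z.1 ≠ 0)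
    (hz : B z.2 (f z.1) = g z.1)
    (hw : B w.2 (f z.1) + B z.2 (fderiv ℝ f z.1 w.1) - fderiv ℝ g z.1 w.1 = 0) :
    ∃ c : ℝ → E × P, c 0 = z ∧ ContDiffAt ℝ 1 c 0 ∧ HasDerivAt c w 0 ∧
      ∀ᶠ t in 𝓝 (0 : ℝ), B (c t).2 (f (c t).1) = g (c t).1 := by
  -- The curve is the straight line `z + t w` with its momentum multiplied by `g / ⟨p, f⟩`; as the
  -- constraint is linear in the momentum, this puts the curve on the hypersurface. The factor is
  -- `1` at `t = 0`, where `g ≠ 0` is used, and `hw` makes its derivative vanish, so the velocity is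
  -- still `w`.
  let x : ℝ → E := fun t => z.1 + t • w.1
  let p : ℝ → P := fun t => z.2 + t • w.2
  have hx0 : x 0 = z.1 := by simp [x]
  have hp0 : p 0 = z.2 := by simp [p]
  have hx : ContDiff ℝ 1 x := contDiff_const.add (contDiff_id.smul contDiff_const)
  have hp : ContDiff ℝ 1 p := contDiff_const.add (contDiff_id.smul contDiff_const)
  have hx' : HasDerivAt x w.1 0 :=
    (((hasDerivAt_id (0 : ℝ)).smul_const w.1).const_add z.1).congr_deriv (one_smul ℝ w.1)
  have hp' : HasDerivAt p w.2 0 :=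
    (((hasDerivAt_id (0 : ℝ)).smul_const w.2).const_add z.2).congr_deriv (one_smul ℝ w.2)
  have hgx : ContDiffAt ℝ 1 (fun t => g (x t)) 0 := by
    rw [← hx0] at hg; exact hg.comp 0 hx.contDiffAt
  have hfx : ContDiffAt ℝ 1 (fun t => f (x t)) 0 := by
    rw [← hx0] at hf; exact hf.comp 0 hx.contDiffAt
  have hG : ContDiffAt ℝ 1 (fun t => B (p t) (f (x t))) 0 :=
    (B.contDiff.comp hp).contDiffAt.clm_apply hfx
  have hG0 : B (p 0) (f (x 0)) ≠ 0 := by rw [hx0, hp0, hz]; exact hg0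
  have hg' : HasDerivAt (fun t => g (x t)) (fderiv ℝ g z.1 w.1) 0 := by
    have h1 := (hg.differentiableAt (by simp)).hasFDerivAt
    rw [← hx0] at h1
    have := h1.comp_hasDerivAt 0 hx'
    rwa [hx0] at this
  have hf' : HasDerivAt (fun t => f (x t)) (fderiv ℝ f z.1 w.1) 0 := by
    have h1 := (hf.differentiableAt (by simp)).hasFDerivAt
    rw [← hx0] at h1
    have := h1.comp_hasDerivAt 0 hx'
    rwa [hx0] at this
  have hG' : HasDerivAt (fun t => B (p t) (f (x t)))
      (B w.2 (f z.1) + B z.2 (fderiv ℝ f z.1 w.1)) 0 := by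
    have := (B.hasFDerivAt.comp_hasDerivAt 0 hp').clm_apply hf'
    simp only [hx0, hp0, Function.comp_apply] at this
    exact this
  have hρ' : HasDerivAt (fun t => g (x t) / B (p t) (f (x t))) 0 0 := by
    refine (hg'.div hG' hG0).congr_deriv ?_
    rw [hx0, hp0, hz, sub_eq_zero.1 hw]
    ring
  have hρ0 : g (x 0) / B (p 0) (f (x 0)) = 1 := by
    rw [hx0, hp0, hz, div_self hg0]
  refine ⟨fun t => (x t, (g (x t) / B (p t) (f (x t))) • p t), ?_, ?_, ?_, ?_⟩
  · show (x 0, (g (x 0) / B (p 0) (f (x 0))) • p 0) = z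
    rw [hρ0, hx0, hp0, one_smul]
  · exact hx.contDiffAt.prodMk ((hgx.div hG hG0).smul hp.contDiffAt)
  · have := hx'.prodMk (hρ'.smul hp')
    refine this.congr_deriv ?_
    rw [hρ0]
    simp
  · filter_upwards [hG.continuousAt.eventually_ne hG0] with t ht
    simp only [map_smul, smul_apply, smul_eq_mul]
    field_simp

variable {E : Type*} [NormedAddCommGroup E] [NormedSpace ℝ E]
  {M : Type*} [TopologicalSpace M] [ChartedSpace E M] [IsManifold 𝓘(ℝ, E) ∞ M]
  {ℓ : Cotangent E M} {f₁ : ∀ q : M, TangentSpace 𝓘(ℝ, E) q} {ψ : M → ℝ}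

/-- In canonical coordinates `Σ⁻` is `⟨p, f₁⟩ = ψ`. Positivity of `ψ` removes the absolute value and
also supplies the nonzero right-hand side that the explicit curve requires. -/
lemma isTangentTo_SigmaMinus (hf₁ : SmoothVF f₁)
    (hψ : ContMDiff 𝓘(ℝ, E) 𝓘(ℝ, ℝ) ∞ ψ) (hℓ : 0 < ψ ℓ.1) (hmem : ℓ ∈ SigmaMinus f₁ ψ)
    {v : TangentSpace (cotangentModel E) ℓ} (hv : differential (PhiMinus f₁ ψ) ℓ v = 0) :
    IsTangentTo (SigmaMinus f₁ ψ) ℓ v := by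
  have hpart := (hasCanonicalPartials_hamLift hf₁ ℓ).sub (hasCanonicalPartials_comp_proj hψ ℓ)
  have hsymm : (extChartAt (cotangentModel E) ℓ).symm (extChartAt (cotangentModel E) ℓ ℓ) = ℓ :=
    (extChartAt (cotangentModel E) ℓ).left_inv (mem_extChartAt_source ℓ)
  have hS := mfderiv_extChartAt_symm_comp (I := cotangentModel E) (mem_extChartAt_target ℓ)
  rw [hsymm] at hS
  have hS' := hasMFDerivAt_extChartAt_symm' (I := cotangentModel E) (mem_extChartAt_target ℓ)
  have hψ1 := (contDiffOn_comp_extChartAt_symm_of_contMDiff hψ ℓ.1).contDiffAt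
    ((isOpen_extChartAt_target ℓ.1).mem_nhds (extChartAt_fst_mem_target ℓ))
  have hcont := contMDiffOn_extChartAt_symm (I := cotangentModel E) (n := 1) ℓ
  rw [differential_congr (PhiMinus_eventuallyEq f₁ hψ hℓ), hpart.2, sub_zero] at hv
  set w : E × (E →L[ℝ] ℝ) := mfderiv (cotangentModel E) 𝓘(ℝ, E × (E →L[ℝ] ℝ))
    (extChartAt (cotangentModel E) ℓ) ℓ v with hw
  have hlift := hamLift_eq_extChartAt f₁ (mem_extChartAt_source (I := cotangentModel E) ℓ)
  have hψ0 : ψ ((extChartAt 𝓘(ℝ, E) ℓ.1).symm (extChartAt (cotangentModel E) ℓ ℓ).1) = ψ ℓ.1 := by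
    rw [extChartAt_apply_fst, (extChartAt 𝓘(ℝ, E) ℓ.1).left_inv (mem_extChartAt_source ℓ.1)]
  have hmem' : hamLift f₁ ℓ - |ψ ℓ.1| = 0 := hmem
  rw [abs_of_pos hℓ, sub_eq_zero] at hmem'
  obtain ⟨c, hc0, hc1, hc', hc⟩ := exists_curve_of_tangent
    (ContinuousLinearMap.id ℝ (E →L[ℝ] ℝ)) (z := extChartAt (cotangentModel E) ℓ ℓ) (w := w)
    ((hf₁.contDiffAt_chartField ℓ).of_le (by norm_cast)) (hψ1.of_le (by norm_cast))
    (by rw [hψ0]; exact hℓ.ne') (by rw [hψ0, ← hmem', hlift]; rfl) (by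
      rw [sub_apply, ← add_sub_assoc] at hv
      exact hv)
  refine ⟨fun t => (extChartAt (cotangentModel E) ℓ).symm (c t), ?_, ?_, ?_, ?_⟩
  · exact (congrArg _ hc0).trans hsymm
  · have h1 := hcont.contMDiffAt ((isOpen_extChartAt_target ℓ).mem_nhds (mem_extChartAt_target ℓ))
    rw [← hc0] at h1
    exact h1.comp 0 hc1.contMDiffAt
  · have h1 : ∀ᶠ t in 𝓝 (0 : ℝ), c t ∈ (extChartAt (cotangentModel E) ℓ).target :=
      hc1.continuousAt.eventually_mem ((isOpen_extChartAt_target ℓ).mem_nhds (by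
        rw [hc0]; exact mem_extChartAt_target ℓ))
    have h2 : ∀ᶠ t in 𝓝 (0 : ℝ), 0 < ψ ((extChartAt 𝓘(ℝ, E) ℓ.1).symm (c t).1) := by
      have h3 : ContinuousAt (fun t => ψ ((extChartAt 𝓘(ℝ, E) ℓ.1).symm (c t).1)) 0 := by
        have h4 := hψ1.continuousAt
        rw [← hc0] at h4
        exact ContinuousAt.comp (g := fun y => ψ ((extChartAt 𝓘(ℝ, E) ℓ.1).symm y)) h4
          hc1.continuousAt.fst
      refine h3.eventually_mem (isOpen_Ioi.mem_nhds ?_)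
      rw [hc0, mem_Ioi, hψ0]
      exact hℓ
    filter_upwards [hc, h1, h2] with t ht ht1 ht2
    have h5 := (extChartAt (cotangentModel E) ℓ).right_inv ht1
    have h6 := (extChartAt (cotangentModel E) ℓ).map_target ht1
    have h7 := hamLift_eq_extChartAt f₁ h6
    have h8 : ((extChartAt (cotangentModel E) ℓ).symm (c t)).1 =
        (extChartAt 𝓘(ℝ, E) ℓ.1).symm (c t).1 := by
      rw [← (extChartAt 𝓘(ℝ, E) ℓ.1).left_inv (mem_extChartAt_source_iff.1 h6),
        ← extChartAt_apply_fst, h5]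
    rw [h5] at h7
    show hamLift f₁ _ - |ψ _| = 0
    rw [h7, h8, abs_of_pos ht2, sub_eq_zero]
    exact ht
  · have h1 := hS'
    rw [← hc0] at h1
    have h2 := h1.comp 0 (hasMFDerivAt_iff_hasFDerivAt.2 hc'.hasFDerivAt)
    refine h2.congr_mfderiv ?_
    rw [hc0]
    refine ContinuousLinearMap.ext fun r => ?_
    exact ((mfderiv 𝓘(ℝ, E × (E →L[ℝ] ℝ)) (cotangentModel E)
      (extChartAt (cotangentModel E) ℓ).symm (extChartAt (cotangentModel E) ℓ ℓ)).map_smul r w).trans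
      (congrArg ((show ℝ from r) • ·) (DFunLike.congr_fun hS v))

end Tangency

/-! ### The extremal along its singular arc -/

section SingularArcExtremal

variable {E : Type*} [NormedAddCommGroup E] [NormedSpace ℝ E]
  {M : Type*} [TopologicalSpace M] [ChartedSpace E M] [IsManifold 𝓘(ℝ, E) ∞ M]
  {F G A : Cotangent E M → ℝ} {ℓ : Cotangent E M}

lemma hasDerivAt_comp_curve {γ : ℝ → Cotangent E M} {t : ℝ} {v : TangentSpace (cotangentModel E) (γ t)}
    (hF : MDifferentiableAt (cotangentModel E) 𝓘(ℝ, ℝ) F (γ t))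
    (hγ : HasMFDerivAt 𝓘(ℝ, ℝ) (cotangentModel E) γ t ((1 : ℝ →L[ℝ] ℝ).smulRight v)) :
    HasDerivAt (fun s => F (γ s)) (differential F (γ t) v) t := by
  have h1 := hasMFDerivAt_iff_hasFDerivAt.1 (hF.hasMFDerivAt.comp t hγ)
  refine hasDerivAt_iff_hasFDerivAt.2 (h1.congr_fderiv ?_)
  refine ContinuousLinearMap.ext fun r => ?_
  exact (mfderiv (cotangentModel E) 𝓘(ℝ, ℝ) F (γ t)).map_smul (show ℝ from r) v

lemma differential_add_mul (hA : MDifferentiableAt (cotangentModel E) 𝓘(ℝ, ℝ) A ℓ)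
    (hG : MDifferentiableAt (cotangentModel E) 𝓘(ℝ, ℝ) G ℓ)
    (hF : MDifferentiableAt (cotangentModel E) 𝓘(ℝ, ℝ) F ℓ)
    (v : TangentSpace (cotangentModel E) ℓ) :
    MDifferentiableAt (cotangentModel E) 𝓘(ℝ, ℝ) (fun ℓ => A ℓ + G ℓ * F ℓ) ℓ ∧
    differential (fun ℓ => A ℓ + G ℓ * F ℓ) ℓ v =
      differential A ℓ v + (G ℓ * differential F ℓ v + F ℓ * differential G ℓ v) := by
  have h1 := hA.hasMFDerivAt.add (hG.hasMFDerivAt.mul hF.hasMFDerivAt)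
  exact ⟨h1.mdifferentiableAt, DFunLike.congr_fun h1.mfderiv v⟩

variable [FiniteDimensional ℝ E] {f₀ f₁ : ∀ q : M, TangentSpace 𝓘(ℝ, E) q} {ψ : M → ℝ}

lemma differential_hamVF_self (hF : MDifferentiableAt (cotangentModel E) 𝓘(ℝ, ℝ) F ℓ) :
    differential F ℓ (hamVF F ℓ) = 0 := by
  have := differential_hamVF_swap hF hF
  linarith

omit [FiniteDimensional ℝ E] in
lemma mdifferentiableAt_PhiMinus (hf₁ : SmoothVF f₁) (hψ : ContMDiff 𝓘(ℝ, E) 𝓘(ℝ, ℝ) ∞ ψ)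
    (hℓ : 0 < ψ ℓ.1) : MDifferentiableAt (cotangentModel E) 𝓘(ℝ, ℝ) (PhiMinus f₁ ψ) ℓ :=
  ((contMDiffOn_PhiMinus hf₁ hψ).contMDiffAt
    ((isOpen_setOf_pos hψ).mem_nhds hℓ)).mdifferentiableAt (by simp)

/-- Where `ψ > 0` and `u > 0`, the derivative of `Φ⁻` along the flow of `h(·, u)`. -/
lemma differential_PhiMinus_hamVF_preHam (hf₀ : SmoothVF f₀) (hf₁ : SmoothVF f₁)
    (hψ : ContMDiff 𝓘(ℝ, E) 𝓘(ℝ, ℝ) ∞ ψ) (hℓ : 0 < ψ ℓ.1) {u : ℝ} (hu : 0 < u) :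
    differential (PhiMinus f₁ ψ) ℓ (hamVF (fun ℓ => preHam f₀ f₁ ψ ℓ u) ℓ) =
      singFun f₀ f₁ ψ ℓ := by
  -- For `u > 0` one has `h(·, u) = F₀ + u Φ⁻`, and the bracket of `Φ⁻` with itself vanishes.
  have h1 : (fun ℓ => preHam f₀ f₁ ψ ℓ u) =ᶠ[𝓝 ℓ]
      fun ℓ => hamLift f₀ ℓ + (fun _ => u) ℓ * PhiMinus f₁ ψ ℓ := by
    filter_upwards with x
    simp only [preHam, PhiMinus, abs_mul, abs_of_pos hu]
    ring
  have hΦ := mdifferentiableAt_PhiMinus hf₁ hψ hℓ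
  have h0 : MDifferentiableAt (cotangentModel E) 𝓘(ℝ, ℝ) (hamLift f₀) ℓ :=
    ((contMDiff_hamLift hf₀) ℓ).mdifferentiableAt (by simp)
  have hc : MDifferentiableAt (cotangentModel E) 𝓘(ℝ, ℝ) (fun _ : Cotangent E M => u) ℓ :=
    mdifferentiableAt_const
  have hc' : ∀ v, differential (fun _ : Cotangent E M => u) ℓ v = 0 := fun v =>
    congrArg (fun A : TangentSpace (cotangentModel E) ℓ →L[ℝ] ℝ => A v)
      (mfderiv_const (I := cotangentModel E) (I' := 𝓘(ℝ, ℝ)) (c := u) (x := ℓ))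
  have h2 := differential_add_mul h0 hc hΦ (hamVF (PhiMinus f₁ ψ) ℓ)
  rw [hamVF_congr h1, differential_hamVF_swap hΦ h2.1, h2.2, differential_hamVF_self hΦ, hc',
    differential_hamLift_hamVF_PhiMinus hf₀ hf₁ hψ hℓ]
  ring

-- On `[0, 1]` the function `v ↦ h(ℓ, v)` is affine with slope `Φ⁻(ℓ)`; a maximum in the interior
-- forces slope zero. Comparison with `v = 0` and `v = 1` suffices.
omit [IsManifold 𝓘(ℝ, E) ∞ M] [FiniteDimensional ℝ E] in
lemma PhiMinus_eq_zero_of_isMaxOn {u : ℝ} (hu : u ∈ Ioo (0 : ℝ) 1)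
    (h : IsMaxOn (fun v => preHam f₀ f₁ ψ ℓ v) (Icc (-1 : ℝ) 1) u) : PhiMinus f₁ ψ ℓ = 0 := by
  have h0 : preHam f₀ f₁ ψ ℓ 0 ≤ preHam f₀ f₁ ψ ℓ u := h (by simp)
  have h1 : preHam f₀ f₁ ψ ℓ 1 ≤ preHam f₀ f₁ ψ ℓ u := h (by simp)
  simp only [preHam, abs_mul, abs_of_pos hu.1, abs_zero, abs_one] at h0 h1
  have e0 : 0 ≤ u * PhiMinus f₁ ψ ℓ := by rw [PhiMinus]; linarith
  have e1 : (1 - u) * PhiMinus f₁ ψ ℓ ≤ 0 := by rw [PhiMinus]; linarith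
  exact le_antisymm (nonpos_of_mul_nonpos_right e1 (by linarith [hu.2]))
    (nonneg_of_mul_nonneg_right e0 hu.1)

/-- The singular arc of a normal extremal lies in `S⁻`. -/
lemma IsNormalExtremal.mem_SMinus {T τ₁ τ₂ τ₃ : ℝ} {q₀ qT : M} {u : ℝ → ℝ}
    {lam : ℝ → Cotangent E M} (hf₀ : SmoothVF f₀) (hf₁ : SmoothVF f₁)
    (hψ : ContMDiff 𝓘(ℝ, E) 𝓘(ℝ, ℝ) ∞ ψ) (hu : IsBangSingularZeroBang T τ₁ τ₂ τ₃ u)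
    (hlam : IsNormalExtremal f₀ f₁ ψ T q₀ qT u lam) (hψpos : ∀ t ∈ Icc τ₁ τ₂, 0 < ψ (lam t).1)
    {t : ℝ} (ht : t ∈ Icc τ₁ τ₂) : lam t ∈ SMinus f₀ f₁ ψ := by
  have : CompleteSpace E := FiniteDimensional.complete ℝ E
  have hsub : Icc τ₁ τ₂ ⊆ Icc 0 T :=
    Icc_subset_Icc hu.pos.le (hu.lt₂₃.le.trans hu.lt₃.le)
  have hcont : ContinuousOn lam (Icc τ₁ τ₂) := hlam.absCont.1.mono hsub
  have hIoo : (Icc τ₁ τ₂ : Set ℝ) =ᵐ[volume] Ioo τ₁ τ₂ := Ioo_ae_eq_Icc.symm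
  have hΦc : ContinuousOn (fun t => PhiMinus f₁ ψ (lam t)) (Icc τ₁ τ₂) :=
    (contMDiffOn_PhiMinus hf₁ hψ).continuousOn.comp hcont hψpos
  have hsc : ContinuousOn (fun t => singFun f₀ f₁ ψ (lam t)) (Icc τ₁ τ₂) :=
    (contMDiff_singFun hf₀ hf₁ hψ).continuous.comp_continuousOn hcont
  -- Maximality holds only for almost every time; continuity extends the conclusion to the closed
  -- interval, end points included.
  have hΦ : EqOn (fun t => PhiMinus f₁ ψ (lam t)) (fun _ => 0) (Icc τ₁ τ₂) := by
    refine Measure.eqOn_Icc_of_ae_eq (μ := volume) hu.lt₁₂.ne ?_ hΦc continuousOn_const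
    rw [Measure.restrict_congr_set hIoo]
    filter_upwards [ae_restrict_of_ae_restrict_of_subset (Ioo_subset_Icc_self.trans hsub)
      hlam.maximality, ae_restrict_mem measurableSet_Ioo] with t h1 h2
    exact PhiMinus_eq_zero_of_isMaxOn (hu.singular t h2) h1
  have hs : EqOn (fun t => singFun f₀ f₁ ψ (lam t)) (fun _ => 0) (Icc τ₁ τ₂) := by
    refine Measure.eqOn_Icc_of_ae_eq (μ := volume) hu.lt₁₂.ne ?_ hsc continuousOn_const
    rw [Measure.restrict_congr_set hIoo]
    filter_upwards [ae_restrict_of_ae_restrict_of_subset (Ioo_subset_Icc_self.trans hsub)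
      hlam.hamiltonian_eq, ae_restrict_mem measurableSet_Ioo] with t h1 h2
    have hpos := hψpos t (Ioo_subset_Icc_self h2)
    have h3 := hasDerivAt_comp_curve (mdifferentiableAt_PhiMinus hf₁ hψ hpos) h1
    rw [differential_PhiMinus_hamVF_preHam hf₀ hf₁ hψ hpos (hu.singular t h2).1] at h3
    -- `Φ⁻` vanishes along the arc near `t`, so its derivative there, which is `F₀₁ - L_{f₀} ψ`, is
    -- zero.
    have h4 : (fun t => PhiMinus f₁ ψ (lam t)) =ᶠ[𝓝 t] fun _ => 0 := by
      filter_upwards [isOpen_Ioo.mem_nhds h2] with s hs using hΦ (Ioo_subset_Icc_self hs)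
    exact h3.unique ((hasDerivAt_const t (0 : ℝ)).congr_of_eventuallyEq h4)
  exact ⟨hΦ ht, hs ht⟩

end SingularArcExtremal

/-! ### The implicit time -/

lemma exists_implicit_zero {Z : Type*} [NormedAddCommGroup Z] [NormedSpace ℝ Z] [CompleteSpace Z]
    {g : Z × ℝ → ℝ} {z₀ : Z} {s₀ c : ℝ} (hg : ContDiffAt ℝ ∞ g (z₀, s₀)) (h0 : g (z₀, s₀) = 0)
    (hd : HasDerivAt (fun s => g (z₀, s)) c s₀) (hc : c ≠ 0) :
    ∃ τ : Z → ℝ, τ z₀ = s₀ ∧ ContDiffAt ℝ ∞ τ z₀ ∧ ∀ᶠ z in 𝓝 z₀, g (z, τ z) = 0 := by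
  have h1 : (fderiv ℝ g (z₀, s₀)).comp (ContinuousLinearMap.inr ℝ Z ℝ) =
      c • ContinuousLinearMap.id ℝ ℝ := by
    have h2 : HasFDerivAt (fun s : ℝ => (z₀, s)) (ContinuousLinearMap.inr ℝ Z ℝ) s₀ :=
      (hasFDerivAt_const z₀ s₀).prodMk (hasFDerivAt_id s₀)
    refine (((hg.differentiableAt (by simp)).hasFDerivAt).comp s₀ h2).unique
      (hd.hasFDerivAt.congr_fderiv ?_)
    ext
    simp
  have h2 : ((fderiv ℝ g (z₀, s₀)).comp (ContinuousLinearMap.inr ℝ Z ℝ)).IsInvertible := by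
    rw [h1]
    refine ContinuousLinearMap.IsInvertible.of_inverse (g := c⁻¹ • ContinuousLinearMap.id ℝ ℝ) ?_ ?_
    · ext; simp [hc]
    · ext; simp [hc]
  refine ⟨hg.implicitFunction (by simp) h2, hg.implicitFunction_apply_self (by simp) h2,
    hg.contDiffAt_implicitFunction (by simp) h2, ?_⟩
  have := hg.eventually_apply_implicitFunction (by simp) h2
  rwa [h0] at this

section ImplicitTime

variable {E : Type*} [NormedAddCommGroup E] [NormedSpace ℝ E] [FiniteDimensional ℝ E]
  {M : Type*} [TopologicalSpace M] [ChartedSpace E M] [IsManifold 𝓘(ℝ, E) ∞ M]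

lemma exists_implicit_zero_cotangent {g : ℝ × Cotangent E M → ℝ} {ℓ₀ : Cotangent E M} {s₀ c : ℝ}
    (hg : ContMDiffAt (𝓘(ℝ, ℝ).prod (cotangentModel E)) 𝓘(ℝ, ℝ) ∞ g (s₀, ℓ₀))
    (h0 : g (s₀, ℓ₀) = 0) (hd : HasDerivAt (fun s => g (s, ℓ₀)) c s₀) (hc : c ≠ 0) :
    ∃ τ : Cotangent E M → ℝ, τ ℓ₀ = s₀ ∧ ContMDiffAt (cotangentModel E) 𝓘(ℝ, ℝ) ∞ τ ℓ₀ ∧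
      ∀ᶠ ℓ in 𝓝 ℓ₀, g (τ ℓ, ℓ) = 0 := by
  have : CompleteSpace (E × (E →L[ℝ] ℝ)) := FiniteDimensional.complete ℝ _
  set χ := extChartAt (cotangentModel E) ℓ₀
  have hχ : χ.symm (χ ℓ₀) = ℓ₀ := χ.left_inv (mem_extChartAt_source ℓ₀)
  have h1 : ContMDiffAt 𝓘(ℝ, E × (E →L[ℝ] ℝ)) (cotangentModel E) ∞ χ.symm (χ ℓ₀) :=
    (contMDiffOn_extChartAt_symm ℓ₀).contMDiffAt
      ((isOpen_extChartAt_target ℓ₀).mem_nhds (mem_extChartAt_target ℓ₀))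
  have h2 : ContMDiffAt 𝓘(ℝ, (E × (E →L[ℝ] ℝ)) × ℝ) (𝓘(ℝ, ℝ).prod (cotangentModel E)) ∞
      (fun p : (E × (E →L[ℝ] ℝ)) × ℝ => (p.2, χ.symm p.1)) (χ ℓ₀, s₀) :=
    contDiffAt_snd.contMDiffAt.prodMk (h1.comp (χ ℓ₀, s₀) contDiffAt_fst.contMDiffAt)
  have h3 : ContDiffAt ℝ ∞ (fun p : (E × (E →L[ℝ] ℝ)) × ℝ => g (p.2, χ.symm p.1)) (χ ℓ₀, s₀) := by
    refine contMDiffAt_iff_contDiffAt.1 (ContMDiffAt.comp (χ ℓ₀, s₀) ?_ h2)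
    rw [hχ]
    exact hg
  obtain ⟨τ, hτ0, hτ, hτg⟩ := exists_implicit_zero h3 (by rw [hχ]; exact h0)
    (by
      show HasDerivAt (fun s => g (s, χ.symm (χ ℓ₀))) c s₀
      rw [hχ]
      exact hd) hc
  have h4 : ContMDiffAt (cotangentModel E) 𝓘(ℝ, E × (E →L[ℝ] ℝ)) ∞ χ ℓ₀ := contMDiffAt_extChartAt
  refine ⟨fun ℓ => τ (χ ℓ), hτ0, hτ.contMDiffAt.comp ℓ₀ h4, ?_⟩
  filter_upwards [h4.continuousAt.eventually hτg,
    (isOpen_extChartAt_source (I := cotangentModel E) ℓ₀).mem_nhds (mem_extChartAt_source ℓ₀)]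
    with ℓ hℓ hℓ'
  rwa [χ.left_inv hℓ'] at hℓ

/-- The open set where `ψ` and `𝕃` are positive. -/
def legendreSet (f₀ f₁ : ∀ q : M, TangentSpace 𝓘(ℝ, E) q) (ψ : M → ℝ) : Set (Cotangent E M) :=
  {ℓ | 0 < ψ ℓ.1} ∩ {ℓ | 0 < legendreFun f₀ f₁ ψ ℓ}

variable {f₀ f₁ : ∀ q : M, TangentSpace 𝓘(ℝ, E) q} {ψ : M → ℝ} {W : Set (Cotangent E M)}
  {δ s : ℝ} {ℓ : Cotangent E M}

lemma isOpen_legendreSet (hf₀ : SmoothVF f₀) (hf₁ : SmoothVF f₁)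
    (hψ : ContMDiff 𝓘(ℝ, E) 𝓘(ℝ, ℝ) ∞ ψ) : IsOpen (legendreSet f₀ f₁ ψ) :=
  (isOpen_setOf_pos hψ).inter
    (isOpen_lt continuous_const (contMDiff_legendreFun hf₀ hf₁ hψ).continuous)

lemma hasDerivAt_singFun_expFlow (hf₀ : SmoothVF f₀) (hf₁ : SmoothVF f₁)
    (hψ : ContMDiff 𝓘(ℝ, E) 𝓘(ℝ, ℝ) ∞ ψ)
    (h : IsFlowBox (PhiMinus f₁ ψ) (legendreSet f₀ f₁ ψ) W δ) (hℓ : ℓ ∈ W) (hs : s ∈ Ioo (-δ) δ) :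
    HasDerivAt (fun s => singFun f₀ f₁ ψ (expFlow (hamVF (PhiMinus f₁ ψ)) s ℓ))
      (legendreFun f₀ f₁ ψ (expFlow (hamVF (PhiMinus f₁ ψ)) s ℓ)) s := by
  have : CompleteSpace E := FiniteDimensional.complete ℝ E
  have h1 := hasDerivAt_comp_curve
    (((contMDiff_singFun hf₀ hf₁ hψ) _).mdifferentiableAt (by simp)) (h.velocity ℓ hℓ s hs)
  rwa [differential_singFun_hamVF_PhiMinus hf₀ hf₁ hψ (h.mem ℓ hℓ s hs).1] at h1

lemma hasDerivAt_hamLift_expFlow (hf₀ : SmoothVF f₀) (hf₁ : SmoothVF f₁)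
    (hψ : ContMDiff 𝓘(ℝ, E) 𝓘(ℝ, ℝ) ∞ ψ)
    (h : IsFlowBox (PhiMinus f₁ ψ) (legendreSet f₀ f₁ ψ) W δ) (hℓ : ℓ ∈ W) (hs : s ∈ Ioo (-δ) δ) :
    HasDerivAt (fun s => hamLift f₀ (expFlow (hamVF (PhiMinus f₁ ψ)) s ℓ))
      (- singFun f₀ f₁ ψ (expFlow (hamVF (PhiMinus f₁ ψ)) s ℓ)) s := by
  have h1 := hasDerivAt_comp_curve
    (((contMDiff_hamLift hf₀) _).mdifferentiableAt (by simp)) (h.velocity ℓ hℓ s hs)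
  rwa [differential_hamLift_hamVF_PhiMinus hf₀ hf₁ hψ (h.mem ℓ hℓ s hs).1] at h1

/-- The derivative is `𝕃`, positive because the box keeps the flow inside `legendreSet`. This single
fact gives uniqueness of the implicit time and strictness of the inequality. -/
lemma strictMonoOn_singFun_expFlow (hf₀ : SmoothVF f₀) (hf₁ : SmoothVF f₁)
    (hψ : ContMDiff 𝓘(ℝ, E) 𝓘(ℝ, ℝ) ∞ ψ)
    (h : IsFlowBox (PhiMinus f₁ ψ) (legendreSet f₀ f₁ ψ) W δ) (hℓ : ℓ ∈ W) :
    StrictMonoOn (fun s => singFun f₀ f₁ ψ (expFlow (hamVF (PhiMinus f₁ ψ)) s ℓ)) (Ioo (-δ) δ) := by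
  refine strictMonoOn_of_deriv_pos (convex_Ioo _ _) (fun s hs =>
    (hasDerivAt_singFun_expFlow hf₀ hf₁ hψ h hℓ hs).continuousAt.continuousWithinAt) fun s hs => ?_
  rw [interior_Ioo] at hs
  rw [(hasDerivAt_singFun_expFlow hf₀ hf₁ hψ h hℓ hs).deriv]
  exact (h.mem ℓ hℓ s hs).2

/-- The implicit time exists near a compact subset of `S⁻`. -/
lemma exists_isImplicitTime (hf₀ : SmoothVF f₀) (hf₁ : SmoothVF f₁)
    (hψ : ContMDiff 𝓘(ℝ, E) 𝓘(ℝ, ℝ) ∞ ψ)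
    (h : IsFlowBox (PhiMinus f₁ ψ) (legendreSet f₀ f₁ ψ) W δ) {K : Set (Cotangent E M)}
    (hK : K ⊆ W) (hKS : K ⊆ SMinus f₀ f₁ ψ) :
    ∃ (U : Set (Cotangent E M)) (θ : Cotangent E M → ℝ), IsImplicitTime f₀ f₁ ψ K U θ := by
  classical
  have : CompleteSpace E := FiniteDimensional.complete ℝ E
  have h0 : (0 : ℝ) ∈ Ioo (-δ) δ := ⟨by linarith [h.pos], h.pos⟩
  set G : ℝ × Cotangent E M → ℝ := fun p =>
    singFun f₀ f₁ ψ (expFlow (hamVF (PhiMinus f₁ ψ)) p.1 p.2) with hG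
  -- `U` collects every point of the box whose flow line meets the zero set within time `δ`.
  -- Uniqueness of that zero makes the choice in `θ` agree with each local implicit function, so no
  -- gluing is needed.
  let U : Set (Cotangent E M) := {ℓ | ℓ ∈ W ∧ ∃ s ∈ Ioo (-δ) δ, G (s, ℓ) = 0}
  let θ : Cotangent E M → ℝ := fun ℓ =>
    if hℓ : ∃ s ∈ Ioo (-δ) δ, G (s, ℓ) = 0 then hℓ.choose else 0
  have hθ : ∀ ℓ ∈ U, θ ℓ ∈ Ioo (-δ) δ ∧ G (θ ℓ, ℓ) = 0 := by
    intro ℓ hℓ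
    simp only [θ, dif_pos hℓ.2]
    exact hℓ.2.choose_spec
  have huniq : ∀ ℓ ∈ W, ∀ s ∈ Ioo (-δ) δ, G (s, ℓ) = 0 → θ ℓ = s := by
    intro ℓ hℓ s hs hs0
    have h1 := hθ ℓ ⟨hℓ, s, hs, hs0⟩
    exact (strictMonoOn_singFun_expFlow hf₀ hf₁ hψ h hℓ).injOn h1.1 hs (h1.2.trans hs0.symm)
  have hloc : ∀ ℓ ∈ U, ∃ τ : Cotangent E M → ℝ, ContMDiffAt (cotangentModel E) 𝓘(ℝ, ℝ) ∞ τ ℓ ∧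
      ∀ᶠ ℓ' in 𝓝 ℓ, ℓ' ∈ U ∧ θ ℓ' = τ ℓ' := by
    rintro ℓ hℓ
    obtain ⟨h1, h2⟩ := hθ ℓ hℓ
    obtain ⟨τ, hτ0, hτ, hτg⟩ := exists_implicit_zero_cotangent
      (((contMDiff_singFun hf₀ hf₁ hψ) _).comp (θ ℓ, ℓ) (h.smooth ℓ hℓ.1 _ h1)) h2
      (hasDerivAt_singFun_expFlow hf₀ hf₁ hψ h hℓ.1 h1) (h.mem ℓ hℓ.1 _ h1).2.ne'
    refine ⟨τ, hτ, ?_⟩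
    have h3 : ∀ᶠ ℓ' in 𝓝 ℓ, τ ℓ' ∈ Ioo (-δ) δ :=
      hτ.continuousAt.eventually_mem (isOpen_Ioo.mem_nhds (by rw [hτ0]; exact h1))
    filter_upwards [h3, hτg, h.isOpen.mem_nhds hℓ.1] with ℓ' e1 e2 e3
    exact ⟨⟨e3, _, e1, e2⟩, huniq ℓ' e3 _ e1 e2⟩
  refine ⟨U, θ, ?_, ?_, ?_, ?_, ?_, ?_⟩
  · refine isOpen_iff_mem_nhds.2 fun ℓ hℓ => ?_
    obtain ⟨τ, -, hτ⟩ := hloc ℓ hℓ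
    filter_upwards [hτ] with ℓ' h' using h'.1
  · intro ℓ hℓ
    refine ⟨hK hℓ, 0, h0, ?_⟩
    simp only [hG, h.zero ℓ (hK hℓ)]
    exact (hKS hℓ).2
  · intro ℓ hℓ
    obtain ⟨τ, hτ, hτ'⟩ := hloc ℓ hℓ
    refine (hτ.congr_of_eventuallyEq ?_).contMDiffWithinAt
    filter_upwards [hτ'] with ℓ' h' using h'.2
  · intro ℓ hℓ
    refine huniq ℓ (hK hℓ) 0 h0 ?_
    simp only [hG, h.zero ℓ (hK hℓ)]
    exact (hKS hℓ).2
  · exact fun ℓ hℓ => h.flowDefined ℓ hℓ.1 _ (hθ ℓ hℓ).1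
  · exact fun ℓ hℓ => (hθ ℓ hℓ).2

end ImplicitTime

/-! ### The Hamiltonian `H₀` -/

/-- If `-g'` is strictly increasing and vanishes at `θ`, then `g` has a strict maximum at `θ`. -/
lemma lt_of_hasDerivAt_neg_of_strictMonoOn {g G : ℝ → ℝ} {I : Set ℝ} {r θ : ℝ} (hI : I.OrdConnected)
    (hg : ∀ s ∈ I, HasDerivAt g (-G s) s) (hG : StrictMonoOn G I) (hr : r ∈ I) (hθ : θ ∈ I)
    (h0 : G θ = 0) (hne : θ ≠ r) : g r < g θ := by
  rcases lt_or_gt_of_ne hne with hlt | hlt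
  · have hsub : Icc θ r ⊆ I := hI.out hθ hr
    refine strictAntiOn_of_deriv_neg (convex_Icc θ r)
      (fun s hs => (hg s (hsub hs)).continuousAt.continuousWithinAt) (fun s hs => ?_)
      (left_mem_Icc.2 hlt.le) (right_mem_Icc.2 hlt.le) hlt
    rw [interior_Icc] at hs
    have hsI := hsub (Ioo_subset_Icc_self hs)
    rw [(hg s hsI).deriv]
    have := hG hθ hsI hs.1
    linarith
  · have hsub : Icc r θ ⊆ I := hI.out hr hθ
    refine strictMonoOn_of_deriv_pos (convex_Icc r θ)
      (fun s hs => (hg s (hsub hs)).continuousAt.continuousWithinAt) (fun s hs => ?_)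
      (left_mem_Icc.2 hlt.le) (right_mem_Icc.2 hlt.le) hlt
    rw [interior_Icc] at hs
    have hsI := hsub (Ioo_subset_Icc_self hs)
    rw [(hg s hsI).deriv]
    have := hG hsI hθ hs.2
    linarith

section ReducedHamiltonian

variable {E : Type*} [NormedAddCommGroup E] [NormedSpace ℝ E]
  {M : Type*} [TopologicalSpace M] [ChartedSpace E M] [IsManifold 𝓘(ℝ, E) ∞ M]
  {F A : Cotangent E M → ℝ} {ℓ : Cotangent E M} {O W : Set (Cotangent E M)} {δ s : ℝ}

/-- If `P(·, ℓ)` is stationary at `θ ℓ`, then `y ↦ P (θ y, y)` and `y ↦ P (θ ℓ, y)` have the same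
differential at `ℓ`. -/
lemma differential_graph_eq_of_stationary {P : ℝ × Cotangent E M → ℝ} {θ : Cotangent E M → ℝ}
    (hP : MDifferentiableAt (𝓘(ℝ, ℝ).prod (cotangentModel E)) 𝓘(ℝ, ℝ) P (θ ℓ, ℓ))
    (hθ : MDifferentiableAt (cotangentModel E) 𝓘(ℝ, ℝ) θ ℓ)
    (h0 : HasDerivAt (fun r => P (r, ℓ)) 0 (θ ℓ)) (v : TangentSpace (cotangentModel E) ℓ) :
    differential (fun y => P (θ y, y)) ℓ v = differential (fun y => P (θ ℓ, y)) ℓ v := by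
  have h1 := HasMFDerivAt.comp (f := fun y => (θ y, y)) (g := P) ℓ hP.hasMFDerivAt
    (hθ.hasMFDerivAt.prodMk (hasMFDerivAt_id ℓ))
  have h2 := HasMFDerivAt.comp (f := fun y => (θ ℓ, y)) (g := P) ℓ hP.hasMFDerivAt
    ((hasMFDerivAt_const (θ ℓ) ℓ).prodMk (hasMFDerivAt_id ℓ))
  have h3 := HasMFDerivAt.comp (f := fun r => (r, ℓ)) (g := P) (θ ℓ) hP.hasMFDerivAt
    ((hasMFDerivAt_id (I := 𝓘(ℝ, ℝ)) (θ ℓ)).prodMk (hasMFDerivAt_const ℓ (θ ℓ)))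
  have h4 := hasMFDerivAt_unique h3 (hasMFDerivAt_iff_hasFDerivAt.2 h0.hasFDerivAt)
  -- The chain rule gives `DP(dθ v, v)` on one side and `DP(0, v)` on the other; stationarity kills
  -- the time component.
  have h5 : ∀ (L : (ℝ × (E × (E →L[ℝ] ℝ))) →L[ℝ] ℝ) (_ : ∀ r : ℝ, L (r, 0) = 0) (r : ℝ)
      (v : E × (E →L[ℝ] ℝ)), L (r, v) = L (0, v) := by
    intro L hL r v
    have : ((r, v) : ℝ × (E × (E →L[ℝ] ℝ))) = (r, 0) + (0, v) := by simp
    rw [this, map_add, hL, zero_add]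
  refine (DFunLike.congr_fun h1.mfderiv v).trans (Eq.trans ?_ (DFunLike.congr_fun h2.mfderiv v).symm)
  refine h5 _ (fun r => (DFunLike.congr_fun h4 r).trans ?_) _ v
  exact mul_zero r

lemma IsFlowBox.mdifferentiableAt_expFlow (h : IsFlowBox F O W δ) (hℓ : ℓ ∈ W)
    (hs : s ∈ Ioo (-δ) δ) :
    MDifferentiableAt (cotangentModel E) (cotangentModel E) (expFlow (hamVF F) s) ℓ := by
  have h1 : ContMDiffAt (cotangentModel E) (𝓘(ℝ, ℝ).prod (cotangentModel E)) ∞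
      (fun y : Cotangent E M => (s, y)) ℓ := contMDiffAt_const.prodMk contMDiffAt_id
  exact ((h.smooth ℓ hℓ s hs).comp ℓ h1).mdifferentiableAt (by simp)

variable [FiniteDimensional ℝ E] [T2Space M]

/-- The Hamiltonian field of `A ∘ exp(s F⃗)` is the pull-back of that of `A`. -/
lemma IsFlowBox.hamVF_comp_expFlow (h : IsFlowBox F O W δ) (hO : IsOpen O)
    (hF : ContMDiffOn (cotangentModel E) 𝓘(ℝ, ℝ) ∞ F O) (hℓ : ℓ ∈ W) (hs : s ∈ Ioo (-δ) δ)
    (hm : expFlow (hamVF F) s ℓ ∈ W) (hA : MDifferentiableAt (cotangentModel E) 𝓘(ℝ, ℝ) A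
      (expFlow (hamVF F) s ℓ)) :
    hamVF (fun y => A (expFlow (hamVF F) s y)) ℓ = pullBackByFlow (hamVF F) (hamVF A) s ℓ := by
  have hs' : -s ∈ Ioo (-δ) δ := ⟨by linarith [hs.2], by linarith [hs.1]⟩
  have h1 := h.mdifferentiableAt_expFlow hℓ hs
  have h2 := hA.hasMFDerivAt.comp ℓ h1.hasMFDerivAt
  have h3 := (h.mdifferentiableAt_expFlow hm hs').hasMFDerivAt.comp ℓ h1.hasMFDerivAt
  have h4 := (hasMFDerivAt_id (I := cotangentModel E) ℓ).congr_of_eventuallyEq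
    (f₁ := fun y => expFlow (hamVF F) (-s) (expFlow (hamVF F) s y)) (by
      filter_upwards [h.isOpen.mem_nhds hℓ] with y hy using h.expFlow_neg hO hF hy hs)
  have h5 := hasMFDerivAt_unique h3 h4
  refine hamVF_eq_of_forall (F := fun y => A (expFlow (hamVF F) s y)) h2.mdifferentiableAt fun v => ?_
  have h6 : differential (fun y => A (expFlow (hamVF F) s y)) ℓ v =
      differential A (expFlow (hamVF F) s ℓ) (mfderiv (cotangentModel E) (cotangentModel E)
        (expFlow (hamVF F) s) ℓ v) := DFunLike.congr_fun h2.mfderiv v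
  -- Both arguments are moved back by the inverse flow, which is symplectic at the end point because
  -- that point lies in `W`. The first argument returns to `v`, and the second becomes the
  -- pulled-back field.
  rw [h6, differential_eq_symplecticForm hA, ← h.symplectic _ hm _ hs']
  have h7 : ∀ (ℓ' ℓ'' : Cotangent E M) (_ : ℓ' = ℓ'') (a a' b : E × (E →L[ℝ] ℝ)) (_ : a = a'),
    symplecticForm ℓ' a b = symplecticForm ℓ'' a' b := by rintro _ _ rfl _ _ _ rfl; rfl
  exact h7 _ _ (h.expFlow_neg hO hF hℓ hs) _ _ _ (DFunLike.congr_fun h5 v)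

/-- The derivative of `A ∘ exp(s F⃗)` along `F⃗`. -/
lemma IsFlowBox.differential_comp_expFlow_hamVF (h : IsFlowBox F O W δ) (hO : IsOpen O)
    (hF : ContMDiffOn (cotangentModel E) 𝓘(ℝ, ℝ) ∞ F O) (hℓ : ℓ ∈ W) (hs : s ∈ Ioo (-δ) δ)
    (hA : MDifferentiableAt (cotangentModel E) 𝓘(ℝ, ℝ) A (expFlow (hamVF F) s ℓ)) :
    differential (fun y => A (expFlow (hamVF F) s y)) ℓ (hamVF F ℓ) =
      differential A (expFlow (hamVF F) s ℓ) (hamVF F (expFlow (hamVF F) s ℓ)) := by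
  have h0 : (0 : ℝ) ∈ Ioo (-δ) δ := ⟨by linarith [h.pos], h.pos⟩
  have h1 := (hA.hasMFDerivAt.comp ℓ (h.mdifferentiableAt_expFlow hℓ hs).hasMFDerivAt).mdifferentiableAt
  have h2 := h.velocity ℓ hℓ 0 h0
  have h1' : MDifferentiableAt (cotangentModel E) 𝓘(ℝ, ℝ) (fun y => A (expFlow (hamVF F) s y))
      (expFlow (hamVF F) 0 ℓ) := by
    rw [h.zero ℓ hℓ]
    exact h1
  have h3 : HasDerivAt (fun r => A (expFlow (hamVF F) s (expFlow (hamVF F) r ℓ)))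
      (differential (fun y => A (expFlow (hamVF F) s y)) (expFlow (hamVF F) 0 ℓ)
        (hamVF F (expFlow (hamVF F) 0 ℓ))) 0 :=
    hasDerivAt_comp_curve (γ := fun r => expFlow (hamVF F) r ℓ) h1' h2
  rw [h.zero ℓ hℓ] at h3
  -- The two sides are derivatives at `r = 0` of `A(exp(s F⃗) exp(r F⃗) ℓ)` and `A(exp((r + s) F⃗)
  -- ℓ)`, which agree by the group law.
  have h4 := hasDerivAt_comp_curve (F := A) (γ := fun r => expFlow (hamVF F) r ℓ) hA (h.velocity ℓ hℓ s hs)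
  have h5 : HasDerivAt (fun r => A (expFlow (hamVF F) (r + s) ℓ)) (differential A
      (expFlow (hamVF F) s ℓ) (hamVF F (expFlow (hamVF F) s ℓ))) 0 :=
    HasDerivAt.comp_add_const 0 s (by rw [zero_add]; exact h4)
  refine h3.unique (h5.congr_of_eventuallyEq ?_)
  have h6 : ∀ᶠ r in 𝓝 (0 : ℝ), r + s ∈ Ioo (-δ) δ :=
    (continuous_id.add continuous_const).continuousAt.eventually_mem
      (isOpen_Ioo.mem_nhds (by simpa using hs))
  filter_upwards [isOpen_Ioo.mem_nhds h0, h6] with r hr hr'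
  rw [h.expFlow_add hO hF hℓ hr hr']

omit [FiniteDimensional ℝ E] [T2Space M] in
lemma hamVF_congr_of_differential {G : Cotangent E M → ℝ}
    (h : ∀ v, differential F ℓ v = differential G ℓ v) : hamVF F ℓ = hamVF G ℓ := by
  have h1 : differential F ℓ = differential G ℓ := funext h
  unfold hamVF
  rw [h1]

variable {f₀ f₁ : ∀ q : M, TangentSpace 𝓘(ℝ, E) q} {ψ : M → ℝ} {θ : Cotangent E M → ℝ}

omit [FiniteDimensional ℝ E] [T2Space M] in
lemma contMDiffAt_H0 (hf₀ : SmoothVF f₀)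
    (h : IsFlowBox (PhiMinus f₁ ψ) (legendreSet f₀ f₁ ψ) W δ) (hℓ : ℓ ∈ W)
    (hs : θ ℓ ∈ Ioo (-δ) δ) (hθ : ContMDiffAt (cotangentModel E) 𝓘(ℝ, ℝ) ∞ θ ℓ) :
    ContMDiffAt (cotangentModel E) (cotangentModel E) ∞
      (fun y => expFlow (hamVF (PhiMinus f₁ ψ)) (θ y) y) ℓ ∧
    ContMDiffAt (cotangentModel E) 𝓘(ℝ, ℝ) ∞ (H0 f₀ f₁ ψ θ) ℓ := by
  have h1 := ContMDiffAt.comp (f := fun y => (θ y, y)) ℓ (h.smooth ℓ hℓ _ hs)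
    (hθ.prodMk contMDiffAt_id)
  exact ⟨h1, ((contMDiff_hamLift hf₀) _).comp ℓ h1⟩

omit [T2Space M] in
/-- In the differential of `H₀` the time `θ` may be frozen. -/
lemma differential_H0 (hf₀ : SmoothVF f₀) (hf₁ : SmoothVF f₁)
    (hψ : ContMDiff 𝓘(ℝ, E) 𝓘(ℝ, ℝ) ∞ ψ)
    (h : IsFlowBox (PhiMinus f₁ ψ) (legendreSet f₀ f₁ ψ) W δ) (hℓ : ℓ ∈ W)
    (hs : θ ℓ ∈ Ioo (-δ) δ) (hθ : MDifferentiableAt (cotangentModel E) 𝓘(ℝ, ℝ) θ ℓ)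
    (h0 : singFun f₀ f₁ ψ (expFlow (hamVF (PhiMinus f₁ ψ)) (θ ℓ) ℓ) = 0)
    (v : TangentSpace (cotangentModel E) ℓ) :
    differential (H0 f₀ f₁ ψ θ) ℓ v =
      differential (fun y => hamLift f₀ (expFlow (hamVF (PhiMinus f₁ ψ)) (θ ℓ) y)) ℓ v := by
  have h1 := hasDerivAt_hamLift_expFlow hf₀ hf₁ hψ h hℓ hs
  rw [h0, neg_zero] at h1
  have h2 := (((contMDiff_hamLift hf₀) _).comp (θ ℓ, ℓ) (h.smooth ℓ hℓ _ hs)).mdifferentiableAt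
    (by simp)
  exact differential_graph_eq_of_stationary
    (P := fun p => hamLift f₀ (expFlow (hamVF (PhiMinus f₁ ψ)) p.1 p.2)) h2 hθ h1 v

/-- With the time frozen, this is the derivative of `F₀` along `Φ⃗⁻` at the end point, namely `-(F₀₁
- L_{f₀} ψ ∘ π)` there, which the implicit equation makes zero. -/
lemma differential_H0_hamVF_PhiMinus (hf₀ : SmoothVF f₀) (hf₁ : SmoothVF f₁)
    (hψ : ContMDiff 𝓘(ℝ, E) 𝓘(ℝ, ℝ) ∞ ψ)
    (h : IsFlowBox (PhiMinus f₁ ψ) (legendreSet f₀ f₁ ψ) W δ) (hℓ : ℓ ∈ W)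
    (hs : θ ℓ ∈ Ioo (-δ) δ) (hθ : MDifferentiableAt (cotangentModel E) 𝓘(ℝ, ℝ) θ ℓ)
    (h0 : singFun f₀ f₁ ψ (expFlow (hamVF (PhiMinus f₁ ψ)) (θ ℓ) ℓ) = 0) :
    differential (H0 f₀ f₁ ψ θ) ℓ (hamVF (PhiMinus f₁ ψ) ℓ) = 0 := by
  rw [differential_H0 hf₀ hf₁ hψ h hℓ hs hθ h0,
    h.differential_comp_expFlow_hamVF (isOpen_legendreSet hf₀ hf₁ hψ)
      ((contMDiffOn_PhiMinus hf₁ hψ).mono inter_subset_left) hℓ hs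
      (((contMDiff_hamLift hf₀) _).mdifferentiableAt (by simp)),
    differential_hamLift_hamVF_PhiMinus hf₀ hf₁ hψ (h.mem ℓ hℓ _ hs).1, h0, neg_zero]

omit [T2Space M] in
/-- `exp(s Φ⃗⁻)(ℓ)` maximises `F₀` along the flow line at the zero of `F₀₁ - L_{f₀} ψ ∘ π`. -/
lemma hamLift_lt_H0 (hf₀ : SmoothVF f₀) (hf₁ : SmoothVF f₁)
    (hψ : ContMDiff 𝓘(ℝ, E) 𝓘(ℝ, ℝ) ∞ ψ)
    (h : IsFlowBox (PhiMinus f₁ ψ) (legendreSet f₀ f₁ ψ) W δ) (hℓ : ℓ ∈ W)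
    (hs : θ ℓ ∈ Ioo (-δ) δ) (h0 : singFun f₀ f₁ ψ (expFlow (hamVF (PhiMinus f₁ ψ)) (θ ℓ) ℓ) = 0)
    (hne : θ ℓ ≠ 0) : hamLift f₀ ℓ < H0 f₀ f₁ ψ θ ℓ := by
  have hz : (0 : ℝ) ∈ Ioo (-δ) δ := ⟨by linarith [h.pos], h.pos⟩
  have h1 := lt_of_hasDerivAt_neg_of_strictMonoOn
    (g := fun s => hamLift f₀ (expFlow (hamVF (PhiMinus f₁ ψ)) s ℓ)) ordConnected_Ioo
    (fun s hs => hasDerivAt_hamLift_expFlow hf₀ hf₁ hψ h hℓ hs)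
    (strictMonoOn_singFun_expFlow hf₀ hf₁ hψ h hℓ) hz hs h0 hne
  simp only [h.zero ℓ hℓ] at h1
  exact h1

omit [T2Space M] in
lemma eq_zero_iff_singFun_eq_zero (hf₀ : SmoothVF f₀) (hf₁ : SmoothVF f₁)
    (hψ : ContMDiff 𝓘(ℝ, E) 𝓘(ℝ, ℝ) ∞ ψ)
    (h : IsFlowBox (PhiMinus f₁ ψ) (legendreSet f₀ f₁ ψ) W δ) (hℓ : ℓ ∈ W)
    (hs : θ ℓ ∈ Ioo (-δ) δ)
    (h0 : singFun f₀ f₁ ψ (expFlow (hamVF (PhiMinus f₁ ψ)) (θ ℓ) ℓ) = 0) :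
    θ ℓ = 0 ↔ singFun f₀ f₁ ψ ℓ = 0 := by
  have hz : (0 : ℝ) ∈ Ioo (-δ) δ := ⟨by linarith [h.pos], h.pos⟩
  constructor
  · intro h1
    rwa [h1, h.zero ℓ hℓ] at h0
  · intro h1
    refine (strictMonoOn_singFun_expFlow hf₀ hf₁ hψ h hℓ).injOn hs hz ?_
    simp only [h.zero ℓ hℓ, h0, h1]

lemma hamVF_H0_eq_pullBackByFlow (hf₀ : SmoothVF f₀) (hf₁ : SmoothVF f₁)
    (hψ : ContMDiff 𝓘(ℝ, E) 𝓘(ℝ, ℝ) ∞ ψ)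
    (h : IsFlowBox (PhiMinus f₁ ψ) (legendreSet f₀ f₁ ψ) W δ) (hℓ : ℓ ∈ W)
    (hs : θ ℓ ∈ Ioo (-δ) δ) (hθ : MDifferentiableAt (cotangentModel E) 𝓘(ℝ, ℝ) θ ℓ)
    (hm : expFlow (hamVF (PhiMinus f₁ ψ)) (θ ℓ) ℓ ∈ W)
    (h0 : singFun f₀ f₁ ψ (expFlow (hamVF (PhiMinus f₁ ψ)) (θ ℓ) ℓ) = 0) :
    hamVF (H0 f₀ f₁ ψ θ) ℓ =
      pullBackByFlow (hamVF (PhiMinus f₁ ψ)) (hamVF (hamLift f₀)) (θ ℓ) ℓ := by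
  rw [hamVF_congr_of_differential (differential_H0 hf₀ hf₁ hψ h hℓ hs hθ h0)]
  exact h.hamVF_comp_expFlow (isOpen_legendreSet hf₀ hf₁ hψ)
    ((contMDiffOn_PhiMinus hf₁ hψ).mono inter_subset_left) hℓ hs hm
    (((contMDiff_hamLift hf₀) _).mdifferentiableAt (by simp))

omit [T2Space M] in
lemma hamVF_H0_eq_hamVF_hamLift (hf₀ : SmoothVF f₀) (hf₁ : SmoothVF f₁)
    (hψ : ContMDiff 𝓘(ℝ, E) 𝓘(ℝ, ℝ) ∞ ψ)
    (h : IsFlowBox (PhiMinus f₁ ψ) (legendreSet f₀ f₁ ψ) W δ) (hℓ : ℓ ∈ W)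
    (hs : θ ℓ ∈ Ioo (-δ) δ) (hθ : MDifferentiableAt (cotangentModel E) 𝓘(ℝ, ℝ) θ ℓ)
    (h0 : singFun f₀ f₁ ψ (expFlow (hamVF (PhiMinus f₁ ψ)) (θ ℓ) ℓ) = 0) (hz : θ ℓ = 0) :
    hamVF (H0 f₀ f₁ ψ θ) ℓ = hamVF (hamLift f₀) ℓ := by
  rw [hamVF_congr_of_differential (differential_H0 hf₀ hf₁ hψ h hℓ hs hθ h0), hz]
  refine hamVF_congr ?_
  filter_upwards [h.isOpen.mem_nhds hℓ] with y hy
  rw [h.zero y hy]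

/-- Tangency to `Σ⁻` of the fields of the functions `H₀ + υ Φ⁻`. -/
lemma isTangentTo_hamVF_H0_add_mul (hf₀ : SmoothVF f₀) (hf₁ : SmoothVF f₁)
    (hψ : ContMDiff 𝓘(ℝ, E) 𝓘(ℝ, ℝ) ∞ ψ)
    (h : IsFlowBox (PhiMinus f₁ ψ) (legendreSet f₀ f₁ ψ) W δ) (hℓ : ℓ ∈ W)
    (hs : θ ℓ ∈ Ioo (-δ) δ) (hθ : ContMDiffAt (cotangentModel E) 𝓘(ℝ, ℝ) ∞ θ ℓ)
    (h0 : singFun f₀ f₁ ψ (expFlow (hamVF (PhiMinus f₁ ψ)) (θ ℓ) ℓ) = 0)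
    (hmem : ℓ ∈ SigmaMinus f₁ ψ) {g : Cotangent E M → ℝ}
    (hg : MDifferentiableAt (cotangentModel E) 𝓘(ℝ, ℝ) g ℓ) :
    IsTangentTo (SigmaMinus f₁ ψ) ℓ
      (hamVF (fun y => H0 f₀ f₁ ψ θ y + g y * PhiMinus f₁ ψ y) ℓ) := by
  have hpos : 0 < ψ ℓ.1 := by
    have := (h.mem ℓ hℓ 0 ⟨by linarith [h.pos], h.pos⟩).1
    rwa [h.zero ℓ hℓ] at this
  have hΦ := mdifferentiableAt_PhiMinus hf₁ hψ hpos
  have h1 := differential_add_mul ((contMDiffAt_H0 hf₀ h hℓ hs hθ).2.mdifferentiableAt (by simp))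
    hg hΦ (hamVF (PhiMinus f₁ ψ) ℓ)
  have h2 : PhiMinus f₁ ψ ℓ = 0 := hmem
  refine isTangentTo_SigmaMinus hf₁ hψ hpos hmem ?_
  -- Antisymmetry reduces the claim to differentiating `H₀ + g Φ⁻` along `Φ⃗⁻`. The term with `dΦ⁻`
  -- is a self-bracket, the term with `dg` carries the factor `Φ⁻(ℓ) = 0`, and `dH₀` vanishes on
  -- `Φ⃗⁻`.
  rw [differential_hamVF_swap hΦ h1.1, h1.2, differential_hamVF_self hΦ, h2,
    differential_H0_hamVF_PhiMinus hf₀ hf₁ hψ h hℓ hs (hθ.mdifferentiableAt (by simp)) h0]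
  ring

end ReducedHamiltonian

end SingularArc

end

/-! ### Assembly of the theorem -/

theorem mainTheorem3
    {E : Type*} [NormedAddCommGroup E] [NormedSpace ℝ E] [FiniteDimensional ℝ E]
    {M : Type*} [TopologicalSpace M] [T2Space M] [ChartedSpace E M] [IsManifold 𝓘(ℝ, E) ∞ M]
    (f₀ f₁ : ∀ q : M, TangentSpace 𝓘(ℝ, E) q)
    (hf₀ : SingularArc.SmoothVF f₀) (hf₁ : SingularArc.SmoothVF f₁)
    (ψ : M → ℝ) (hψ : ContMDiff 𝓘(ℝ, E) 𝓘(ℝ, ℝ) ∞ ψ)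
    (T τ₁ τ₂ τ₃ : ℝ) (q₀ qT : M) (u : ℝ → ℝ) (lam : ℝ → SingularArc.Cotangent E M)
    (hu : SingularArc.IsBangSingularZeroBang T τ₁ τ₂ τ₃ u)
    (hlam : SingularArc.IsNormalExtremal f₀ f₁ ψ T q₀ qT u lam)
    (hψpos : ∀ t ∈ Icc τ₁ τ₂, 0 < ψ (lam t).1)
    (hSGLC : ∀ t ∈ Icc τ₁ τ₂, 0 < SingularArc.legendreFun f₀ f₁ ψ (lam t)) :
    (∃ (U : Set (SingularArc.Cotangent E M)) (θ : SingularArc.Cotangent E M → ℝ),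
      SingularArc.IsImplicitTime f₀ f₁ ψ (lam '' Icc τ₁ τ₂) U θ) ∧
    ∀ (U : Set (SingularArc.Cotangent E M)) (θ : SingularArc.Cotangent E M → ℝ),
      SingularArc.IsImplicitTime f₀ f₁ ψ (lam '' Icc τ₁ τ₂) U θ →
      ∃ V ⊆ U, IsOpen V ∧ lam '' Icc τ₁ τ₂ ⊆ V ∧
        ContMDiffOn (SingularArc.cotangentModel E) 𝓘(ℝ, ℝ) ∞ (SingularArc.PhiMinus f₁ ψ) V ∧
        ContMDiffOn (SingularArc.cotangentModel E) 𝓘(ℝ, ℝ) ∞ (SingularArc.H0 f₀ f₁ ψ θ) V ∧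
        -- the field of `H₀` on `Σ⁻`: tangency, and the formula in terms of the flow of `Φ⁻`
        (∀ ℓ ∈ SingularArc.SigmaMinus f₁ ψ ∩ V,
          SingularArc.IsTangentTo (SingularArc.SigmaMinus f₁ ψ) ℓ
            (SingularArc.hamVF (SingularArc.H0 f₀ f₁ ψ θ) ℓ) ∧
          SingularArc.expFlow (SingularArc.hamVF (SingularArc.PhiMinus f₁ ψ)) (-θ ℓ)
            (SingularArc.expFlow (SingularArc.hamVF (SingularArc.PhiMinus f₁ ψ)) (θ ℓ) ℓ) = ℓ ∧
          MDifferentiableAt (SingularArc.cotangentModel E) (SingularArc.cotangentModel E)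
            (SingularArc.expFlow (SingularArc.hamVF (SingularArc.PhiMinus f₁ ψ)) (-θ ℓ))
            (SingularArc.expFlow (SingularArc.hamVF (SingularArc.PhiMinus f₁ ψ)) (θ ℓ) ℓ) ∧
          SingularArc.hamVF (SingularArc.H0 f₀ f₁ ψ θ) ℓ =
            SingularArc.pullBackByFlow (SingularArc.hamVF (SingularArc.PhiMinus f₁ ψ))
              (SingularArc.hamVF (SingularArc.hamLift f₀)) (θ ℓ) ℓ) ∧
        -- on `S⁻` it is the field of `F₀`
        (∀ ℓ ∈ SingularArc.SMinus f₀ f₁ ψ ∩ V,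
          SingularArc.hamVF (SingularArc.H0 f₀ f₁ ψ θ) ℓ =
            SingularArc.hamVF (SingularArc.hamLift f₀) ℓ) ∧
        -- `H₀ ≥ F₀` on `Σ⁻`, with equality exactly on `S⁻`
        (∀ ℓ ∈ SingularArc.SigmaMinus f₁ ψ ∩ V,
          SingularArc.hamLift f₀ ℓ ≤ SingularArc.H0 f₀ f₁ ψ θ ℓ ∧
          (SingularArc.H0 f₀ f₁ ψ θ ℓ = SingularArc.hamLift f₀ ℓ ↔
            ℓ ∈ SingularArc.SMinus f₀ f₁ ψ)) ∧
        -- the field of `H₀ + υ Φ⁻` is tangent to `Σ⁻`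
        (∀ υ : ℝ × SingularArc.Cotangent E M → ℝ,
          ContMDiff (𝓘(ℝ, ℝ).prod (SingularArc.cotangentModel E)) 𝓘(ℝ, ℝ) ∞ υ →
          ∀ t : ℝ, ∀ ℓ ∈ SingularArc.SigmaMinus f₁ ψ ∩ V,
            SingularArc.IsTangentTo (SingularArc.SigmaMinus f₁ ψ) ℓ
              (SingularArc.hamVF (fun ℓ' => SingularArc.H0 f₀ f₁ ψ θ ℓ' +
                υ (t, ℓ') * SingularArc.PhiMinus f₁ ψ ℓ') ℓ)) := by
  have hf := SingularArc.contMDiffOn_PhiMinus hf₁ hψ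
  have hK : IsCompact (lam '' Icc τ₁ τ₂) := isCompact_Icc.image_of_continuousOn
    (hlam.absCont.1.mono (Icc_subset_Icc hu.pos.le (hu.lt₂₃.le.trans hu.lt₃.le)))
  have hKS : lam '' Icc τ₁ τ₂ ⊆ SingularArc.SMinus f₀ f₁ ψ := by
    rintro _ ⟨t, ht, rfl⟩
    exact hlam.mem_SMinus hf₀ hf₁ hψ hu hψpos ht
  have hKO : lam '' Icc τ₁ τ₂ ⊆ SingularArc.legendreSet f₀ f₁ ψ := by
    rintro _ ⟨t, ht, rfl⟩
    exact ⟨hψpos t ht, hSGLC t ht⟩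
  have hO := SingularArc.isOpen_legendreSet hf₀ hf₁ hψ
  have hfO := hf.mono (inter_subset_left :
    SingularArc.legendreSet f₀ f₁ ψ ⊆ {ℓ : SingularArc.Cotangent E M | 0 < ψ ℓ.1})
  obtain ⟨W, δ, hKW, h⟩ := SingularArc.exists_isFlowBox_of_isCompact hO hfO hK hKO
  refine ⟨SingularArc.exists_isImplicitTime hf₀ hf₁ hψ h hKW hKS, fun U θ hθ => ?_⟩
  have hz : (0 : ℝ) ∈ Ioo (-δ) δ := ⟨by linarith [h.pos], h.pos⟩
  have hV₁ : IsOpen ((U ∩ W) ∩ θ ⁻¹' Ioo (-δ) δ) :=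
    (hθ.smooth.continuousOn.mono inter_subset_left).isOpen_inter_preimage
      (hθ.isOpen.inter h.isOpen) isOpen_Ioo
  have hθat : ∀ ℓ ∈ U, ContMDiffAt (SingularArc.cotangentModel E) 𝓘(ℝ, ℝ) ∞ θ ℓ := fun ℓ hℓ =>
    hθ.smooth.contMDiffAt (hθ.isOpen.mem_nhds hℓ)
  have hsm : ∀ ℓ ∈ (U ∩ W) ∩ θ ⁻¹' Ioo (-δ) δ, _ := fun ℓ hℓ =>
    SingularArc.contMDiffAt_H0 (f₀ := f₀) hf₀ h hℓ.1.2 hℓ.2 (hθat ℓ hℓ.1.1)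
  have hpos : ∀ ℓ ∈ W, 0 < ψ ℓ.1 := fun ℓ hℓ => by
    have := (h.mem ℓ hℓ 0 hz).1
    rwa [h.zero ℓ hℓ] at this
  -- An arbitrary implicit time is cut down to the flow box: `|θ| < δ` makes the monotonicity
  -- arguments available, and an end point in `W` permits flowing back. Both conditions are open and
  -- hold on `K`, where `θ = 0`.
  refine ⟨((U ∩ W) ∩ θ ⁻¹' Ioo (-δ) δ) ∩
      (fun ℓ => SingularArc.expFlow (SingularArc.hamVF (SingularArc.PhiMinus f₁ ψ)) (θ ℓ) ℓ) ⁻¹' W,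
    fun ℓ hℓ => hℓ.1.1.1, ?_, ?_, ?_, ?_, ?_, ?_, ?_, ?_⟩
  · exact ContinuousOn.isOpen_inter_preimage
      (fun ℓ hℓ => (hsm ℓ hℓ).1.continuousAt.continuousWithinAt) hV₁ h.isOpen
  · intro ℓ hℓ
    have h1 := hθ.zero_on ℓ hℓ
    refine ⟨⟨⟨hθ.subset hℓ, hKW hℓ⟩, ?_⟩, ?_⟩
    · rw [mem_preimage, h1]
      exact hz
    · rw [mem_preimage, h1, h.zero ℓ (hKW hℓ)]
      exact hKW hℓ
  · exact hf.mono fun ℓ hℓ => hpos ℓ hℓ.1.1.2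
  · exact fun ℓ hℓ => (hsm ℓ hℓ.1).2.contMDiffWithinAt
  · rintro ℓ ⟨hmem, ⟨⟨hU, hW⟩, hI⟩, hm⟩
    have hI' : -θ ℓ ∈ Ioo (-δ) δ := ⟨by linarith [hI.2], by linarith [hI.1]⟩
    refine ⟨?_, h.expFlow_neg hO hfO hW hI, h.mdifferentiableAt_expFlow hm hI',
      SingularArc.hamVF_H0_eq_pullBackByFlow hf₀ hf₁ hψ h hW hI
        ((hθat ℓ hU).mdifferentiableAt (by simp)) hm (hθ.equation ℓ hU)⟩
    -- Tangency of `H⃗₀` itself is the case of zero multiplier.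
    have h1 := SingularArc.isTangentTo_hamVF_H0_add_mul hf₀ hf₁ hψ h hW hI (hθat ℓ hU)
      (hθ.equation ℓ hU) hmem (g := fun _ => 0) mdifferentiableAt_const
    simpa only [zero_mul, add_zero] using h1
  · rintro ℓ ⟨hS, ⟨⟨hU, hW⟩, hI⟩, -⟩
    exact SingularArc.hamVF_H0_eq_hamVF_hamLift hf₀ hf₁ hψ h hW hI
      ((hθat ℓ hU).mdifferentiableAt (by simp)) (hθ.equation ℓ hU)
      ((SingularArc.eq_zero_iff_singFun_eq_zero hf₀ hf₁ hψ h hW hI (hθ.equation ℓ hU)).2 hS.2)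
  · rintro ℓ ⟨hmem, ⟨⟨hU, hW⟩, hI⟩, -⟩
    have hiff := SingularArc.eq_zero_iff_singFun_eq_zero hf₀ hf₁ hψ h hW hI (hθ.equation ℓ hU)
    have heq : θ ℓ = 0 → SingularArc.H0 f₀ f₁ ψ θ ℓ = SingularArc.hamLift f₀ ℓ := fun h1 => by
      rw [SingularArc.H0, h1, h.zero ℓ hW]
    have hlt := SingularArc.hamLift_lt_H0 hf₀ hf₁ hψ h hW hI (hθ.equation ℓ hU)
    by_cases h1 : θ ℓ = 0
    · exact ⟨(heq h1).ge, fun _ => ⟨hmem, hiff.1 h1⟩, fun _ => heq h1⟩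
    · exact ⟨(hlt h1).le, fun h2 => absurd h2 (hlt h1).ne', fun h2 => absurd (hiff.2 h2.2) h1⟩
  · rintro υ hυ t ℓ ⟨hmem, ⟨⟨hU, hW⟩, hI⟩, -⟩
    have h1 : ContMDiff (SingularArc.cotangentModel E)
        (𝓘(ℝ, ℝ).prod (SingularArc.cotangentModel E)) ∞
        (fun ℓ' : SingularArc.Cotangent E M => (t, ℓ')) := contMDiff_const.prodMk contMDiff_id
    exact SingularArc.isTangentTo_hamVF_H0_add_mul hf₀ hf₁ hψ h hW hI (hθat ℓ hU)
      (hθ.equation ℓ hU) hmem (((hυ.comp h1) ℓ).mdifferentiableAt (by simp))
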